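/- Let $K$ be a field of characteristic zero, $\overline K$ its algebraic closure; algebras are associative unital $K$-algebras. For an algebra $A$ with centre $Z(A)$ put $\overline A=\overline K\otimes_K A\supseteq A$. For $a\in A$ let $\delta=\operatorname{ad} a$, $\delta(b)=ab-ba$, and - $C(a)=\ker\delta=\{b\in A: ab=ba\}$, - $N(a)=\bigcup_{i\ge 0}\ker\delta^{i+1}$, - $D(a)=A\cap\bigoplus_{\lambda\in\overline K}\{b\in\overline A:\delta(b)=\lambda b\}$ ($\delta$ extended $\overline K$-linearly to $\overline A$), - $F(a)=\{b\in A:\dim_K K[\delta]b<\infty\}$. An element $a\in A\setminus Z(A)$ is called *strongly nilpotent* if $N(a)=A$ and $D(a)=C(a)$; *weakly nilpotent* if $C(a)\ne N(a)\ne A$ and $D(a)=C(a)$; *strongly semi-simple* if $N(a)=C(a)$ and $D(a)=A$; *weakly semi-simple* if $N(a)=C(a)$ and $C(a)\neq D(a)=F(a)\ne A$; *generic* if $N(a)=D(a)=C(a)$. The algebra $A$ *admits the Dixmier partition* if every element of $A\setminus Z(A)$ has one of these five types. A noncommutative algebra $A$ that admits the Dixmier partition satisfies the *homogeneous centralizer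 condition* (hcc) if for each $a\in A\setminus Z(A)$ exactly one of the following holds: (1) all elements of $C(a)\setminus Z(A)$ are strongly nilpotent; (2) all are weakly nilpotent; (3) there is a strongly semi-simple $c\in C(a)$ such that the elements of $K^*c+Z(A)$ are strongly semi-simple and all other elements of $C(a)\setminus Z(A)$ are generic; (4) the same as (3) with "weakly semi-simple" in place of "strongly semi-simple"; (5) all elements of $C(a)\setminus Z(A)$ are generic. Here $K^*=K\setminus\{0\}$. A noncommutative algebra $A$ satisfies the *commutative centralizer condition* (ccc) if $C(a)$ is commutative for every $a\in A\setminus Z(A)$. Let $A_1=K\langle x,\partial\mid \partial x-x\partial=1\rangle$ be the first Weyl algebra and $Q(A_1)$ its division ring of fractions. For a nonzero polynomial $a\in K[H]$ let $$A(a)=K\langle X,Y,H\mid XH=(H-1)X,\ YH=(H+1)Y,\ YX=a(H),\ XY=a(H-1)\rangle$$ (the noncommutative deformations of type-A Kleinian singularities). The Gelfand–Kirillov dimension of $A$ is $\operatorname{GK}(A)=\sup_V\limsup_{n\to\infty}\frac{\log\dim_K(K+V+\dots+V^n)}{\log n}$, where $V$ runs over the finite dimensional subspaces of $A$. **Corollary.**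 1. The Weyl division ring $Q(A_1)$ satisfies the ccc. 2. The Weyl algebra $A_1$, the algebras $A(a)$ for all $0\ne a\in K[H]$, and every noncommutative $K$-subalgebra $A$ of $Q(A_1)$ with $\operatorname{GK}(A)<3$ admit the Dixmier partition and satisfy both the hcc and the ccc. -/

import Mathlib

open scoped Polynomial TensorProduct nonZeroDivisors

universe u v

noncomputable section

/-! ## The kernel, nil-algebra, eigenvalue algebra and torsion algebra of a derivation -/

section Types

variable (K : Type u) [Field K] {A : Type v} [Ring A] [Algebra K A]

/-- `C(δ) = ker δ`. -/
def kernelAlg (δ : Module.End K A) : Submodule K A := LinearMap.ker δ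

/-- `N(δ) = ⋃ i, ker δ ^ (i + 1)` (an increasing union, hence equal to the supremum). -/
def nilAlg (δ : Module.End K A) : Submodule K A := ⨆ i : ℕ, LinearMap.ker (δ ^ (i + 1))

/-- `D(δ) = A ∩ D(δ, A')`, where `A' = K' ⊗ A` with `K'` the algebraic closure of `K`, and
`D(δ, A')` is the sum of all eigenspaces in `A'` of the extension of `δ` to `A'`. -/
def eigenAlg (δ : Module.End K A) : Submodule K A :=
  Submodule.comap (TensorProduct.mk K (AlgebraicClosure K) A 1)
    (Submodule.restrictScalars K
      (⨆ μ : AlgebraicClosure K,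
        Module.End.eigenspace (LinearMap.baseChange (AlgebraicClosure K) δ) μ))

/-- `F(δ) = {a | dim K[δ]a < ∞}`, where `K[δ]a` is the span of `a, δ a, δ² a, …`. -/
def torsionAlg (δ : Module.End K A) : Submodule K A where
  carrier := {a | (Submodule.span K (Set.range fun n : ℕ => (δ ^ n) a)).FG}
  zero_mem' := by
    have : (Set.range fun n : ℕ => (δ ^ n) (0 : A)) = {0} := by
      simp
    simp only [Set.mem_ofPred_eq, this]
    exact Submodule.fg_span (Set.finite_singleton _)
  add_mem' := by
    intro a b ha hb
    have hab := ha.sup hb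
    have := (IsNoetherian.iff_fg (K := K)).2 (Module.Finite.iff_fg.2 hab)
    refine Submodule.FG.of_le hab (Submodule.span_le.2 ?_)
    rintro _ ⟨n, rfl⟩
    simp only [map_add]
    exact Submodule.add_mem_sup (Submodule.subset_span ⟨n, rfl⟩) (Submodule.subset_span ⟨n, rfl⟩)
  smul_mem' := by
    intro c a ha
    have := (IsNoetherian.iff_fg (K := K)).2 (Module.Finite.iff_fg.2 ha)
    refine Submodule.FG.of_le ha (Submodule.span_le.2 ?_)
    rintro _ ⟨n, rfl⟩
    simp only [map_smul]
    exact Submodule.smul_mem _ _ (Submodule.subset_span ⟨n, rfl⟩)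

/-- The inner derivation `b ↦ a * b - b * a`. -/
def innerDer (a : A) : Module.End K A := LinearMap.mulLeft K a - LinearMap.mulRight K a

/-! ## The types of non-central elements -/

/-- `Δ₁(A)`. -/
def IsStronglyNilpotentElt (a : A) : Prop :=
  a ∉ Subalgebra.center K A ∧
    nilAlg K (innerDer K a) = ⊤ ∧
    eigenAlg K (innerDer K a) = kernelAlg K (innerDer K a)

/-- `Δ₂(A)`. -/
def IsWeaklyNilpotentElt (a : A) : Prop :=
  a ∉ Subalgebra.center K A ∧
    kernelAlg K (innerDer K a) ≠ nilAlg K (innerDer K a) ∧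
    nilAlg K (innerDer K a) ≠ ⊤ ∧
    eigenAlg K (innerDer K a) = kernelAlg K (innerDer K a)

/-- `Δ₃(A)`. -/
def IsStronglySemisimpleElt (a : A) : Prop :=
  a ∉ Subalgebra.center K A ∧
    nilAlg K (innerDer K a) = kernelAlg K (innerDer K a) ∧
    eigenAlg K (innerDer K a) = ⊤

/-- `Δ₄(A)`. -/
def IsWeaklySemisimpleElt (a : A) : Prop :=
  a ∉ Subalgebra.center K A ∧
    nilAlg K (innerDer K a) = kernelAlg K (innerDer K a) ∧
    kernelAlg K (innerDer K a) ≠ eigenAlg K (innerDer K a) ∧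
    eigenAlg K (innerDer K a) = torsionAlg K (innerDer K a) ∧
    torsionAlg K (innerDer K a) ≠ ⊤

/-- `Δ₅(A)`. -/
def IsGenericElt (a : A) : Prop :=
  a ∉ Subalgebra.center K A ∧
    nilAlg K (innerDer K a) = eigenAlg K (innerDer K a) ∧
    eigenAlg K (innerDer K a) = kernelAlg K (innerDer K a)

variable (A)

/-- The algebra `A` admits the Dixmier partition: `A \ Z(A) = Δ₁ ∪ Δ₂ ∪ Δ₃ ∪ Δ₄ ∪ Δ₅`. -/
def AdmitsDixmierPartition : Prop :=
  ∀ a : A, a ∉ Subalgebra.center K A →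
    IsStronglyNilpotentElt K a ∨ IsWeaklyNilpotentElt K a ∨ IsStronglySemisimpleElt K a ∨
      IsWeaklySemisimpleElt K a ∨ IsGenericElt K a

/-- The algebra `A` is not commutative. -/
def IsNoncommutative (A : Type v) [Ring A] : Prop := ∃ x y : A, x * y ≠ y * x

/-- The commutative centralizer condition (ccc). -/
def CommCentralizerCondition : Prop :=
  IsNoncommutative A ∧
    ∀ a : A, a ∉ Subalgebra.center K A →
      ∀ b ∈ Subalgebra.centralizer K {a}, ∀ c ∈ Subalgebra.centralizer K {a}, b * c = c * b

variable {A}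

/-- The subset `K^* c + Z(A)` of `A`. -/
def scaledCoset (c : A) : Set A :=
  {b | ∃ k : K, k ≠ 0 ∧ ∃ z ∈ Subalgebra.center K A, b = k • c + z}

/-- The five possible shapes of the set `C(a) \ Z(A)` in the homogeneous centralizer condition. -/
inductive CentralizerShape : Type
  | stronglyNilpotent
  | weaklyNilpotent
  | genericExceptStronglySemisimple
  | genericExceptWeaklySemisimple
  | generic

/-- The non-central elements of `C(a)` have the given shape. -/
def HasCentralizerShape (a : A) : CentralizerShape → Prop
  | .stronglyNilpotent =>
      ∀ b ∈ Subalgebra.centralizer K {a}, b ∉ Subalgebra.center K A → IsStronglyNilpotentElt K b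
  | .weaklyNilpotent =>
      ∀ b ∈ Subalgebra.centralizer K {a}, b ∉ Subalgebra.center K A → IsWeaklyNilpotentElt K b
  | .genericExceptStronglySemisimple =>
      ∃ c ∈ Subalgebra.centralizer K {a}, IsStronglySemisimpleElt K c ∧
        ∀ b ∈ Subalgebra.centralizer K {a}, b ∉ Subalgebra.center K A →
          (b ∈ scaledCoset K c → IsStronglySemisimpleElt K b) ∧
          (b ∉ scaledCoset K c → IsGenericElt K b)
  | .genericExceptWeaklySemisimple =>
      ∃ c ∈ Subalgebra.centralizer K {a}, IsWeaklySemisimpleElt K c ∧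
        ∀ b ∈ Subalgebra.centralizer K {a}, b ∉ Subalgebra.center K A →
          (b ∈ scaledCoset K c → IsWeaklySemisimpleElt K b) ∧
          (b ∉ scaledCoset K c → IsGenericElt K b)
  | .generic =>
      ∀ b ∈ Subalgebra.centralizer K {a}, b ∉ Subalgebra.center K A → IsGenericElt K b

variable (A)

/-- The homogeneous centralizer condition (hcc), a condition on noncommutative algebras that admit
the Dixmier partition. -/
def HomogCentralizerCondition : Prop :=
  IsNoncommutative A ∧ AdmitsDixmierPartition K A ∧
    ∀ a : A, a ∉ Subalgebra.center K A → ∃! s : CentralizerShape, HasCentralizerShape K a s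

/-- The Gelfand-Kirillov dimension of `A` over `K`: the supremum, over all finite dimensional
subspaces `V` of `A`, of `limsup (log (dim V_n) / log n)`, where `V_n = K + V + ⋯ + V ^ n`, which
is the `n`-th power of the subspace `K + V`. -/
def gkDim : EReal :=
  ⨆ V : {V : Submodule K A // V.FG},
    Filter.limsup
      (fun n : ℕ =>
        ((Real.log (Module.finrank K ↥((1 ⊔ V.1) ^ n : Submodule K A)) / Real.log n : ℝ) : EReal))
      Filter.atTop

end Types

/-! ## The first Weyl algebra -/

/-- Names of the generators `x` and `∂` of the first Weyl algebra. -/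
inductive WeylGen : Type
  | x
  | d

/-- The defining relation `∂ x - x ∂ = 1`. -/
inductive WeylRel (K : Type u) [Field K] : FreeAlgebra K WeylGen → FreeAlgebra K WeylGen → Prop
  | comm : WeylRel K
      (FreeAlgebra.ι K WeylGen.d * FreeAlgebra.ι K WeylGen.x
        - FreeAlgebra.ι K WeylGen.x * FreeAlgebra.ι K WeylGen.d) 1

/-- The first Weyl algebra `A₁ = K⟨x, ∂ | ∂ x - x ∂ = 1⟩`. -/
def WeylAlgebra (K : Type u) [Field K] : Type u := RingQuot (WeylRel K)

instance (K : Type u) [Field K] : Ring (WeylAlgebra K) := inferInstanceAs (Ring (RingQuot (WeylRel K)))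

instance (K : Type u) [Field K] : Algebra K (WeylAlgebra K) :=
  inferInstanceAs (Algebra K (RingQuot (WeylRel K)))

namespace WeylAlgebra

open Polynomial (X)

variable (K : Type u) [Field K]

/-- The quotient map from the free algebra. -/
def mk : FreeAlgebra K WeylGen →ₐ[K] WeylAlgebra K := RingQuot.mkAlgHom K (WeylRel K)

/-- The generator `x`. -/
def x : WeylAlgebra K := mk K (FreeAlgebra.ι K WeylGen.x)

/-- The generator `∂`. -/
def d : WeylAlgebra K := mk K (FreeAlgebra.ι K WeylGen.d)

theorem d_mul_x : d K * x K = x K * d K + 1 := by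
  have h : mk K _ = mk K _ := RingQuot.mkAlgHom_rel K (WeylRel.comm (K := K))
  rw [map_sub, map_mul, map_mul, map_one] at h
  exact (sub_eq_iff_eq_add'.1 h)

/-- The action of the Weyl algebra on polynomials by differential operators. -/
def rep : WeylAlgebra K →ₐ[K] Module.End K K[X] :=
  RingQuot.liftAlgHom K (s := WeylRel K)
    ⟨FreeAlgebra.lift K (fun g : WeylGen =>
        match g with
        | .x => LinearMap.mulLeft K (X : K[X])
        | .d => (Polynomial.derivative : K[X] →ₗ[K] K[X])), by
      rintro _ _ ⟨⟩
      refine LinearMap.ext fun p => ?_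
      simp [Module.End.mul_apply]⟩

theorem rep_x (p : K[X]) : rep K (x K) p = X * p := by
  have h : rep K (x K) = LinearMap.mulLeft K (X : K[X]) := by
    refine (RingQuot.liftAlgHom_mkAlgHom_apply K _ _ _).trans ?_
    simp
  rw [h, LinearMap.mulLeft_apply]

theorem aeval_x_injective : Function.Injective (Polynomial.aeval (R := K) (x K)) := by
  have key : ∀ p q : K[X], rep K (Polynomial.aeval (x K) p) q = p * q := by
    intro p q
    induction p using Polynomial.induction_on' with
    | add p r hp hr => simp [hp, hr, add_mul]
    | monomial n a =>
      have : ∀ m : ℕ, ∀ q : K[X], rep K (x K ^ m) q = X ^ m * q := by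
        intro m
        induction m with
        | zero => intro q; simp
        | succ m ih => intro q; rw [pow_succ, map_mul, Module.End.mul_apply, rep_x, ih]; ring
      rw [← Polynomial.C_mul_X_pow_eq_monomial, map_mul, Polynomial.aeval_C, map_pow,
        Polynomial.aeval_X, map_mul, AlgHom.commutes, Module.End.mul_apply, this,
        Module.algebraMap_end_apply, Polynomial.smul_eq_C_mul, mul_assoc]
  intro p q h
  have h1 := key p 1
  have h2 := key q 1
  rw [h, h2] at h1
  simpa using h1.symm

instance : Nontrivial (WeylAlgebra K) :=
  (aeval_x_injective K).nontrivial

theorem d_mul_x_pow (i : ℕ) : d K * x K ^ i = x K ^ i * d K + (i : K) • x K ^ (i - 1) := by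
  induction i with
  | zero => simp
  | succ i ih =>
    rw [pow_succ, ← mul_assoc, ih, add_mul, mul_assoc, d_mul_x, mul_add, mul_one, ← mul_assoc,
      add_assoc]
    congr 1
    rcases i with _ | i
    · simp
    · simp only [Nat.add_sub_cancel, smul_mul_assoc, ← pow_succ]
      rw [Nat.cast_succ (i + 1), add_smul, one_smul, add_comm]

/-- The span of the monomials `x ^ i ∂ ^ j` with `i, j ≤ n`. -/
def box (n : ℕ) : Submodule K (WeylAlgebra K) :=
  Submodule.span K (Set.range fun ij : Fin (n + 1) × Fin (n + 1) =>
    x K ^ (ij.1 : ℕ) * d K ^ (ij.2 : ℕ))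

theorem mem_box {n i j : ℕ} (hi : i ≤ n) (hj : j ≤ n) : x K ^ i * d K ^ j ∈ box K n :=
  Submodule.subset_span ⟨(⟨i, by omega⟩, ⟨j, by omega⟩), rfl⟩

theorem box_mono {m n : ℕ} (h : m ≤ n) : box K m ≤ box K n := by
  refine Submodule.span_le.2 ?_
  rintro _ ⟨⟨i, j⟩, rfl⟩
  exact mem_box K (by omega) (by omega)

theorem finrank_box_le (n : ℕ) : Module.finrank K (box K n) ≤ (n + 1) ^ 2 := by
  refine (finrank_range_le_card _).trans ?_
  simp [sq]

instance (n : ℕ) : Module.Finite K (box K n) :=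
  Module.Finite.iff_fg.2 (Submodule.fg_span (Set.finite_range _))

/-- The span of `1, x, ∂`. -/
def gens : Submodule K (WeylAlgebra K) := Submodule.span K {1, x K, d K}

theorem gens_pow_le_box (n : ℕ) : gens K ^ n ≤ box K n := by
  induction n with
  | zero =>
    rw [pow_zero, Submodule.one_le]
    simpa using mem_box K (le_refl 0) (le_refl 0)
  | succ n ih =>
    rw [pow_succ']
    refine (mul_le_mul' le_rfl ih).trans ?_
    rw [gens, box, Submodule.span_mul_span, Submodule.span_le]
    rintro _ ⟨g, hg, _, ⟨⟨i, j⟩, rfl⟩, rfl⟩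
    simp only [SetLike.mem_coe]
    rcases hg with rfl | rfl | rfl
    · rw [one_mul]
      exact mem_box K (by omega) (by omega)
    · rw [← mul_assoc, ← pow_succ']
      exact mem_box K (by omega) (by omega)
    · rw [← mul_assoc, d_mul_x_pow, add_mul, mul_assoc, ← pow_succ', smul_mul_assoc]
      exact add_mem (mem_box K (by omega) (by omega))
        (Submodule.smul_mem _ _ (mem_box K (by omega) (by omega)))

theorem gens_mono {m n : ℕ} (h : m ≤ n) : gens K ^ m ≤ gens K ^ n :=
  pow_le_pow_right₀ (Submodule.one_le.2 (Submodule.subset_span (by simp))) h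

theorem exists_mem_gens_pow (u : WeylAlgebra K) : ∃ n, u ∈ gens K ^ n := by
  obtain ⟨f, rfl⟩ : ∃ f, mk K f = u := RingQuot.mkAlgHom_surjective K (WeylRel K) u
  induction f using FreeAlgebra.induction with
  | grade0 r =>
    refine ⟨0, ?_⟩
    rw [AlgHom.commutes, pow_zero]
    exact Submodule.algebraMap_mem r
  | grade1 g =>
    refine ⟨1, ?_⟩
    rw [pow_one]
    cases g
    · exact Submodule.subset_span (by simp [x])
    · exact Submodule.subset_span (by simp [d])
  | mul a b ha hb =>
    obtain ⟨n, hn⟩ := ha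
    obtain ⟨m, hm⟩ := hb
    exact ⟨n + m, by rw [map_mul, pow_add]; exact Submodule.mul_mem_mul hn hm⟩
  | add a b ha hb =>
    obtain ⟨n, hn⟩ := ha
    obtain ⟨m, hm⟩ := hb
    exact ⟨max n m, by
      rw [map_add]
      exact add_mem (gens_mono K (le_max_left _ _) hn) (gens_mono K (le_max_right _ _) hm)⟩

/-- The derivation `u ↦ u x - x u`, which behaves as `d / d∂`. -/
def der : Module.End K (WeylAlgebra K) := LinearMap.mulRight K (x K) - LinearMap.mulLeft K (x K)

theorem der_apply (u : WeylAlgebra K) : der K u = u * x K - x K * u := rfl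

theorem der_mul (u v : WeylAlgebra K) : der K (u * v) = der K u * v + u * der K v := by
  simp only [der_apply]
  rw [sub_mul, mul_sub, mul_assoc, mul_assoc, mul_assoc, sub_add_sub_cancel']

theorem der_aeval (p : K[X]) : der K (Polynomial.aeval (x K) p) = 0 := by
  rw [der_apply, sub_eq_zero]
  have h := congrArg (Polynomial.aeval (x K)) (mul_comm p X)
  simpa using h

theorem der_pow_aeval_mul (n : ℕ) (p : K[X]) (v : WeylAlgebra K) :
    (der K ^ n) (Polynomial.aeval (x K) p * v) = Polynomial.aeval (x K) p * (der K ^ n) v := by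
  induction n with
  | zero => simp
  | succ n ih => rw [pow_succ', Module.End.mul_apply, Module.End.mul_apply, ih, der_mul,
      der_aeval, zero_mul, zero_add]

theorem der_d : der K (d K) = 1 := by
  rw [der_apply, d_mul_x, add_sub_cancel_left]

theorem der_d_pow (n : ℕ) : der K (d K ^ (n + 1)) = (n + 1) • d K ^ n := by
  induction n with
  | zero => simp [der_d]
  | succ n ih =>
    rw [pow_succ, der_mul, ih, der_d, mul_one, smul_mul_assoc, ← pow_succ, ← succ_nsmul]

theorem der_pow_d_pow (n : ℕ) : (der K ^ n) (d K ^ n) = n.factorial • (1 : WeylAlgebra K) := by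
  induction n with
  | zero => simp
  | succ n ih =>
    rw [pow_succ, Module.End.mul_apply, der_d_pow, map_nsmul, ih, smul_smul, Nat.factorial_succ]

theorem der_pow_succ_d_pow (n : ℕ) : (der K ^ (n + 1)) (d K ^ n) = 0 := by
  rw [pow_succ', Module.End.mul_apply, der_pow_d_pow, map_nsmul]
  have h := der_aeval K 1
  rw [map_one] at h
  rw [h, smul_zero]

theorem der_pow_zero_of_le {u : WeylAlgebra K} {m n : ℕ} (h : m ≤ n) (hu : (der K ^ m) u = 0) :
    (der K ^ n) u = 0 := by
  obtain ⟨k, rfl⟩ := Nat.exists_eq_add_of_le' h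
  rw [pow_add, Module.End.mul_apply, hu, map_zero]

/-- A form of the top-degree part of the Leibniz rule. -/
theorem exists_leibniz (n m : ℕ) : ∃ c : ℕ, c ≠ 0 ∧ ∀ u v : WeylAlgebra K,
    (der K ^ (n + 1)) u = 0 → (der K ^ (m + 1)) v = 0 →
      (der K ^ (n + m)) (u * v) = c • ((der K ^ n) u * (der K ^ m) v) := by
  induction n generalizing m with
  | zero =>
    refine ⟨1, one_ne_zero, fun u v hu _ => ?_⟩
    rw [zero_add, one_smul, pow_zero, Module.End.one_apply]
    clear * - hu
    rw [zero_add, pow_one] at hu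
    induction m with
    | zero => simp
    | succ m ih => rw [pow_succ', Module.End.mul_apply, Module.End.mul_apply, ih, der_mul, hu,
        zero_mul, zero_add]
  | succ n ihn =>
    induction m with
    | zero =>
      refine ⟨1, one_ne_zero, fun u v _ hv => ?_⟩
      rw [add_zero, one_smul, pow_zero, Module.End.one_apply]
      rw [zero_add, pow_one] at hv
      generalize n + 1 = k
      induction k with
      | zero => simp
      | succ k ih => rw [pow_succ', Module.End.mul_apply, Module.End.mul_apply, ih, der_mul, hv,
          mul_zero, add_zero]
    | succ m ihm =>
      obtain ⟨c₁, h₁, H₁⟩ := ihn (m + 1)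
      obtain ⟨c₂, h₂, H₂⟩ := ihm
      refine ⟨c₁ + c₂, by omega, fun u v hu hv => ?_⟩
      have e₁ := H₁ (der K u) v (by rw [← Module.End.mul_apply, ← pow_succ]; exact hu) hv
      have e₂ := H₂ u (der K v) hu (by rw [← Module.End.mul_apply, ← pow_succ]; exact hv)
      rw [← Module.End.mul_apply (der K ^ n), ← pow_succ] at e₁
      rw [← Module.End.mul_apply (der K ^ m), ← pow_succ] at e₂
      rw [show n + 1 + (m + 1) = (n + (m + 1)) + 1 by ring, pow_succ, Module.End.mul_apply,
        der_mul, map_add, e₁, show n + (m + 1) = n + 1 + m by ring, e₂, add_smul]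

theorem exists_normal_form (u : WeylAlgebra K) :
    ∃ (n : ℕ) (p : ℕ → K[X]), u = ∑ j ∈ Finset.range n, Polynomial.aeval (x K) (p j) * d K ^ j := by
  obtain ⟨n, hn⟩ := exists_mem_gens_pow K u
  have hu := gens_pow_le_box K n hn
  refine ⟨n + 1, ?_⟩
  clear hn
  induction hu using Submodule.span_induction with
  | mem u hu =>
    obtain ⟨⟨i, j⟩, rfl⟩ := hu
    refine ⟨fun k => if k = j then X ^ (i : ℕ) else 0, ?_⟩
    rw [Finset.sum_eq_single (j : ℕ)]
    · simp
    · intro k _ hk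
      simp [hk]
    · intro hj
      exact absurd (Finset.mem_range.2 j.2) hj
  | zero => exact ⟨fun _ => 0, by simp⟩
  | add u v _ _ hu hv =>
    obtain ⟨p, rfl⟩ := hu
    obtain ⟨q, rfl⟩ := hv
    exact ⟨fun j => p j + q j, by simp [add_mul, Finset.sum_add_distrib]⟩
  | smul c u _ hu =>
    obtain ⟨p, rfl⟩ := hu
    exact ⟨fun j => c • p j, by simp [Finset.smul_sum]⟩

variable [CharZero K]

theorem exists_symbol (u : WeylAlgebra K) (hu : u ≠ 0) : ∃ (n : ℕ) (p : K[X]), p ≠ 0 ∧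
    (der K ^ n) u = Polynomial.aeval (x K) p ∧ (der K ^ (n + 1)) u = 0 := by
  obtain ⟨n, p, rfl⟩ := exists_normal_form K u
  induction n with
  | zero => simp at hu
  | succ n ih =>
    by_cases hp : p n = 0
    · rw [Finset.sum_range_succ, hp] at hu ⊢
      simp only [map_zero, zero_mul, add_zero] at hu ⊢
      exact ih hu
    · refine ⟨n, n.factorial • p n, smul_ne_zero (Nat.factorial_ne_zero n) hp, ?_, ?_⟩
      · rw [Finset.sum_range_succ, map_add, map_sum, Finset.sum_eq_zero, zero_add,
          der_pow_aeval_mul, der_pow_d_pow, mul_smul_comm, mul_one, map_nsmul]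
        intro j hj
        rw [der_pow_aeval_mul, der_pow_zero_of_le K (Finset.mem_range.1 hj)
          (der_pow_succ_d_pow K j), mul_zero]
      · rw [map_sum, Finset.sum_eq_zero]
        intro j hj
        rw [der_pow_aeval_mul, der_pow_zero_of_le K (m := j + 1)
          (by have := Finset.mem_range.1 hj; omega) (der_pow_succ_d_pow K j), mul_zero]

instance : NoZeroDivisors (WeylAlgebra K) where
  eq_zero_or_eq_zero_of_mul_eq_zero := by
    intro u v huv
    by_contra! h
    obtain ⟨n, p, hp, hun, hu⟩ := exists_symbol K u h.1
    obtain ⟨m, q, hq, hvm, hv⟩ := exists_symbol K v h.2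
    obtain ⟨c, hc, H⟩ := exists_leibniz K n m
    have h1 := H u v hu hv
    rw [huv, map_zero, hun, hvm, ← map_mul, ← map_nsmul] at h1
    have h2 := aeval_x_injective K ((map_zero (Polynomial.aeval (x K))).trans h1)
    exact smul_ne_zero hc (mul_ne_zero hp hq) h2.symm

/-- The left Ore condition for the nonzero elements of the Weyl algebra. -/
theorem exists_ore (r : WeylAlgebra K) (s : (WeylAlgebra K)⁰) :
    ∃ (r' : WeylAlgebra K) (s' : (WeylAlgebra K)⁰), s' * r = r' * s := by
  by_contra! hno
  have hs : (s : WeylAlgebra K) ≠ 0 := nonZeroDivisors.coe_ne_zero s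
  have hinj : ∀ a b : WeylAlgebra K, a * r = b * s → a = 0 ∧ b = 0 := by
    intro a b hab
    by_cases ha : a = 0
    · subst ha
      rw [zero_mul] at hab
      exact ⟨rfl, (mul_eq_zero.1 hab.symm).resolve_right hs⟩
    · exact absurd hab (hno b ⟨a, mem_nonZeroDivisors_of_ne_zero ha⟩)
  obtain ⟨d₁, hd₁⟩ := exists_mem_gens_pow K r
  obtain ⟨d₂, hd₂⟩ := exists_mem_gens_pow K (s : WeylAlgebra K)
  set e := max d₁ d₂ with he
  have hr : r ∈ gens K ^ e := gens_mono K (le_max_left _ _) hd₁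
  have hs' : (s : WeylAlgebra K) ∈ gens K ^ e := gens_mono K (le_max_right _ _) hd₂
  have hfin : ∀ n, Module.Finite K ↥(gens K ^ n) := fun n =>
    Submodule.finiteDimensional_of_le (gens_pow_le_box K n)
  have hdouble : ∀ n, 2 * Module.finrank K ↥(gens K ^ n) ≤ Module.finrank K ↥(gens K ^ (n + e)) := by
    intro n
    have := hfin n
    have := hfin (n + e)
    let φ : (↥(gens K ^ n) × ↥(gens K ^ n)) →ₗ[K] WeylAlgebra K :=
      (LinearMap.mulRight K r ∘ₗ (gens K ^ n).subtype).coprod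
        (-(LinearMap.mulRight K (s : WeylAlgebra K) ∘ₗ (gens K ^ n).subtype))
    have hφ : ∀ a b, φ (a, b) = (a : WeylAlgebra K) * r - b * s := by
      intro a b
      simp [φ, sub_eq_add_neg]
    let ψ : (↥(gens K ^ n) × ↥(gens K ^ n)) →ₗ[K] ↥(gens K ^ (n + e)) :=
      φ.codRestrict _ (by
        rintro ⟨a, b⟩
        rw [hφ, pow_add]
        exact sub_mem (Submodule.mul_mem_mul a.2 hr) (Submodule.mul_mem_mul b.2 hs'))
    have hψ : Function.Injective ψ := by
      rw [injective_iff_map_eq_zero]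
      rintro ⟨a, b⟩ hab
      have h1 : φ (a, b) = 0 := congrArg Subtype.val hab
      rw [hφ, sub_eq_zero] at h1
      obtain ⟨ha, hb⟩ := hinj _ _ h1
      ext
      · exact ha
      · exact hb
    have := LinearMap.finrank_le_finrank_of_injective hψ
    rw [Module.finrank_prod] at this
    omega
  have hexp : ∀ n, 2 ^ n ≤ Module.finrank K ↥(gens K ^ (n * e)) := by
    intro n
    induction n with
    | zero =>
      have := hfin (0 * e)
      rw [pow_zero, Nat.one_le_iff_ne_zero, Ne, Submodule.finrank_eq_zero]
      rw [zero_mul, pow_zero]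
      intro h
      exact one_ne_zero ((Submodule.mem_bot K).1 (h ▸ Submodule.one_le.1 le_rfl) :
        (1 : WeylAlgebra K) = 0)
    | succ n ih =>
      have := hdouble (n * e)
      rw [Nat.succ_mul, pow_succ]
      omega
  have hbound : ∀ n : ℕ, 2 ^ n ≤ (n * e + 1) ^ 2 := by
    intro n
    exact (hexp n).trans ((Submodule.finrank_mono (gens_pow_le_box K (n * e))).trans
      (finrank_box_le K _))
  have hlim : Filter.Tendsto (fun n : ℕ => (n : ℝ) ^ 2 / 2 ^ n) Filter.atTop (nhds 0) :=
    tendsto_pow_const_div_const_pow_of_one_lt 2 one_lt_two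
  have hev := hlim.eventually (gt_mem_nhds (show (0 : ℝ) < 1 / ((e : ℝ) + 1) ^ 2 by positivity))
  obtain ⟨n, hn, hn1⟩ := (hev.and (Filter.eventually_ge_atTop 1)).exists
  have h2 : ((2 : ℝ) ^ n) ≤ ((n : ℝ) * e + 1) ^ 2 := by exact_mod_cast hbound n
  rw [div_lt_div_iff₀ (by positivity) (by positivity)] at hn
  have h3 : ((n : ℝ) * e + 1) ^ 2 ≤ (n : ℝ) ^ 2 * ((e : ℝ) + 1) ^ 2 := by
    rw [← mul_pow]
    have : (1 : ℝ) ≤ n := by exact_mod_cast hn1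
    gcongr
    nlinarith
  linarith

instance : OreLocalization.OreSet (WeylAlgebra K)⁰ :=
  (OreLocalization.nonempty_oreSet_iff_of_noZeroDivisors.2 (exists_ore K)).some

end WeylAlgebra

/-- The Weyl division ring `Q(A₁)`, the ring of fractions of the first Weyl algebra. -/
def WeylDivisionRing (K : Type u) [Field K] [CharZero K] : Type u :=
  OreLocalization (WeylAlgebra K)⁰ (WeylAlgebra K)

instance (K : Type u) [Field K] [CharZero K] : DivisionRing (WeylDivisionRing K) :=
  inferInstanceAs (DivisionRing (OreLocalization (WeylAlgebra K)⁰ (WeylAlgebra K)))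

instance (K : Type u) [Field K] [CharZero K] : Algebra K (WeylDivisionRing K) :=
  inferInstanceAs (Algebra K (OreLocalization (WeylAlgebra K)⁰ (WeylAlgebra K)))

/-! ## The noncommutative deformations of type-A Kleinian singularities -/

/-- Names of the generators `X`, `Y`, `H`. -/
inductive KleinianGen : Type
  | X
  | Y
  | H

/-- The defining relations `XH = (H - 1)X`, `YH = (H + 1)Y`, `YX = a(H)`, `XY = a(H - 1)`. -/
inductive KleinianRel (K : Type u) [Field K] (a : K[X]) :
    FreeAlgebra K KleinianGen → FreeAlgebra K KleinianGen → Prop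
  | XH : KleinianRel K a
      (FreeAlgebra.ι K KleinianGen.X * FreeAlgebra.ι K KleinianGen.H)
      ((FreeAlgebra.ι K KleinianGen.H - 1) * FreeAlgebra.ι K KleinianGen.X)
  | YH : KleinianRel K a
      (FreeAlgebra.ι K KleinianGen.Y * FreeAlgebra.ι K KleinianGen.H)
      ((FreeAlgebra.ι K KleinianGen.H + 1) * FreeAlgebra.ι K KleinianGen.Y)
  | YX : KleinianRel K a
      (FreeAlgebra.ι K KleinianGen.Y * FreeAlgebra.ι K KleinianGen.X)
      (Polynomial.aeval (FreeAlgebra.ι K KleinianGen.H) a)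
  | XY : KleinianRel K a
      (FreeAlgebra.ι K KleinianGen.X * FreeAlgebra.ι K KleinianGen.Y)
      (Polynomial.aeval (FreeAlgebra.ι K KleinianGen.H - 1) a)

/-- The algebra `A(a)`, for a polynomial `a ∈ K[H]`. -/
def KleinianDeformation (K : Type u) [Field K] (a : K[X]) : Type u :=
  RingQuot (KleinianRel K a)

instance (K : Type u) [Field K] (a : K[X]) : Ring (KleinianDeformation K a) :=
  inferInstanceAs (Ring (RingQuot (KleinianRel K a)))

instance (K : Type u) [Field K] (a : K[X]) : Algebra K (KleinianDeformation K a) :=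
  inferInstanceAs (Algebra K (RingQuot (KleinianRel K a)))

end

/-! ### Generalized eigenvectors of a derivation of a domain -/

section GeneralizedEigenvectors

variable {k : Type u} [Field k] {R : Type v} [Ring R] [Algebra k R]

/-! All the algebras embed in Q(A₁): A₁ by inclusion, and A(a) by X ↦ x, Y ↦ a(h)x⁻¹, H ↦ h, where h
= x∂. Both A₁ and A(a) have Gelfand-Kirillov dimension at most 2. So it suffices to prove the ccc in
Q(A₁), and to deduce the Dixmier partition and the hcc from the ccc together with GK < 3.

The ccc. A nonzero element of Q(A₁) has a lowest term f(h)xⁿ with f ∈ K(h) and x f(h) = f(h - 1) x,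
as in a skew Laurent series ring; `IsLeadingTerm` records the calculus of such terms. If a has
degree n ≠ 0, two elements of C(a) of the same degree have leading coefficients whose ratio is
invariant under h ↦ h - n, hence is a scalar. So every element of C(a) is approximated by Laurent
polynomials over K in one element t of least positive degree, and C(a) is commutative. If a has
degree 0, either subtracting a scalar makes the degree nonzero, or all nonzero elements of C(a) have
degree 0, and then a nonzero commutator in C(a) would have leading coefficient zero
(`IsLeadingTerm.commute_of_commute`).

Growth. The ring K̄ ⊗ A is a domain, because K̄ ⊗ A₁ embeds in the Weyl algebra over K̄. In a domain
of characteristic zero the eigenvalues and the heights of generalized eigenvectors of ad a add under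
multiplication. If ad a has an eigenvector b with nonzero eigenvalue and also a generalized
eigenvector c of height exactly two, then the monomials aⁱbʲcˡ are linearly independent, which
forces GK ≥ 3. Hence for GK < 3 the inequality C(a) ≠ D(a) implies N(a) = C(a) and D(a) = F(a), and
this is the Dixmier partition.

Similarly, let b and c commute, and let ad c and ad b have eigenvectors u and v with nonzero
eigenvalues. If b and c are algebraically independent, the monomials cⁱbʲuˡ are independent. If they
are dependent, the cⁱuʲvˡ are independent unless the curve with generic point (c, b) is stable under
a nontrivial translation. Such a curve is a line, so b ∈ K̄c + K̄, and this descends to K.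

The hcc. By the ccc every noncentral b ∈ C(a) has C(b) = C(a), and therefore N(b) = N(a). Only D(b)
can vary with b, and by the previous paragraph the noncentral b with D(b) ≠ C(b), if there are any,
lie in one coset family K*c + Z(A). -/

theorem innerDer_apply (a b : R) : innerDer k a b = a * b - b * a := rfl

theorem innerDer_mul (a x y : R) :
    innerDer k a (x * y) = innerDer k a x * y + x * innerDer k a y := by
  simp only [innerDer_apply]
  noncomm_ring

/-- `x` is a generalized eigenvector of `D` of exact height `m + 1` for the eigenvalue `ν`. -/
def IsGenEigenvector (D : Module.End k R) (ν : k) (m : ℕ) (x : R) : Prop :=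
  ((D - algebraMap k _ ν) ^ m) x ≠ 0 ∧ ((D - algebraMap k _ ν) ^ (m + 1)) x = 0

/-- The multiplication map R ⊗ R → R intertwines f + g with D - (ν + ν'), where f = (D - ν) ⊗ 1 and
g = 1 ⊗ (D - ν') commute; the formula is the binomial theorem for f + g. -/
theorem pow_sub_algebraMap_mul {D : Module.End k R} (hD : ∀ x y, D (x * y) = D x * y + x * D y)
    (ν ν' : k) (N : ℕ) (x y : R) :
    ((D - algebraMap k _ (ν + ν')) ^ N) (x * y) =
      ∑ i ∈ Finset.range (N + 1), (N.choose i) •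
        (((D - algebraMap k _ ν) ^ i) x * ((D - algebraMap k _ ν') ^ (N - i)) y) := by
  set f : Module.End k (R ⊗[k] R) := TensorProduct.map (D - algebraMap k _ ν) LinearMap.id with hf
  set g : Module.End k (R ⊗[k] R) := TensorProduct.map LinearMap.id (D - algebraMap k _ ν') with hg
  have hfg : Commute f g := by
    refine TensorProduct.ext' fun x y => ?_
    simp [hf, hg]
  have hstep : ∀ z, (D - algebraMap k _ (ν + ν')) (LinearMap.mul' k R z) =
      LinearMap.mul' k R ((f + g) z) := by
    intro z
    induction z with
    | zero => simp
    | add z w hz hw => rw [LinearMap.map_add, LinearMap.map_add, hz, hw, LinearMap.map_add (f + g),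
        LinearMap.map_add]
    | tmul x y =>
      simp only [hf, hg, LinearMap.add_apply, TensorProduct.map_tmul, map_add,
        LinearMap.mul'_apply, LinearMap.sub_apply, Module.algebraMap_end_apply, hD,
        LinearMap.id_apply, sub_mul, mul_sub, smul_mul_assoc, mul_smul_comm]
      abel
  have hpow : ∀ (N : ℕ) z, ((D - algebraMap k _ (ν + ν')) ^ N) (LinearMap.mul' k R z) =
      LinearMap.mul' k R (((f + g) ^ N) z) := by
    intro N
    induction N with
    | zero => simp
    | succ N ih => intro z; rw [pow_succ, pow_succ, Module.End.mul_apply, Module.End.mul_apply,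
        hstep, ih]
  have hfp : ∀ (i : ℕ) x y, (f ^ i) (x ⊗ₜ y) = ((D - algebraMap k _ ν) ^ i) x ⊗ₜ y := by
    intro i
    induction i with
    | zero => simp
    | succ i ih => intro x y; rw [pow_succ, pow_succ, Module.End.mul_apply, Module.End.mul_apply,
        ← ih, hf, TensorProduct.map_tmul, LinearMap.id_apply]
  have hgp : ∀ (i : ℕ) x y, (g ^ i) (x ⊗ₜ y) = x ⊗ₜ ((D - algebraMap k _ ν') ^ i) y := by
    intro i
    induction i with
    | zero => simp
    | succ i ih => intro x y; rw [pow_succ, pow_succ, Module.End.mul_apply, Module.End.mul_apply,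
        ← ih, hg, TensorProduct.map_tmul, LinearMap.id_apply]
  rw [← LinearMap.mul'_apply (R := k), hpow, hfg.add_pow, LinearMap.sum_apply, map_sum]
  refine Finset.sum_congr rfl fun i _ => ?_
  rw [← nsmul_eq_mul', LinearMap.smul_apply, Module.End.mul_apply, hgp, hfp, map_nsmul,
    LinearMap.mul'_apply]

theorem pow_apply_eq_zero_of_le {D : Module.End k R} {m n : ℕ} (h : m ≤ n) {x : R}
    (hx : (D ^ m) x = 0) : (D ^ n) x = 0 := by
  obtain ⟨j, rfl⟩ := Nat.exists_eq_add_of_le' h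
  rw [pow_add, Module.End.mul_apply, hx, map_zero]

/-- In the Leibniz expansion of exponent m + n only the term i = m survives. It is a binomial
coefficient times a product of nonzero elements, which is why characteristic zero and a domain are
needed. In exponent m + n + 1 no term survives. -/
theorem IsGenEigenvector.mul [CharZero k] [NoZeroDivisors R] {D : Module.End k R}
    (hD : ∀ x y, D (x * y) = D x * y + x * D y) {ν ν' : k} {m n : ℕ} {x y : R}
    (hx : IsGenEigenvector D ν m x) (hy : IsGenEigenvector D ν' n y) :
    IsGenEigenvector D (ν + ν') (m + n) (x * y) := by
  constructor
  · rw [pow_sub_algebraMap_mul hD, Finset.sum_eq_single m]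
    · rw [Nat.add_sub_cancel_left, ← Nat.cast_smul_eq_nsmul k]
      exact smul_ne_zero (Nat.cast_ne_zero.2 (Nat.choose_pos (Nat.le_add_right m n)).ne')
        (mul_ne_zero hx.1 hy.1)
    · intro i _ hi
      rcases lt_or_gt_of_ne hi with hi | hi
      · rw [pow_apply_eq_zero_of_le (show n + 1 ≤ m + n - i by omega) hy.2, mul_zero, smul_zero]
      · rw [pow_apply_eq_zero_of_le (show m + 1 ≤ i by omega) hx.2, zero_mul, smul_zero]
    · intro h
      exact absurd (Finset.mem_range.2 (by omega)) h
  · rw [pow_sub_algebraMap_mul hD]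
    refine Finset.sum_eq_zero fun i _ => ?_
    rcases le_or_gt i m with hi | hi
    · rw [pow_apply_eq_zero_of_le (show n + 1 ≤ m + n + 1 - i by omega) hy.2, mul_zero, smul_zero]
    · rw [pow_apply_eq_zero_of_le (show m + 1 ≤ i by omega) hx.2, zero_mul, smul_zero]

theorem IsGenEigenvector.one [Nontrivial R] {D : Module.End k R} (hD : D 1 = 0) :
    IsGenEigenvector D 0 0 (1 : R) := by
  simp [IsGenEigenvector, hD]

theorem IsGenEigenvector.pow [CharZero k] [NoZeroDivisors R] [Nontrivial R] {D : Module.End k R}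
    (hD : ∀ x y, D (x * y) = D x * y + x * D y) {ν : k} {m : ℕ} {x : R}
    (hx : IsGenEigenvector D ν m x) (n : ℕ) : IsGenEigenvector D (n * ν) (n * m) (x ^ n) := by
  induction n with
  | zero =>
    have h1 : D 1 = 0 := by simpa using hD 1 1
    simpa using IsGenEigenvector.one h1
  | succ n ih =>
    have := ih.mul hD hx
    rwa [pow_succ, Nat.cast_succ, add_mul, one_mul, Nat.succ_mul]

open Polynomial in
/-- Generalized eigenvectors with distinct pairs (eigenvalue, height) are linearly independent. -/
theorem IsGenEigenvector.not_sum_eq_zero {ι : Type*} {D : Module.End k R} (S : Finset ι)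
    (hS : S.Nonempty) (ν : ι → k) (m : ι → ℕ) (w : ι → R)
    (hw : ∀ s ∈ S, IsGenEigenvector D (ν s) (m s) (w s))
    (hinj : Set.InjOn (fun s => (ν s, m s)) S) : ∑ s ∈ S, w s ≠ 0 := by
  classical
  intro hsum
  -- With s₀ of maximal height, the polynomial G * F built below kills every other summand: F
  -- handles equal eigenvalues, where distinct pairs force a smaller height, and G handles the other
  -- eigenvalues.
  obtain ⟨s₀, hs₀, hmax⟩ := S.exists_max_image m hS
  have heval : ∀ (c : k) (n : ℕ), aeval D ((X - C c) ^ n) = (D - algebraMap k _ c) ^ n := by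
    intro c n
    simp
  let T := S.filter fun s => ν s ≠ ν s₀
  let F : k[X] := (X - C (ν s₀)) ^ (m s₀)
  let G : k[X] := ∏ s ∈ T, (X - C (ν s)) ^ (m s + 1)
  have hkill : ∀ s ∈ S, s ≠ s₀ → aeval D (G * F) (w s) = 0 := by
    intro s hs hne
    by_cases h : ν s = ν s₀
    · have hlt : m s < m s₀ := lt_of_le_of_ne (hmax s hs) fun h' =>
        hne (hinj hs hs₀ (Prod.ext h h'))
      rw [map_mul, Module.End.mul_apply, heval, ← h, pow_apply_eq_zero_of_le hlt (hw s hs).2,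
        map_zero]
    · have hsT : s ∈ T := Finset.mem_filter.2 ⟨hs, h⟩
      obtain ⟨G', hG'⟩ := Finset.dvd_prod_of_mem (fun s => (X - C (ν s)) ^ (m s + 1)) hsT
      have : G * F = (G' * F) * (X - C (ν s)) ^ (m s + 1) := by
        change (∏ s ∈ T, (X - C (ν s)) ^ (m s + 1)) * F = _
        rw [hG']; ring
      rw [this, map_mul, Module.End.mul_apply, heval, (hw s hs).2, map_zero]
  have h0 : aeval D (G * F) (w s₀) = 0 := by
    have := congrArg (aeval D (G * F)) hsum
    rw [map_sum, map_zero, Finset.sum_eq_single s₀ hkill (fun h => absurd hs₀ h)] at this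
    exact this
  -- F sends `w s₀` to a genuine eigenvector e, on which G acts by the nonzero scalar G(ν s₀).
  set e := ((D - algebraMap k _ (ν s₀)) ^ m s₀) (w s₀) with he
  have hDe : D e = ν s₀ • e := by
    have := (hw s₀ hs₀).2
    rw [pow_succ', Module.End.mul_apply, ← he, LinearMap.sub_apply, Module.algebraMap_end_apply,
      sub_eq_zero] at this
    exact this
  have hG : ∀ P : k[X], aeval D P e = P.eval (ν s₀) • e := by
    intro P
    exact Module.End.aeval_apply_of_hasEigenvector
      ⟨Module.End.mem_eigenspace_iff.2 hDe, (hw s₀ hs₀).1⟩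
  rw [map_mul, Module.End.mul_apply, heval, ← he, hG] at h0
  refine smul_ne_zero ?_ (hw s₀ hs₀).1 h0
  rw [eval_prod, Finset.prod_ne_zero_iff]
  intro s hs
  simp only [eval_pow, eval_sub, eval_X, eval_C]
  exact pow_ne_zero _ (sub_ne_zero.2 (Ne.symm (Finset.mem_filter.1 hs).2))

end GeneralizedEigenvectors

/-! ### Independence of ordered monomials, and translation-stable plane curves -/

section Independence

variable {k : Type u} [Field k] {R : Type v} [Ring R] [Algebra k R]

open Polynomial

theorem exists_eq_algebraMap_of_aeval_eq_zero [IsAlgClosed k] [NoZeroDivisors R] [Nontrivial R]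
    {a : R} {p : k[X]} (hp : p ≠ 0) (h : aeval a p = 0) : ∃ κ : k, a = algebraMap k R κ := by
  induction hn : p.natDegree generalizing p with
  | zero =>
    rw [eq_C_of_natDegree_eq_zero hn, aeval_C] at h
    rw [eq_C_of_natDegree_eq_zero hn, C_ne_zero] at hp
    exact absurd ((map_eq_zero _).1 h) hp
  | succ n ih =>
    obtain ⟨κ, hκ⟩ := IsAlgClosed.exists_root p fun hd => by
      rw [natDegree_eq_of_degree_eq_some (n := 0) (by simpa using hd)] at hn
      omega
    obtain ⟨q, rfl⟩ := dvd_iff_isRoot.2 hκ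
    rw [map_mul, mul_eq_zero] at h
    rcases h with h | h
    · exact ⟨κ, by simpa [sub_eq_zero] using h⟩
    · have hq : q ≠ 0 := right_ne_zero_of_mul hp
      refine ih hq h ?_
      rw [natDegree_mul (X_sub_C_ne_zero κ) hq, natDegree_X_sub_C] at hn
      omega

/-- Collecting the powers of c in front of each `m s` turns a relation over k into one with
polynomial coefficients in c. -/
theorem linearIndependent_pow_mul {ι : Type*} (c : R) (m : ι → R)
    (H : ∀ (S : Finset ι) (f : ι → k[X]), ∑ s ∈ S, aeval c (f s) * m s = 0 → ∀ s ∈ S, f s = 0) :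
    LinearIndependent k (fun t : ℕ × ι => c ^ t.1 * m t.2) := by
  classical
  rw [linearIndependent_iff']
  intro S g hg t ht
  let f : ι → k[X] := fun s => ∑ t ∈ S with t.2 = s, monomial t.1 (g t)
  have hf := H (S.image Prod.snd) f (by
    rw [← hg, ← Finset.sum_fiberwise_of_maps_to
      (fun t ht => Finset.mem_image_of_mem Prod.snd ht) (f := fun t => g t • (c ^ t.1 * m t.2))]
    refine Finset.sum_congr rfl fun s _ => ?_
    rw [map_sum, Finset.sum_mul]
    refine Finset.sum_congr rfl fun t ht => ?_
    rw [(Finset.mem_filter.1 ht).2, aeval_monomial, ← Algebra.smul_def, smul_mul_assoc])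
    t.2 (Finset.mem_image_of_mem Prod.snd ht)
  have := congrArg (fun p => coeff p t.1) hf
  simp only [f, finsetSum_coeff, coeff_monomial, coeff_zero] at this
  rw [Finset.sum_eq_single t, if_pos rfl] at this
  · exact this
  · rintro ⟨i, s⟩ hs hne
    rw [if_neg]
    rintro rfl
    exact hne (Prod.ext rfl (Finset.mem_filter.1 hs).2)
  · intro h
    exact absurd (Finset.mem_filter.2 (⟨ht, rfl⟩ : t ∈ S ∧ t.2 = t.2)) h

theorem IsGenEigenvector.kernel_mul [CharZero k] [NoZeroDivisors R] {a : R} {ν : k} {m : ℕ} {z w : R} (hz : z ≠ 0)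
    (haz : innerDer k a z = 0) (hw : IsGenEigenvector (innerDer k a) ν m w) :
    IsGenEigenvector (innerDer k a) ν m (z * w) := by
  have hz' : IsGenEigenvector (innerDer k a) 0 0 z := by
    simpa [IsGenEigenvector, hz] using haz
  simpa using hz'.mul (innerDer_mul a) hw

theorem innerDer_aeval (a : R) (p : k[X]) : innerDer k a (aeval a p) = 0 := by
  have h := congrArg (aeval a) (mul_comm X p)
  simpa [innerDer_apply, sub_eq_zero] using h

/-- The product f(a) bⁱ cʲ with f ≠ 0 is a generalized eigenvector with eigenvalue iλ + jμ and
height index j. Since λ ≠ 0, this pair determines (i, j). -/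
theorem linearIndependent_of_eigenvector_of_genEigenvector [CharZero k] [NoZeroDivisors R]
    [Nontrivial R] {a b c : R}
    (ha : ∀ p : k[X], aeval a p = 0 → p = 0) {lam μ : k} (hlam : lam ≠ 0)
    (hb : IsGenEigenvector (innerDer k a) lam 0 b) (hc : IsGenEigenvector (innerDer k a) μ 1 c) :
    LinearIndependent k (fun t : ℕ × (ℕ × ℕ) => a ^ t.1 * (b ^ t.2.1 * c ^ t.2.2)) := by
  classical
  refine linearIndependent_pow_mul a (fun s : ℕ × ℕ => b ^ s.1 * c ^ s.2) fun S f hf => ?_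
  by_contra! hne
  obtain ⟨s, hs, hfs⟩ := hne
  refine IsGenEigenvector.not_sum_eq_zero (D := innerDer k a) (S.filter fun s => f s ≠ 0)
    ⟨s, Finset.mem_filter.2 ⟨hs, hfs⟩⟩ (fun s => s.1 * lam + s.2 * μ) (fun s => s.2)
    (fun s => aeval a (f s) * (b ^ s.1 * c ^ s.2)) ?_ ?_ ?_
  · intro s hs
    have := (hb.pow (innerDer_mul a) s.1).mul (innerDer_mul a) (hc.pow (innerDer_mul a) s.2)
    rw [mul_zero, zero_add, mul_one] at this
    exact this.kernel_mul (fun h => (Finset.mem_filter.1 hs).2 (ha _ h)) (innerDer_aeval a _)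
  · rintro ⟨i, j⟩ _ ⟨i', j'⟩ _ h
    simp only [Prod.mk.injEq] at h ⊢
    obtain ⟨h1, rfl⟩ := h
    exact ⟨by simpa [hlam] using h1, rfl⟩
  · rw [Finset.sum_filter_of_ne, hf]
    intro s _ h hfs
    simp [hfs] at h

variable {B : Type*} [CommRing B] [Algebra k B]

/-- Evaluation of bivariate polynomials at the translate `(c + x, b + y)` of `(c, b)`. -/
noncomputable def translateEval (c b : B) (x y : k) : k[X][X] →+* B :=
  eval₂RingHom (aeval (R := k) (c + algebraMap k B x)).toRingHom (b + algebraMap k B y)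

theorem translateEval_C (c b : B) (x y : k) (p : k[X]) :
    translateEval c b x y (C p) = aeval (c + algebraMap k B x) p := by
  simp [translateEval]

theorem translateEval_X (c b : B) (x y : k) :
    translateEval c b x y X = b + algebraMap k B y := by
  simp [translateEval]

theorem exists_translateEval_add (c b : B) (x y : k) :
    ∃ τ : k[X][X] →+* k[X][X], ∀ x' y' F,
      translateEval c b x' y' (τ F) = translateEval c b (x' + x) (y' + y) F := by
  refine ⟨eval₂RingHom (C.comp (aeval (R := k) (X + C x)).toRingHom) (X + C (C y)),
    fun x' y' F => ?_⟩
  rw [← RingHom.comp_apply]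
  congr 1
  refine ringHom_ext' (ringHom_ext (fun a => ?_) ?_) ?_
  · simp [translateEval_C]
  · simp [translateEval_C, add_assoc]
  · simp [translateEval_X, translateEval_C, add_assoc]


/-- If `(c, b)` is a generic point of an algebraic curve that is stable under a nontrivial
translation then the curve is a line. -/
theorem exists_eq_of_translateEval_eq_zero [CharZero k] [IsAlgClosed k] [IsDomain B] {c b : B}
    (hc : ∀ p : k[X], aeval c p = 0 → p = 0) {x y : k} (hxy : x ≠ 0 ∨ y ≠ 0) {P : k[X][X]}
    (hP : P ≠ 0) (hPcb : translateEval c b 0 0 P = 0)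
    (h : ∀ F, translateEval c b 0 0 F = 0 → translateEval c b x y F = 0) :
    ∃ ρ ω : k, b = ρ • c + algebraMap k B ω := by
  have : CharZero B := charZero_of_injective_algebraMap (algebraMap k B).injective
  -- Applying `h` to translates of P iterates the translation.
  have hn : ∀ n : ℕ, translateEval c b (n * x) (n * y) P = 0 := by
    intro n
    induction n with
    | zero => simpa using hPcb
    | succ n ih =>
      obtain ⟨τ, hτ⟩ := exists_translateEval_add c b (n * x) (n * y)
      have h1 := h (τ P) (by rw [hτ]; simpa using ih)
      rw [hτ] at h1
      convert h1 using 3 <;> push_cast <;> ring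
  -- Φ restricts P to the line (c, b) + T(x, y). All natural numbers T are roots, so Φ P = 0, and T
  -- may be specialized to any element of B.
  let Φ : k[X][X] →+* B[X] := eval₂RingHom
    (aeval (R := k) (C c + C (algebraMap k B x) * X)).toRingHom (C b + C (algebraMap k B y) * X)
  have hΦ : Φ P = 0 := by
    refine eq_zero_of_infinite_isRoot _ ((Set.infinite_range_of_injective
      (Nat.cast_injective (R := B))).mono ?_)
    rintro _ ⟨n, rfl⟩
    rw [Set.mem_ofPred_eq, IsRoot.def, ← hn n, ← coe_evalRingHom, ← RingHom.comp_apply]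
    congr 1
    refine ringHom_ext' (ringHom_ext (fun a => ?_) ?_) ?_
    · simp [Φ, translateEval_C, Polynomial.algebraMap_apply]
    · simp [Φ, translateEval_C, -mul_eq_mul_left_iff]; ring
    · simp [Φ, translateEval_X]; ring
  by_cases hx : x = 0
  -- For a vertical translation, T is chosen so that the second coordinate becomes κ. Then P(c, κ) =
  -- 0 for every κ, and transcendence of c forces P = 0.
  · have hy : y ≠ 0 := hxy.resolve_left (fun h => h hx)
    refine absurd (eq_zero_of_infinite_isRoot P ((Set.infinite_range_of_injective
      (C_injective (R := k))).mono ?_)) hP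
    rintro _ ⟨κ, rfl⟩
    refine hc _ ?_
    have h1 := congrArg (eval (algebraMap k B y⁻¹ * (algebraMap k B κ - b))) hΦ
    rw [eval_zero] at h1
    rw [← h1, ← coe_evalRingHom, ← coe_evalRingHom]
    change ((aeval (R := k) c).toRingHom.comp (evalRingHom (C κ))) P =
      ((evalRingHom _).comp Φ) P
    congr 1
    refine ringHom_ext' (ringHom_ext (fun a => ?_) ?_) ?_
    · simp [Φ, Polynomial.algebraMap_apply]
    · simp [Φ, hx]
    · simp [Φ, ← mul_assoc, ← map_mul, hy]
  -- For x ≠ 0, T = x⁻¹(κ - c) makes the first coordinate the constant κ. The second coordinate b +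
  -- yT is then a root of the nonzero polynomial P(κ, ·) over k, hence a scalar ω.
  · obtain ⟨κ, hκ⟩ : ∃ κ : k, P.map (evalRingHom κ) ≠ 0 := by
      by_contra! hall
      refine hP (leadingCoeff_eq_zero.1 (Polynomial.funext fun κ => ?_))
      have := congrArg (fun p => coeff p P.natDegree) (hall κ)
      simpa using this
    have h1 := congrArg (eval (algebraMap k B x⁻¹ * (algebraMap k B κ - c))) hΦ
    have h2 : aeval (b + algebraMap k B y * (algebraMap k B x⁻¹ * (algebraMap k B κ - c)))
        (P.map (evalRingHom κ)) = 0 := by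
      rw [eval_zero] at h1
      rw [← h1, ← coe_evalRingHom, ← coe_mapRingHom]
      change ((aeval (R := k) _).toRingHom.comp (mapRingHom _)) P = ((evalRingHom _).comp Φ) P
      congr 1
      refine ringHom_ext' (ringHom_ext (fun a => ?_) ?_) ?_
      · simp [Φ, Polynomial.algebraMap_apply]
      · simp [Φ, ← mul_assoc, ← map_mul, hx]
      · simp [Φ]
    obtain ⟨ω, hω⟩ := exists_eq_algebraMap_of_aeval_eq_zero hκ h2
    refine ⟨y * x⁻¹, ω - y * x⁻¹ * κ, ?_⟩
    rw [Algebra.smul_def, map_sub, ← hω, map_mul, map_mul]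
    simp only [map_mul]
    ring

end Independence

/-! ### Commuting elements whose inner derivations have eigenvectors -/

section CommutingEigenvectors

open Polynomial

variable {k : Type u} [Field k] {R : Type v} [Ring R] [Algebra k R]
  {B : Type*} [CommRing B] [Algebra k B]

/-- Collecting by powers of u leaves terms P_j(c, b) uʲ. The factor P_j(c, b) commutes with c and is
nonzero if P_j is, so the nonzero terms are eigenvectors with distinct eigenvalues jλ. -/
theorem linearIndependent_of_algebraicIndependent [CharZero k] [NoZeroDivisors R] [Nontrivial R]
    (ι : B →ₐ[k] R) (hι : Function.Injective ι) {c b : B} {lam : k} (hlam : lam ≠ 0) {u : R}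
    (hu : IsGenEigenvector (innerDer k (ι c)) lam 0 u)
    (h : ∀ P, translateEval c b (0 : k) 0 P = 0 → P = 0) :
    LinearIndependent k (fun t : ℕ × (ℕ × ℕ) => ι c ^ t.1 * (ι b ^ t.2.1 * u ^ t.2.2)) := by
  classical
  refine linearIndependent_pow_mul (ι c) (fun s : ℕ × ℕ => ι b ^ s.1 * u ^ s.2) fun S f hf => ?_
  by_contra! hne
  obtain ⟨s, hs, hfs⟩ := hne
  let P : ℕ → k[X][X] := fun j => ∑ s ∈ S with s.2 = j, monomial s.1 (f s)
  have hP : ∀ j, ι (translateEval c b 0 0 (P j)) * u ^ j =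
      ∑ s ∈ S with s.2 = j, aeval (ι c) (f s) * (ι b ^ s.1 * u ^ s.2) := by
    intro j
    rw [map_sum, map_sum, Finset.sum_mul]
    refine Finset.sum_congr rfl fun s hs => ?_
    rw [← C_mul_X_pow_eq_monomial, map_mul, map_pow, translateEval_C, translateEval_X, map_mul,
      map_zero, add_zero, add_zero, ← aeval_algHom_apply, map_pow, mul_assoc,
      (Finset.mem_filter.1 hs).2]
  have hPs : P s.2 ≠ 0 := by
    intro h0
    have := congrArg (fun p => coeff p s.1) h0
    simp only [P, finsetSum_coeff, coeff_monomial, coeff_zero] at this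
    rw [Finset.sum_eq_single s, if_pos rfl] at this
    · exact hfs this
    · rintro ⟨i, j⟩ hij hne
      rw [if_neg]
      rintro rfl
      exact hne (Prod.ext rfl (Finset.mem_filter.1 hij).2)
    · intro h
      exact absurd (Finset.mem_filter.2 (⟨hs, rfl⟩ : s ∈ S ∧ s.2 = s.2)) h
  refine IsGenEigenvector.not_sum_eq_zero (D := innerDer k (ι c))
    ((S.image Prod.snd).filter fun j => P j ≠ 0)
    ⟨s.2, Finset.mem_filter.2 ⟨Finset.mem_image_of_mem _ hs, hPs⟩⟩ (fun j => j * lam) (fun _ => 0)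
    (fun j => ι (translateEval c b 0 0 (P j)) * u ^ j) ?_ ?_ ?_
  · intro j hj
    have := hu.pow (innerDer_mul (ι c)) j
    rw [mul_zero] at this
    refine this.kernel_mul (fun h0 => (Finset.mem_filter.1 hj).2 (h _ (hι (h0.trans
      (map_zero ι).symm)))) ?_
    rw [innerDer_apply, ← map_mul, ← map_mul, mul_comm, sub_self]
  · intro i _ j _ hij
    simpa [hlam] using hij
  · rw [Finset.sum_filter_of_ne]
    · rw [← hf, ← Finset.sum_fiberwise_of_maps_to
        (fun s hs => Finset.mem_image_of_mem Prod.snd hs)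
        (f := fun s => aeval (ι c) (f s) * (ι b ^ s.1 * u ^ s.2))]
      exact Finset.sum_congr rfl fun j _ => hP j
    · intro j _ h h0
      simp [h0] at h

theorem mul_pow_eigenvector {c u : R} {lam : k} (hu : innerDer k c u = lam • u) (j : ℕ) :
    c * u ^ j = u ^ j * (c + algebraMap k R (j * lam)) := by
  induction j with
  | zero => simp
  | succ j ih =>
    have h1 : c * u = u * (c + algebraMap k R lam) := by
      rw [innerDer_apply, sub_eq_iff_eq_add] at hu
      rw [hu, mul_add, ← Algebra.commutes, ← Algebra.smul_def, add_comm]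
    rw [pow_succ, ← mul_assoc, ih, mul_assoc, add_mul, h1, Algebra.commutes, ← mul_add, add_assoc,
      ← map_add, ← mul_assoc, Nat.cast_succ]
    ring_nf

theorem pow_eigenvector_mul {b v : R} {μ : k} (hv : innerDer k b v = μ • v) (j : ℕ) :
    v ^ j * b = (b + algebraMap k R (-(j * μ))) * v ^ j := by
  rw [add_mul, mul_pow_eigenvector hv, mul_add, map_neg, neg_mul, Algebra.commutes,
    add_neg_cancel_right]

/-- The action of bivariate polynomials on `R`, the variables acting by left multiplication
by `c` and right multiplication by `b`. -/
noncomputable def bimoduleAction (c b : R) : k[X][X] →+* Module.End k R :=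
  eval₂RingHom' ((Algebra.lmul k R).comp (aeval (R := k) c)).toRingHom (LinearMap.mulRight k b)
    fun p => LinearMap.ext fun z => by simp [mul_assoc]

theorem bimoduleAction_C (c b : R) (p : k[X]) (z : R) :
    bimoduleAction c b (C p) z = aeval c p * z := by
  simp [bimoduleAction]

theorem bimoduleAction_X (c b : R) (z : R) :
    bimoduleAction (k := k) c b X z = z * b := by
  simp [bimoduleAction]

theorem aeval_mul_eq_mul_aeval {c c' U : R} (h : c * U = U * c') (p : k[X]) :
    aeval c p * U = U * aeval c' p := by
  induction p using Polynomial.induction_on' with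
  | add p q hp hq => simp [add_mul, mul_add, hp, hq]
  | monomial n a =>
    have hn : c ^ n * U = U * c' ^ n := (SemiconjBy.pow_right (a := U) (x := c') (y := c)
      h.symm n).symm
    rw [aeval_monomial, aeval_monomial, mul_assoc, hn, ← mul_assoc, ← mul_assoc, Algebra.commutes]

/-- Moving c to the right past U and b to the left past V translates each by a scalar. So on U ι(B)
V the polynomial F acts by multiplying the middle factor by F(c + x, b + y). -/
theorem bimoduleAction_apply (ι : B →ₐ[k] R) {c b : B} {x y : k} {U V : R}
    (hU : ι c * U = U * (ι c + algebraMap k R x)) (hV : V * ι b = (ι b + algebraMap k R y) * V)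
    (F : k[X][X]) (z : B) : bimoduleAction (ι c) (ι b) F (U * ι z * V) =
      U * ι (translateEval c b x y F * z) * V := by
  induction F using Polynomial.induction_on generalizing z with
  | C p =>
    rw [bimoduleAction_C, translateEval_C, map_mul, ← aeval_algHom_apply, map_add,
      AlgHom.commutes, ← mul_assoc, ← mul_assoc, aeval_mul_eq_mul_aeval hU, mul_assoc U]
  | add F G hF hG =>
    rw [map_add, LinearMap.add_apply, hF, hG, map_add, add_mul, map_add, mul_add, add_mul]
  | monomial n p ih =>
    rw [pow_succ, ← mul_assoc, map_mul (bimoduleAction (ι c) (ι b)), Module.End.mul_apply,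
      bimoduleAction_X, mul_assoc, hV,
      ← mul_assoc, mul_assoc U]
    have : ι z * (ι b + algebraMap k R y) = ι ((b + algebraMap k B y) * z) := by
      rw [mul_comm (b + algebraMap k B y), map_mul, map_add, AlgHom.commutes]
    rw [this, ih, map_mul _ _ X, translateEval_X]
    simp only [mul_assoc]

/-- Left multiplication by c and right multiplication by b act on uⁱvʲ through evaluation at the
translate (c + iλ, b - jμ). Unless the curve through (c, b) is a line, polynomials in these two
operators separate the translates and hence isolate a single uⁱvʲ. -/
theorem linearIndependent_of_algebraicDependent [CharZero k] [IsAlgClosed k] [IsDomain B]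
    [NoZeroDivisors R] [Nontrivial R] (ι : B →ₐ[k] R) (hι : Function.Injective ι) {c b : B}
    (hc : ∀ p : k[X], aeval c p = 0 → p = 0) {lam μ : k} (hlam : lam ≠ 0) (hμ : μ ≠ 0) {u v : R}
    (hu0 : u ≠ 0) (hv0 : v ≠ 0) (hu : innerDer k (ι c) u = lam • u)
    (hv : innerDer k (ι b) v = μ • v) (hbc : ¬ ∃ ρ ω : k, b = ρ • c + algebraMap k B ω)
    {P : k[X][X]} (hP : P ≠ 0) (hPcb : translateEval c b (0 : k) 0 P = 0) :
    LinearIndependent k (fun t : ℕ × (ℕ × ℕ) => ι c ^ t.1 * (u ^ t.2.1 * v ^ t.2.2)) := by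
  classical
  let ev : ℕ × ℕ → k[X][X] →+* B := fun s => translateEval c b (s.1 * lam) (-(s.2 * μ))
  -- Otherwise, after translating s back to the origin, the curve would be stable under the nonzero
  -- difference of the two translations and hence a line, contrary to `hbc`.
  have hev : ∀ s t, s ≠ t → ∃ F, ev s F = 0 ∧ ev t F ≠ 0 := by
    intro s t hst
    by_contra! hall
    refine hbc (exists_eq_of_translateEval_eq_zero hc (x := t.1 * lam - s.1 * lam)
      (y := -(t.2 * μ) - -(s.2 * μ)) ?_ hP hPcb fun F hF => ?_)
    · by_contra! h
      refine hst (Prod.ext ?_ ?_)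
      · have := h.1
        rw [← sub_mul, mul_eq_zero, sub_eq_zero, Nat.cast_inj] at this
        exact (this.resolve_right hlam).symm
      · have := h.2
        rw [neg_sub_neg, ← sub_mul, mul_eq_zero, sub_eq_zero, Nat.cast_inj] at this
        exact this.resolve_right hμ
    · obtain ⟨τ, hτ⟩ := exists_translateEval_add c b (-(s.1 * lam)) (s.2 * μ)
      have h1 := hall (τ F) (by simpa [ev, hτ] using hF)
      simpa [ev, hτ, sub_eq_add_neg] using h1
  choose! F hF0 hF1 using hev
  refine linearIndependent_pow_mul (ι c) (fun s : ℕ × ℕ => u ^ s.1 * v ^ s.2)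
    fun S f hf t ht => ?_
  -- G annihilates the terms indexed by s ≠ t, and `ev t G` is nonzero because B is a domain.
  let G := ∏ s ∈ S.erase t, F s t
  have hact : ∀ (s : ℕ × ℕ) (H : k[X][X]), bimoduleAction (ι c) (ι b) H (u ^ s.1 * v ^ s.2) =
      u ^ s.1 * ι (ev s H) * v ^ s.2 := by
    intro s H
    simpa using bimoduleAction_apply ι (mul_pow_eigenvector hu s.1) (pow_eigenvector_mul hv s.2) H 1
  have h1 := congrArg (bimoduleAction (ι c) (ι b) G) hf
  have h2 : ∀ s, bimoduleAction (ι c) (ι b) G (aeval (ι c) (f s) * (u ^ s.1 * v ^ s.2)) =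
      u ^ s.1 * ι (ev s (G * C (f s))) * v ^ s.2 := by
    intro s
    rw [← hact, map_mul (bimoduleAction (ι c) (ι b)), Module.End.mul_apply, bimoduleAction_C]
  rw [map_sum, map_zero, Finset.sum_eq_single t] at h1
  · rw [h2, mul_eq_zero, mul_eq_zero] at h1
    have h3 : ev t (G * C (f t)) = 0 := by
      have := (h1.resolve_right (pow_ne_zero _ hv0)).resolve_left (pow_ne_zero _ hu0)
      exact hι (this.trans (map_zero ι).symm)
    rw [map_mul, mul_eq_zero] at h3
    rcases h3 with h3 | h3
    · rw [map_prod, Finset.prod_eq_zero_iff] at h3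
      obtain ⟨s, hs, h3⟩ := h3
      exact absurd h3 (hF1 s t (Finset.ne_of_mem_erase hs))
    · have h4 : aeval c ((f t).comp (X + C (t.1 * lam))) = 0 := by
        rw [aeval_comp, ← h3]
        simp [ev, translateEval_C]
      have h5 := congrArg (fun p => p.comp (X - C (t.1 * lam))) (hc _ h4)
      simpa [comp_assoc] using h5
  · intro s hs hst
    have h0 : ∏ r ∈ S.erase t, ev s (F r t) = 0 :=
      Finset.prod_eq_zero (Finset.mem_erase.2 ⟨hst, hs⟩) (hF0 s t hst)
    rw [h2, map_mul, map_prod, h0, zero_mul, map_zero, mul_zero, zero_mul]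
  · exact fun h => absurd ht h

end CommutingEigenvectors

/-! ### Growth estimates and extension of scalars -/

section GelfandKirillov

open Filter Topology

theorem tendsto_log_mul_pow_div_log {D : ℝ} (hD : 0 < D) (e : ℕ) :
    Tendsto (fun n : ℕ => Real.log (D * (n : ℝ) ^ e) / Real.log n) atTop (𝓝 e) := by
  have h1 : Tendsto (fun n : ℕ => Real.log n) atTop atTop :=
    Real.tendsto_log_atTop.comp tendsto_natCast_atTop_atTop
  have h2 : Tendsto (fun n : ℕ => Real.log D / Real.log n + e) atTop (𝓝 (0 + e)) :=
    (h1.const_div_atTop _).add tendsto_const_nhds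
  rw [zero_add] at h2
  refine h2.congr' ?_
  filter_upwards [eventually_ge_atTop 2] with n hn
  have hn' : (2 : ℝ) ≤ n := by exact_mod_cast hn
  have hlog : Real.log n ≠ 0 := (Real.log_pos (by linarith)).ne'
  rw [Real.log_mul hD.ne' (by positivity), Real.log_pow, add_div, mul_div_assoc, div_self hlog,
    mul_one]

theorem le_limsup_log_div_log {d : ℕ → ℕ} {D : ℝ} (hD : 0 < D) {e : ℕ}
    (h : ∀ᶠ n : ℕ in atTop, D * (n : ℝ) ^ e ≤ d n) :
    ((e : ℝ) : EReal) ≤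
      limsup (fun n : ℕ => ((Real.log (d n) / Real.log n : ℝ) : EReal)) atTop := by
  have h1 := (continuous_coe_real_ereal.tendsto _).comp (tendsto_log_mul_pow_div_log hD e)
  rw [← h1.limsup_eq]
  refine limsup_le_limsup ?_
  filter_upwards [h, eventually_ge_atTop 2] with n hn h2
  have hn' : (2 : ℝ) ≤ n := by exact_mod_cast h2
  have hlog : 0 < Real.log n := Real.log_pos (by linarith)
  simp only [Function.comp_apply]
  rw [EReal.coe_le_coe_iff]
  gcongr

theorem limsup_log_div_log_le {d : ℕ → ℕ} {D : ℝ} (hD : 0 < D) {e : ℕ} (h0 : ∀ n, 0 < d n)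
    (h : ∀ᶠ n : ℕ in atTop, (d n : ℝ) ≤ D * (n : ℝ) ^ e) :
    limsup (fun n : ℕ => ((Real.log (d n) / Real.log n : ℝ) : EReal)) atTop ≤
      ((e : ℝ) : EReal) := by
  have h1 := (continuous_coe_real_ereal.tendsto _).comp (tendsto_log_mul_pow_div_log hD e)
  rw [← h1.limsup_eq]
  refine limsup_le_limsup ?_
  filter_upwards [h, eventually_ge_atTop 2] with n hn h2
  have hn' : (2 : ℝ) ≤ n := by exact_mod_cast h2
  have hlog : 0 < Real.log n := Real.log_pos (by linarith)
  have := h0 n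
  simp only [Function.comp_apply]
  rw [EReal.coe_le_coe_iff]
  gcongr

variable {K : Type u} [Field K] {A : Type v} [Ring A] [Algebra K A]

theorem fg_one_sup_pow {V : Submodule K A} (hV : V.FG) (n : ℕ) :
    ((1 ⊔ V) ^ n : Submodule K A).FG := by
  refine Submodule.FG.pow (Submodule.FG.sup ?_ hV) n
  rw [Submodule.one_eq_span]
  exact Submodule.fg_span_singleton 1

theorem finrank_one_sup_pow_pos [Nontrivial A] {V : Submodule K A} (hV : V.FG) (n : ℕ) :
    0 < Module.finrank K ↥((1 ⊔ V) ^ n : Submodule K A) := by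
  have := Module.Finite.iff_fg.2 (fg_one_sup_pow hV n)
  have h1 : (1 : A) ∈ ((1 ⊔ V) ^ n : Submodule K A) :=
    Submodule.one_le.1 (one_le_pow_of_one_le' le_sup_left n)
  rw [Module.finrank_pos_iff_exists_ne_zero]
  exact ⟨⟨1, h1⟩, fun h => one_ne_zero (congrArg Subtype.val h)⟩

/-- Any finite dimensional V lies in some Wᵐ, so (K + V)ⁿ ⊆ Wᵐⁿ, and m affects only the constant of
the quadratic bound. -/
theorem gkDim_le_two [Nontrivial A] (W : Submodule K A) (h1 : 1 ≤ W) (hW : ∀ x, ∃ n, x ∈ W ^ n)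
    (hfin : ∀ n, Module.Finite K ↥(W ^ n)) (C : ℕ)
    (hC : ∀ n, Module.finrank K ↥(W ^ n) ≤ C * (n + 1) ^ 2) : gkDim K A ≤ 2 := by
  have hmono : ∀ {m n : ℕ}, m ≤ n → W ^ m ≤ W ^ n := fun h => pow_le_pow_right₀ h1 h
  refine iSup_le fun V => ?_
  obtain ⟨m, hm⟩ : ∃ m, V.1 ≤ W ^ m := by
    obtain ⟨S, hS⟩ := V.2
    choose n hn using hW
    refine ⟨S.sup n, ?_⟩
    rw [← hS, Submodule.span_le]
    exact fun x hx => hmono (Finset.le_sup hx) (hn x)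
  have hle : ∀ n, ((1 ⊔ V.1) ^ n : Submodule K A) ≤ W ^ (m * n) := by
    intro n
    rw [pow_mul]
    exact pow_le_pow_left' (sup_le (one_le_pow_of_one_le' h1 m) hm) n
  refine (limsup_log_div_log_le (D := (C + 1) * (m + 1) ^ 2) (e := 2) (by positivity)
    (finrank_one_sup_pow_pos V.2) ?_).trans (by norm_num; rfl)
  filter_upwards [eventually_ge_atTop 1] with n hn
  have h2 := (Submodule.finrank_mono (hle n)).trans (hC (m * n))
  have h3 : ((Module.finrank K ↥((1 ⊔ V.1) ^ n : Submodule K A) : ℕ) : ℝ) ≤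
      C * (m * n + 1) ^ 2 := by exact_mod_cast h2
  refine h3.trans ?_
  rw [mul_assoc, ← mul_pow]
  have hn' : (1 : ℝ) ≤ n := by exact_mod_cast hn
  gcongr
  · linarith
  · nlinarith

variable {L : Type u} [Field L] [Algebra K L]

theorem mul_mem_baseChange {V W : Submodule K A} {x y : L ⊗[K] A} (hx : x ∈ V.baseChange L)
    (hy : y ∈ W.baseChange L) : x * y ∈ (V * W).baseChange L := by
  have h : V.baseChange L * W.baseChange L ≤ (V * W).baseChange L := by
    rw [Submodule.baseChange_eq_span, Submodule.baseChange_eq_span, Submodule.span_mul_span,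
      Submodule.span_le]
    rintro _ ⟨_, ⟨a, ha, rfl⟩, _, ⟨b, hb, rfl⟩, rfl⟩
    simp only [TensorProduct.mk_apply, Algebra.TensorProduct.tmul_mul_tmul, SetLike.mem_coe]
    exact Submodule.tmul_mem_baseChange_of_mem _ (Submodule.mul_mem_mul ha hb)
  exact h (Submodule.mul_mem_mul hx hy)

theorem pow_mem_baseChange {V : Submodule K A} {x : L ⊗[K] A} (hx : x ∈ V.baseChange L) (n : ℕ) :
    x ^ n ∈ (V ^ n).baseChange L := by
  induction n with
  | zero =>
    rw [pow_zero, pow_zero]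
    exact Submodule.tmul_mem_baseChange_of_mem 1 (Submodule.one_le.1 le_rfl)
  | succ n ih =>
    rw [pow_succ, pow_succ]
    exact mul_mem_baseChange ih hx

theorem exists_fg_mem_baseChange (x : L ⊗[K] A) : ∃ V : Submodule K A, V.FG ∧ x ∈ V.baseChange L := by
  induction x with
  | zero => exact ⟨⊥, Submodule.fg_bot, zero_mem _⟩
  | tmul l a => exact ⟨Submodule.span K {a}, Submodule.fg_span_singleton a,
      Submodule.tmul_mem_baseChange_of_mem _ (Submodule.mem_span_singleton_self a)⟩
  | add x y hx hy =>
    obtain ⟨V, hV, hx⟩ := hx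
    obtain ⟨W, hW, hy⟩ := hy
    exact ⟨V ⊔ W, hV.sup hW, add_mem (Submodule.baseChange_mono L le_sup_left hx)
      (Submodule.baseChange_mono L le_sup_right hy)⟩

theorem finrank_baseChange_le {V : Submodule K A} (hV : V.FG) :
    Module.Finite L ↥(V.baseChange L) ∧
      Module.finrank L ↥(V.baseChange L) ≤ Module.finrank K V := by
  have := Module.Finite.iff_fg.2 hV
  have hs := V.toBaseChange_surjective L
  exact ⟨Module.Finite.of_surjective _ hs, by
    simpa [Module.finrank_baseChange] using LinearMap.finrank_le_finrank_of_surjective hs⟩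

/-- The elements p, q, r need not lie in A, but they lie in the base change of some finite
dimensional V over K. The m³ monomials with exponents below m lie in the base change of (K + V)ⁿ for
n ≥ 3m, and base change does not increase dimension. -/
theorem three_le_gkDim {p q r : L ⊗[K] A}
    (h : LinearIndependent L (fun t : ℕ × (ℕ × ℕ) => p ^ t.1 * (q ^ t.2.1 * r ^ t.2.2))) :
    3 ≤ gkDim K A := by
  obtain ⟨V₁, hV₁, hp⟩ := exists_fg_mem_baseChange p
  obtain ⟨V₂, hV₂, hq⟩ := exists_fg_mem_baseChange q
  obtain ⟨V₃, hV₃, hr⟩ := exists_fg_mem_baseChange r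
  let V := V₁ ⊔ V₂ ⊔ V₃
  have hV : V.FG := (hV₁.sup hV₂).sup hV₃
  let U : Submodule K A := 1 ⊔ V
  have hUV : V ≤ U := le_sup_right
  have hp' : p ∈ U.baseChange L :=
    Submodule.baseChange_mono L ((le_sup_left.trans le_sup_left).trans hUV) hp
  have hq' : q ∈ U.baseChange L :=
    Submodule.baseChange_mono L ((le_sup_right.trans le_sup_left).trans hUV) hq
  have hr' : r ∈ U.baseChange L := Submodule.baseChange_mono L (le_sup_right.trans hUV) hr
  have hmem : ∀ t : ℕ × (ℕ × ℕ), ∀ n, t.1 + (t.2.1 + t.2.2) ≤ n →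
      p ^ t.1 * (q ^ t.2.1 * r ^ t.2.2) ∈ (U ^ n).baseChange L := by
    intro t n ht
    refine Submodule.baseChange_mono L (pow_le_pow_right₀ le_sup_left ht) ?_
    rw [pow_add, pow_add]
    exact mul_mem_baseChange (pow_mem_baseChange hp' _)
      (mul_mem_baseChange (pow_mem_baseChange hq' _) (pow_mem_baseChange hr' _))
  have hcount : ∀ m n : ℕ, 3 * m ≤ n → m ^ 3 ≤ Module.finrank K ↥(U ^ n) := by
    intro m n hmn
    obtain ⟨hfin, hle⟩ := finrank_baseChange_le (L := L) (fg_one_sup_pow hV n)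
    refine le_trans ?_ hle
    let g : Fin m × (Fin m × Fin m) → ℕ × (ℕ × ℕ) := fun t => (t.1, (t.2.1, t.2.2))
    have hg : Function.Injective g := by
      rintro ⟨a, b, c⟩ ⟨a', b', c'⟩ h
      simp only [g, Prod.mk.injEq, Fin.val_inj] at h
      simp [h]
    have h1 := finrank_span_eq_card (h.comp g hg)
    have h2 : Fintype.card (Fin m × (Fin m × Fin m)) = m ^ 3 := by
      simp; ring
    rw [← h2, ← h1]
    refine Submodule.finrank_mono (Submodule.span_le.2 ?_)
    rintro _ ⟨t, rfl⟩
    refine hmem _ _ ?_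
    simp only [g]
    omega
  refine le_trans ?_ (le_iSup _ ⟨V, hV⟩)
  -- The constant is 5⁻³, from n ≤ 5⌊n/3⌋ for n ≥ 3.
  refine le_trans (by norm_num; rfl) (le_limsup_log_div_log (D := 1 / 125) (e := 3) (by norm_num) ?_)
  filter_upwards [eventually_ge_atTop 3] with n hn
  have h1 : n ≤ 5 * (n / 3) := by omega
  have h2 := hcount (n / 3) n (by omega)
  have h3 : ((n / 3 : ℕ) : ℝ) ^ 3 ≤ (Module.finrank K ↥(U ^ n) : ℝ) := by exact_mod_cast h2
  refine le_trans ?_ h3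
  have h4 : (n : ℝ) ≤ 5 * ((n / 3 : ℕ) : ℝ) := by exact_mod_cast h1
  have h5 : (n : ℝ) ^ 3 ≤ (5 * ((n / 3 : ℕ) : ℝ)) ^ 3 := by gcongr
  rw [mul_pow] at h5
  linarith

end GelfandKirillov

/-! ### Diagonalizability in the absence of generalized eigenvectors of height two -/

section Semisimplicity

variable {k : Type u} [Field k] {R : Type v} [Ring R] [Algebra k R]

/-- If a vector has height greater than two, a suitable power of D - μ takes it to one of height
exactly two; excluding that height leaves only eigenvectors and zero. -/
theorem mem_eigenspace_of_pow_eq_zero {D : Module.End k R}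
    (h : ∀ μ c, ¬ IsGenEigenvector D μ 1 c) {μ : k} {y : R} {n : ℕ}
    (hn : ((D - algebraMap k _ μ) ^ (n + 1)) y = 0) : y ∈ Module.End.eigenspace D μ := by
  rw [Module.End.mem_eigenspace_iff]
  induction n with
  | zero => simpa [sub_eq_zero] using hn
  | succ n ih =>
    refine ih ?_
    by_contra hne
    rw [pow_succ', Module.End.mul_apply] at hne
    refine h μ (((D - algebraMap k _ μ) ^ n) y) ⟨by rwa [pow_one], ?_⟩
    rw [← Module.End.mul_apply, ← pow_add, add_comm, ← add_assoc]
    exact hn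

theorem mem_iSup_eigenspace_of_mem_invariant [IsAlgClosed k] {D : Module.End k R}
    (h : ∀ μ c, ¬ IsGenEigenvector D μ 1 c) (W : Submodule k R) (hW : Module.Finite k W)
    (hinv : W ≤ W.comap D) {x : R} (hx : x ∈ W) :
    x ∈ ⨆ μ : k, Module.End.eigenspace D μ := by
  have htop := Module.End.iSup_maxGenEigenspace_eq_top
    (LinearMap.restrict D hinv : Module.End k W)
  have hmem : (⟨x, hx⟩ : W) ∈
      ⨆ μ, Module.End.maxGenEigenspace (LinearMap.restrict D hinv : Module.End k W) μ :=
    htop ▸ Submodule.mem_top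
  have h1 := Submodule.mem_map_of_mem (f := W.subtype) hmem
  rw [Submodule.map_iSup] at h1
  have h2 : ⨆ μ, (Module.End.maxGenEigenspace (LinearMap.restrict D hinv : Module.End k W) μ).map
      W.subtype ≤ ⨆ μ : k, Module.End.eigenspace D μ := iSup_mono fun μ => ?_
  · exact h2 h1
  rw [Module.End.maxGenEigenspace, Module.End.genEigenspace_restrict, Submodule.map_comap_eq]
  refine inf_le_right.trans fun y hy => ?_
  obtain ⟨n, hn⟩ := (Module.End.mem_maxGenEigenspace D μ y).1 hy
  rw [← Algebra.algebraMap_eq_smul_one] at hn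
  exact mem_eigenspace_of_pow_eq_zero h (pow_apply_eq_zero_of_le n.le_succ hn)

end Semisimplicity

/-! ### The eigenvalue algebra and the torsion algebra over the algebraic closure -/

section EigenvalueAlgebra

variable {K : Type u} [Field K] {A : Type v} [Ring A] [Algebra K A]

local notation "K̄" => AlgebraicClosure K

theorem mem_eigenAlg {δ : Module.End K A} {x : A} : x ∈ eigenAlg K δ ↔
    (1 : K̄) ⊗ₜ[K] x ∈ ⨆ μ : K̄, Module.End.eigenspace (δ.baseChange K̄) μ := Iff.rfl

theorem mem_torsionAlg {δ : Module.End K A} {x : A} : x ∈ torsionAlg K δ ↔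
    (Submodule.span K (Set.range fun n : ℕ => (δ ^ n) x)).FG := Iff.rfl

theorem kernelAlg_le_eigenAlg (δ : Module.End K A) : kernelAlg K δ ≤ eigenAlg K δ := by
  intro x hx
  refine Submodule.mem_iSup_of_mem (0 : K̄) ?_
  rw [Module.End.mem_eigenspace_iff, zero_smul, TensorProduct.mk_apply, LinearMap.baseChange_tmul,
    LinearMap.mem_ker.1 hx, TensorProduct.tmul_zero]

theorem kernelAlg_le_nilAlg (δ : Module.End K A) : kernelAlg K δ ≤ nilAlg K δ := by
  refine le_trans ?_ (le_iSup (fun i : ℕ => LinearMap.ker (δ ^ (i + 1))) 0)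
  rw [zero_add, pow_one]
  exact le_rfl

theorem mem_nilAlg {δ : Module.End K A} {x : A} : x ∈ nilAlg K δ ↔ ∃ i : ℕ, (δ ^ (i + 1)) x = 0 := by
  rw [nilAlg, Submodule.mem_iSup_of_directed]
  · simp
  · refine Monotone.directed_le fun i j hij x hx => ?_
    exact pow_apply_eq_zero_of_le (Nat.succ_le_succ hij) hx

theorem one_tmul_injective : Function.Injective fun x : A => (1 : K̄) ⊗ₜ[K] x :=
  Algebra.TensorProduct.includeRight_injective (FaithfulSMul.algebraMap_injective K K̄)

theorem exists_eigenvector_of_kernelAlg_ne_eigenAlg {δ : Module.End K A}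
    (h : kernelAlg K δ ≠ eigenAlg K δ) :
    ∃ lam : K̄, lam ≠ 0 ∧ ∃ b : K̄ ⊗[K] A, IsGenEigenvector (δ.baseChange K̄) lam 0 b := by
  by_contra! hno
  refine h (le_antisymm (kernelAlg_le_eigenAlg δ) fun x hx => ?_)
  rw [mem_eigenAlg] at hx
  have hle : ⨆ μ : K̄, Module.End.eigenspace (δ.baseChange K̄) μ ≤ LinearMap.ker (δ.baseChange K̄) := by
    refine iSup_le fun μ b hb => ?_
    rw [Module.End.mem_eigenspace_iff] at hb
    by_cases hμ : μ = 0
    · rw [LinearMap.mem_ker, hb, hμ, zero_smul]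
    · by_cases hb0 : b = 0
      · rw [hb0]; exact zero_mem _
      · exact absurd ⟨by simpa using hb0, by simp [hb]⟩ (hno μ hμ b)
  have h1 := hle hx
  rw [LinearMap.mem_ker, LinearMap.baseChange_tmul] at h1
  exact one_tmul_injective (K := K) (h1.trans (TensorProduct.tmul_zero _ _).symm)

theorem exists_genEigenvector_of_kernelAlg_ne_nilAlg {δ : Module.End K A}
    (h : kernelAlg K δ ≠ nilAlg K δ) :
    ∃ c : K̄ ⊗[K] A, IsGenEigenvector (δ.baseChange K̄) 0 1 c := by
  obtain ⟨x, hx, hx'⟩ : ∃ x, (δ ^ 2) x = 0 ∧ δ x ≠ 0 := by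
    by_contra! hno
    refine h (le_antisymm (kernelAlg_le_nilAlg δ) fun x hx => ?_)
    obtain ⟨i, hi⟩ := mem_nilAlg.1 hx
    induction i with
    | zero => simpa [kernelAlg] using hi
    | succ i ih =>
      refine ih ?_
      rw [pow_succ', Module.End.mul_apply]
      refine hno _ ?_
      rw [← Module.End.mul_apply, ← pow_add, add_comm]
      exact hi
  refine ⟨1 ⊗ₜ x, ?_, ?_⟩
  · rw [map_zero, sub_zero, pow_one, LinearMap.baseChange_tmul]
    intro h0
    exact hx' (one_tmul_injective (K := K) (h0.trans (TensorProduct.tmul_zero _ _).symm))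
  · rw [map_zero, sub_zero, ← LinearMap.baseChange_pow, LinearMap.baseChange_tmul, hx,
      TensorProduct.tmul_zero]

theorem baseChange_mem_span_pow {δ : Module.End K A} (x : A) (n : ℕ) :
    ((δ.baseChange K̄) ^ n) (1 ⊗ₜ x) = (1 : K̄) ⊗ₜ[K] (δ ^ n) x := by
  rw [← LinearMap.baseChange_pow, LinearMap.baseChange_tmul]

/-- A sum of eigenvectors lies in a finite dimensional invariant subspace U over K̄. The base change
of K[δ]x lies in U, and base change preserves rank, so K[δ]x is finite dimensional over K. -/
theorem eigenAlg_le_torsionAlg (δ : Module.End K A) : eigenAlg K δ ≤ torsionAlg K δ := by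
  intro x hx
  rw [mem_eigenAlg] at hx
  rw [mem_torsionAlg]
  set W := Submodule.span K (Set.range fun n : ℕ => (δ ^ n) x) with hW
  obtain ⟨U, hU, hUx, hUδ⟩ : ∃ U : Submodule K̄ (K̄ ⊗[K] A), U.FG ∧ (1 : K̄) ⊗ₜ[K] x ∈ U ∧
      ∀ y ∈ U, δ.baseChange K̄ y ∈ U := by
    generalize (1 : K̄) ⊗ₜ[K] x = z at hx
    induction hx using Submodule.iSup_induction' with
    | mem μ y hy =>
      rw [Module.End.mem_eigenspace_iff] at hy
      refine ⟨Submodule.span K̄ {y}, Submodule.fg_span_singleton y,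
        Submodule.mem_span_singleton_self y, fun w hw => ?_⟩
      obtain ⟨c, rfl⟩ := Submodule.mem_span_singleton.1 hw
      rw [map_smul, hy, smul_smul]
      exact Submodule.smul_mem _ _ (Submodule.mem_span_singleton_self y)
    | zero => exact ⟨⊥, Submodule.fg_bot, zero_mem _, fun y hy => by
        rw [(Submodule.mem_bot _).1 hy, map_zero]; exact zero_mem _⟩
    | add y z _ _ hy hz =>
      obtain ⟨U, h1, h2, h3⟩ := hy
      obtain ⟨V, h1', h2', h3'⟩ := hz
      refine ⟨U ⊔ V, h1.sup h1', Submodule.add_mem_sup h2 h2', fun w hw => ?_⟩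
      obtain ⟨a, ha, b, hb, rfl⟩ := Submodule.mem_sup.1 hw
      rw [map_add]
      exact Submodule.add_mem_sup (h3 a ha) (h3' b hb)
  have hWU : W.baseChange K̄ ≤ U := by
    rw [hW, Submodule.baseChange_span, Submodule.span_le]
    rintro _ ⟨_, ⟨n, rfl⟩, rfl⟩
    simp only [TensorProduct.mk_apply, ← baseChange_mem_span_pow, SetLike.mem_coe]
    induction n with
    | zero => simpa using hUx
    | succ n ih => rw [pow_succ', Module.End.mul_apply]; exact hUδ _ ih
  have hfinU := Module.Finite.iff_fg.2 hU
  have hfin : Module.Finite K̄ ↥(W.baseChange K̄) := Submodule.finiteDimensional_of_le hWU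
  have hfin' : Module.Finite K̄ (K̄ ⊗[K] W) :=
    Module.Finite.of_injective (W.toBaseChange K̄) (W.toBaseChange_injective K̄)
  have hrank := Module.rank_lt_aleph0 K̄ (K̄ ⊗[K] W)
  rw [Module.rank_baseChange, Cardinal.lift_lt_aleph0] at hrank
  exact Module.Finite.iff_fg.1 (Module.rank_lt_aleph0_iff.1 hrank)

theorem eigenAlg_eq_torsionAlg {δ : Module.End K A}
    (h : ∀ μ c, ¬ IsGenEigenvector (δ.baseChange K̄) μ 1 c) : eigenAlg K δ = torsionAlg K δ := by
  refine le_antisymm (eigenAlg_le_torsionAlg δ) fun x hx => ?_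
  rw [mem_torsionAlg] at hx
  rw [mem_eigenAlg]
  have hinv : (Submodule.span K (Set.range fun n : ℕ => (δ ^ n) x)).baseChange K̄ ≤
      ((Submodule.span K (Set.range fun n : ℕ => (δ ^ n) x)).baseChange K̄).comap
        (δ.baseChange K̄) := by
    rw [Submodule.baseChange_span, Submodule.span_le]
    rintro _ ⟨_, ⟨n, rfl⟩, rfl⟩
    refine Submodule.subset_span ⟨_, ⟨n + 1, rfl⟩, ?_⟩
    simp [pow_succ']
  refine mem_iSup_eigenspace_of_mem_invariant h _ (finrank_baseChange_le hx).1 hinv ?_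
  exact Submodule.tmul_mem_baseChange_of_mem _ (Submodule.subset_span ⟨0, rfl⟩)

end EigenvalueAlgebra

/-! ### Consequences of GK < 3 after extending scalars -/

section ScalarExtension

variable {K : Type u} [Field K] {A : Type v} [Ring A] [Algebra K A] {L : Type u} [Field L]
  [Algebra K L] [CharZero L] [NoZeroDivisors (L ⊗[K] A)]

theorem not_isGenEigenvector_of_gkDim_lt_three (hgk : gkDim K A < 3) {a b c : L ⊗[K] A}
    (ha : ∀ p : L[X], Polynomial.aeval a p = 0 → p = 0) {lam μ : L} (hlam : lam ≠ 0)
    (hb : IsGenEigenvector (innerDer L a) lam 0 b) :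
    ¬ IsGenEigenvector (innerDer L a) μ 1 c := by
  intro hc
  have : Nontrivial (L ⊗[K] A) := ⟨⟨b, 0, by simpa using hb.1⟩⟩
  have h := linearIndependent_of_eigenvector_of_genEigenvector ha hlam hb hc
  exact hgk.not_ge (three_le_gkDim h)

theorem exists_eq_of_eigenvectors_of_gkDim_lt_three [IsAlgClosed L] (hgk : gkDim K A < 3)
    {B : Type*} [CommRing B] [IsDomain B] [Algebra L B] (ι : B →ₐ[L] L ⊗[K] A)
    (hι : Function.Injective ι) {b c : B} (hc : ∀ p : L[X], Polynomial.aeval c p = 0 → p = 0)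
    {lam μ : L} (hlam : lam ≠ 0) (hμ : μ ≠ 0) {u v : L ⊗[K] A}
    (hu : IsGenEigenvector (innerDer L (ι c)) lam 0 u)
    (hv : IsGenEigenvector (innerDer L (ι b)) μ 0 v) :
    ∃ ρ ω : L, b = ρ • c + algebraMap L B ω := by
  have hu0 : u ≠ 0 := by simpa using hu.1
  have hv0 : v ≠ 0 := by simpa using hv.1
  have : Nontrivial (L ⊗[K] A) := ⟨⟨u, 0, hu0⟩⟩
  by_contra hno
  by_cases hP : ∀ P, translateEval c b (0 : L) 0 P = 0 → P = 0
  · have h := linearIndependent_of_algebraicIndependent ι hι hlam hu hP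
    exact hgk.not_ge (three_le_gkDim h)
  · push Not at hP
    obtain ⟨P, hP0, hP⟩ := hP
    have hu1 : innerDer L (ι c) u = lam • u := by simpa [sub_eq_zero] using hu.2
    have hv1 : innerDer L (ι b) v = μ • v := by simpa [sub_eq_zero] using hv.2
    have h := linearIndependent_of_algebraicDependent ι hι hc hlam hμ hu0 hv0 hu1 hv1 hno hP hP0
    exact hgk.not_ge (three_le_gkDim h)

/-- The subalgebra generated by b and c is a commutative domain, which serves as the ring B of the
preceding result. -/
theorem exists_eq_of_commute_of_gkDim_lt_three [IsAlgClosed L] (hgk : gkDim K A < 3)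
    {b c u v : L ⊗[K] A} (hc : ∀ p : L[X], Polynomial.aeval c p = 0 → p = 0) (hbc : c * b = b * c)
    {lam μ : L} (hlam : lam ≠ 0) (hμ : μ ≠ 0) (hu : IsGenEigenvector (innerDer L c) lam 0 u)
    (hv : IsGenEigenvector (innerDer L b) μ 0 v) :
    ∃ ρ ω : L, b = ρ • c + algebraMap L (L ⊗[K] A) ω := by
  have : Nontrivial (L ⊗[K] A) := ⟨⟨u, 0, by simpa using hu.1⟩⟩
  let B := Algebra.adjoin L {c, b}
  have : IsMulCommutative B := Algebra.isMulCommutative_adjoin L (by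
    rintro x (rfl | rfl) y (rfl | rfl)
    · rfl
    · exact hbc
    · exact hbc.symm
    · rfl)
  let _ : CommRing B := { (inferInstance : Ring B) with mul_comm := mul_comm' }
  have : IsDomain B := NoZeroDivisors.to_isDomain B
  let c' : B := ⟨c, Algebra.subset_adjoin (by simp)⟩
  let b' : B := ⟨b, Algebra.subset_adjoin (by simp)⟩
  have hc' : ∀ p : L[X], Polynomial.aeval c' p = 0 → p = 0 := by
    intro p hp
    refine hc p ?_
    have := congrArg B.val hp
    rwa [map_zero, ← Polynomial.aeval_algHom_apply] at this
  obtain ⟨ρ, ω, h⟩ := exists_eq_of_eigenvectors_of_gkDim_lt_three hgk B.val Subtype.val_injective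
    (b := b') hc' hlam hμ hu hv
  exact ⟨ρ, ω, congrArg Subtype.val h⟩

end ScalarExtension

/-! ### The Dixmier partition for GK < 3 -/

section SmallGrowth

variable {K : Type u} [Field K] {A : Type v} [Ring A] [Algebra K A]

local notation "K̄" => AlgebraicClosure K

theorem baseChange_innerDer (a : A) :
    (innerDer K a).baseChange K̄ = innerDer K̄ ((1 : K̄) ⊗ₜ[K] a) := by
  refine TensorProduct.AlgebraTensorModule.ext fun l x => ?_
  simp [innerDer_apply, TensorProduct.tmul_sub]

/-- A K-linear retraction φ of K → K̄, applied to the left tensor factor, carries the relation down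
to K. -/
theorem exists_eq_of_one_tmul_eq {b c : A} {ρ ω : K̄}
    (h : (1 : K̄) ⊗ₜ[K] b = ρ • ((1 : K̄) ⊗ₜ[K] c) + algebraMap K̄ (K̄ ⊗[K] A) ω) :
    ∃ ρ' ω' : K, b = ρ' • c + algebraMap K A ω' := by
  obtain ⟨φ, hφ⟩ := (Algebra.linearMap K K̄).exists_leftInverse_of_injective
    (LinearMap.ker_eq_bot.2 (FaithfulSMul.algebraMap_injective K K̄))
  have hφ1 : φ 1 = 1 := by
    have := LinearMap.congr_fun hφ 1
    simpa using this
  refine ⟨φ ρ, φ ω, ?_⟩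
  rw [Algebra.TensorProduct.algebraMap_apply, TensorProduct.smul_tmul', smul_eq_mul, mul_one,
    Algebra.algebraMap_self_apply] at h
  have := congrArg (TensorProduct.lid K A ∘ φ.rTensor A) h
  simpa [hφ1, ← Algebra.algebraMap_eq_smul_one] using this

/-- In a domain over K̄ an algebraic element is a scalar. If 1 ⊗ a is a scalar over K̄ then a is a
scalar over K, hence central. -/
theorem aeval_one_tmul_injective [NoZeroDivisors (K̄ ⊗[K] A)] [Nontrivial A] {a : A}
    (ha : a ∉ Subalgebra.center K A) (p : K̄[X]) (hp : Polynomial.aeval ((1 : K̄) ⊗ₜ[K] a) p = 0) :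
    p = 0 := by
  have : Nontrivial (K̄ ⊗[K] A) := (one_tmul_injective (K := K) (A := A)).nontrivial
  by_contra hp0
  obtain ⟨κ, hκ⟩ := exists_eq_algebraMap_of_aeval_eq_zero hp0 hp
  obtain ⟨ρ, ω, h⟩ := exists_eq_of_one_tmul_eq (b := a) (c := (0 : A)) (ρ := 0) (ω := κ)
    (by rw [zero_smul, zero_add, hκ])
  rw [smul_zero, zero_add] at h
  exact ha (h ▸ Subalgebra.algebraMap_mem _ ω)

variable [CharZero K] [NoZeroDivisors (AlgebraicClosure K ⊗[K] A)] [Nontrivial A]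

theorem nilAlg_eq_and_eigenAlg_eq_of_gkDim_lt_three (hgk : gkDim K A < 3) {a : A}
    (ha : a ∉ Subalgebra.center K A)
    (h : kernelAlg K (innerDer K a) ≠ eigenAlg K (innerDer K a)) :
    nilAlg K (innerDer K a) = kernelAlg K (innerDer K a) ∧
      eigenAlg K (innerDer K a) = torsionAlg K (innerDer K a) := by
  have : Nontrivial (K̄ ⊗[K] A) := (one_tmul_injective (K := K) (A := A)).nontrivial
  obtain ⟨lam, hlam, b, hb⟩ := exists_eigenvector_of_kernelAlg_ne_eigenAlg h
  have hno : ∀ μ c, ¬ IsGenEigenvector ((innerDer K a).baseChange K̄) μ 1 c := by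
    intro μ c hc
    rw [baseChange_innerDer] at hb hc
    exact not_isGenEigenvector_of_gkDim_lt_three hgk (aeval_one_tmul_injective ha) hlam hb hc
  refine ⟨?_, eigenAlg_eq_torsionAlg hno⟩
  by_contra hne
  obtain ⟨c, hc⟩ := exists_genEigenvector_of_kernelAlg_ne_nilAlg (Ne.symm hne)
  exact hno 0 c hc

theorem admitsDixmierPartition_of_gkDim_lt_three (hgk : gkDim K A < 3) :
    AdmitsDixmierPartition K A := by
  intro a ha
  by_cases hD : kernelAlg K (innerDer K a) = eigenAlg K (innerDer K a)
  · by_cases hN : kernelAlg K (innerDer K a) = nilAlg K (innerDer K a)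
    · exact Or.inr (Or.inr (Or.inr (Or.inr ⟨ha, hN.symm.trans hD, hD.symm⟩)))
    · by_cases hT : nilAlg K (innerDer K a) = ⊤
      · exact Or.inl ⟨ha, hT, hD.symm⟩
      · exact Or.inr (Or.inl ⟨ha, hN, hT, hD.symm⟩)
  · obtain ⟨hN, hF⟩ := nilAlg_eq_and_eigenAlg_eq_of_gkDim_lt_three hgk ha hD
    by_cases hT : torsionAlg K (innerDer K a) = ⊤
    · exact Or.inr (Or.inr (Or.inl ⟨ha, hN, hF.trans hT⟩))
    · exact Or.inr (Or.inr (Or.inr (Or.inl ⟨ha, hN, hD, hF, hT⟩)))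

/-- The growth bound gives an affine relation between 1 ⊗ b and 1 ⊗ c over K̄, which descends to b =
ρ'c + ω'. Here ρ' ≠ 0, since otherwise b would be central. -/
theorem mem_scaledCoset_of_commute (hgk : gkDim K A < 3) {b c : A}
    (hb : b ∉ Subalgebra.center K A) (hc : c ∉ Subalgebra.center K A) (hbc : c * b = b * c)
    (hDb : kernelAlg K (innerDer K b) ≠ eigenAlg K (innerDer K b))
    (hDc : kernelAlg K (innerDer K c) ≠ eigenAlg K (innerDer K c)) : b ∈ scaledCoset K c := by
  have : Nontrivial (K̄ ⊗[K] A) := (one_tmul_injective (K := K) (A := A)).nontrivial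
  by_contra hno
  obtain ⟨lam, hlam, u, hu⟩ := exists_eigenvector_of_kernelAlg_ne_eigenAlg hDc
  obtain ⟨μ, hμ, v, hv⟩ := exists_eigenvector_of_kernelAlg_ne_eigenAlg hDb
  rw [baseChange_innerDer] at hu hv
  obtain ⟨ρ, ω, h⟩ := exists_eq_of_commute_of_gkDim_lt_three hgk
    (aeval_one_tmul_injective hc) (b := (1 : K̄) ⊗ₜ[K] b)
    (by rw [Algebra.TensorProduct.tmul_mul_tmul, Algebra.TensorProduct.tmul_mul_tmul, hbc])
    hlam hμ hu hv
  obtain ⟨ρ', ω', h2⟩ := exists_eq_of_one_tmul_eq h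
  refine hno ⟨ρ', ?_, _, Subalgebra.algebraMap_mem _ ω', h2⟩
  rintro rfl
  rw [zero_smul, zero_add] at h2
  exact hb (h2 ▸ Subalgebra.algebraMap_mem _ ω')

end SmallGrowth

/-! ### From the commutative to the homogeneous centralizer condition -/

section HomogeneousCentralizers

variable {K : Type u} [Field K] {A : Type v} [Ring A] [Algebra K A]

local notation "K̄" => AlgebraicClosure K

theorem mem_kernelAlg_innerDer {a x : A} : x ∈ kernelAlg K (innerDer K a) ↔ a * x = x * a := by
  rw [kernelAlg, LinearMap.mem_ker, innerDer_apply, sub_eq_zero]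

theorem mem_centralizer_singleton {a x : A} :
    x ∈ Subalgebra.centralizer K {a} ↔ a * x = x * a := by
  simp [Subalgebra.mem_centralizer_iff]

theorem innerDer_commute {a b : A} (h : a * b = b * a) :
    Commute (innerDer K a) (innerDer K b) := by
  refine LinearMap.ext fun x => ?_
  have h1 : a * (b * x) = b * (a * x) := by rw [← mul_assoc, h, mul_assoc]
  have h2 : x * a * b = x * b * a := by rw [mul_assoc, h, mul_assoc]
  simp only [Module.End.mul_apply, innerDer_apply, mul_sub, sub_mul, h1, h2, mul_assoc]
  abel

/-- Write δ for ad. If δ_aⁱ⁺¹ kills y then δ_aⁱ y lies in C(a) ⊆ C(b). As δ_a and δ_b commute, δ_aⁱ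
kills δ_b y, so one power of δ_a is traded for one of δ_b. -/
theorem nilAlg_le_nilAlg_of_commute {a b : A} (hab : a * b = b * a)
    (hcomm : ∀ x, a * x = x * a → b * x = x * b) :
    nilAlg K (innerDer K a) ≤ nilAlg K (innerDer K b) := by
  intro y hy
  rw [mem_nilAlg] at hy ⊢
  obtain ⟨i, hi⟩ := hy
  refine ⟨i, ?_⟩
  have hker : ∀ x, innerDer K a x = 0 → innerDer K b x = 0 := by
    intro x hx
    rw [innerDer_apply, sub_eq_zero] at hx ⊢
    exact hcomm x hx
  induction i generalizing y with
  | zero => simpa using hker y (by simpa using hi)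
  | succ i ih =>
    rw [pow_succ, Module.End.mul_apply]
    refine ih ?_
    rw [← Module.End.mul_apply, ((innerDer_commute hab).pow_left (i + 1)).eq, Module.End.mul_apply]
    refine hker _ ?_
    rwa [← Module.End.mul_apply, ← pow_succ']

theorem eigenAlg_smul_le {δ : Module.End K A} {r : K} (hr : r ≠ 0) :
    eigenAlg K (r • δ) ≤ eigenAlg K δ := by
  intro x hx
  rw [mem_eigenAlg] at hx ⊢
  have h : ⨆ μ : K̄, Module.End.eigenspace ((r • δ).baseChange K̄) μ ≤
      ⨆ μ : K̄, Module.End.eigenspace (δ.baseChange K̄) μ := by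
    refine iSup_le fun μ => le_trans (fun y hy => ?_)
      (le_iSup (fun μ : K̄ => Module.End.eigenspace (δ.baseChange K̄) μ) (r⁻¹ • μ))
    rw [Module.End.mem_eigenspace_iff] at hy ⊢
    rw [LinearMap.baseChange_smul, LinearMap.smul_apply] at hy
    rw [smul_assoc, ← hy, smul_smul, inv_mul_cancel₀ hr, one_smul]
  exact h hx

theorem eigenAlg_smul {δ : Module.End K A} {r : K} (hr : r ≠ 0) :
    eigenAlg K (r • δ) = eigenAlg K δ := by
  refine le_antisymm (eigenAlg_smul_le hr) ?_
  have h := eigenAlg_smul_le (δ := r • δ) (inv_ne_zero hr)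
  rwa [smul_smul, inv_mul_cancel₀ hr, one_smul] at h

theorem innerDer_eq_smul_of_mem_scaledCoset {b c : A} (h : b ∈ scaledCoset K c) :
    ∃ r : K, r ≠ 0 ∧ innerDer K b = r • innerDer K c := by
  obtain ⟨r, hr, z, hz, rfl⟩ := h
  refine ⟨r, hr, LinearMap.ext fun x => ?_⟩
  rw [Subalgebra.mem_center_iff] at hz
  simp only [innerDer_apply, LinearMap.smul_apply, add_mul, mul_add, smul_mul_assoc,
    mul_smul_comm, smul_sub, hz]
  abel

/-- A noncentral element has C ≠ A, which makes the five types mutually exclusive. Two shapes are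
compared at a, or at the distinguished semisimple c when a shape supplies one. -/
theorem HasCentralizerShape.eq {a : A} (ha : a ∉ Subalgebra.center K A)
    {s t : CentralizerShape} (hs : HasCentralizerShape K a s) (ht : HasCentralizerShape K a t) :
    s = t := by
  have haa : a ∈ Subalgebra.centralizer K {a} := mem_centralizer_singleton.2 rfl
  have nil_ne : ∀ {b : A}, b ∉ Subalgebra.center K A → nilAlg K (innerDer K b) = ⊤ →
      nilAlg K (innerDer K b) = kernelAlg K (innerDer K b) → False := by
    intro b hb h1 h2
    refine hb (Subalgebra.mem_center_iff.2 fun x => ?_)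
    have hx : x ∈ kernelAlg K (innerDer K b) := by rw [← h2, h1]; trivial
    exact (mem_kernelAlg_innerDer.1 hx).symm
  have ker_ne : ∀ {b : A}, b ∉ Subalgebra.center K A →
      kernelAlg K (innerDer K b) ≠ ⊤ := by
    intro b hb h1
    refine hb (Subalgebra.mem_center_iff.2 fun x => ?_)
    have hx : x ∈ kernelAlg K (innerDer K b) := by rw [h1]; trivial
    exact (mem_kernelAlg_innerDer.1 hx).symm
  cases s <;> cases t <;> first | rfl | exfalso
  all_goals simp only [HasCentralizerShape] at hs ht
  · exact (ht a haa ha).2.2.1 (hs a haa ha).2.1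
  · obtain ⟨c, hc, h, -⟩ := ht
    exact nil_ne h.1 (hs c hc h.1).2.1 h.2.1
  · obtain ⟨c, hc, h, -⟩ := ht
    exact nil_ne h.1 (hs c hc h.1).2.1 h.2.1
  · have h1 := hs a haa ha
    have h2 := ht a haa ha
    exact nil_ne ha h1.2.1 (h2.2.1.trans h2.2.2)
  · exact (hs a haa ha).2.2.1 (ht a haa ha).2.1
  · obtain ⟨c, hc, h, -⟩ := ht
    exact (hs c hc h.1).2.1 h.2.1.symm
  · obtain ⟨c, hc, h, -⟩ := ht
    exact (hs c hc h.1).2.1 h.2.1.symm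
  · have h1 := hs a haa ha
    have h2 := ht a haa ha
    exact h1.2.1 (h2.2.1.trans h2.2.2).symm
  · obtain ⟨c, hc, h, -⟩ := hs
    exact nil_ne h.1 (ht c hc h.1).2.1 h.2.1
  · obtain ⟨c, hc, h, -⟩ := hs
    exact (ht c hc h.1).2.1 h.2.1.symm
  · obtain ⟨c, hc, h, -⟩ := hs
    obtain ⟨c', hc', h', hall⟩ := ht
    by_cases hcc : c ∈ scaledCoset K c'
    · have h1 := (hall c hc h.1).1 hcc
      exact h1.2.2.2.2 (h1.2.2.2.1.symm.trans h.2.2)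
    · have h1 := (hall c hc h.1).2 hcc
      exact ker_ne h.1 (h1.2.2.symm.trans h.2.2)
  · obtain ⟨c, hc, h, -⟩ := hs
    have h1 := ht c hc h.1
    exact ker_ne h.1 (h1.2.2.symm.trans h.2.2)
  · obtain ⟨c, hc, h, -⟩ := hs
    exact nil_ne h.1 (ht c hc h.1).2.1 h.2.1
  · obtain ⟨c, hc, h, -⟩ := hs
    exact (ht c hc h.1).2.1 h.2.1.symm
  · obtain ⟨c, hc, h, -⟩ := ht
    obtain ⟨c', hc', h', hall⟩ := hs
    by_cases hcc : c ∈ scaledCoset K c'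
    · have h1 := (hall c hc h.1).1 hcc
      exact h1.2.2.2.2 (h1.2.2.2.1.symm.trans h.2.2)
    · have h1 := (hall c hc h.1).2 hcc
      exact ker_ne h.1 (h1.2.2.symm.trans h.2.2)
  · obtain ⟨c, hc, h, -⟩ := hs
    exact h.2.2.1 (ht c hc h.1).2.2.symm
  · have h1 := ht a haa ha
    have h2 := hs a haa ha
    exact nil_ne ha h1.2.1 (h2.2.1.trans h2.2.2)
  · have h1 := ht a haa ha
    have h2 := hs a haa ha
    exact h1.2.1 (h2.2.1.trans h2.2.2).symm
  · obtain ⟨c, hc, h, -⟩ := ht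
    have h1 := hs c hc h.1
    exact ker_ne h.1 (h1.2.2.symm.trans h.2.2)
  · obtain ⟨c, hc, h, -⟩ := ht
    exact h.2.2.1 (hs c hc h.1).2.2.symm

/-- By the ccc, C(b) and N(b) are the same for all noncentral b ∈ C(a). The shape is therefore
decided by whether N(a) equals C(a) or A, and by whether some b has D(b) ≠ C(b). -/
theorem exists_hasCentralizerShape [CharZero K] [NoZeroDivisors (AlgebraicClosure K ⊗[K] A)]
    [Nontrivial A] (hgk : gkDim K A < 3) (hccc : CommCentralizerCondition K A) {a : A}
    (ha : a ∉ Subalgebra.center K A) : ∃ s, HasCentralizerShape K a s := by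
  have hker : ∀ b ∈ Subalgebra.centralizer K {a}, b ∉ Subalgebra.center K A → ∀ x,
      a * x = x * a ↔ b * x = x * b := by
    intro b hb hbZ x
    rw [← mem_centralizer_singleton (K := K) (a := a), ← mem_centralizer_singleton (K := K) (a := b)]
    have hab := (mem_centralizer_singleton.1 hb).symm
    exact ⟨fun hx => mem_centralizer_singleton.2 (hccc.2 a ha b hb x hx),
      fun hx => mem_centralizer_singleton.2
        (hccc.2 b hbZ a (mem_centralizer_singleton.2 hab) x hx)⟩
  have hkerEq : ∀ b ∈ Subalgebra.centralizer K {a}, b ∉ Subalgebra.center K A →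
      kernelAlg K (innerDer K b) = kernelAlg K (innerDer K a) := by
    intro b hb hbZ
    ext x
    rw [mem_kernelAlg_innerDer, mem_kernelAlg_innerDer]
    exact (hker b hb hbZ x).symm
  have hnilEq : ∀ b ∈ Subalgebra.centralizer K {a}, b ∉ Subalgebra.center K A →
      nilAlg K (innerDer K b) = nilAlg K (innerDer K a) := by
    intro b hb hbZ
    have hab := mem_centralizer_singleton.1 hb
    exact le_antisymm (nilAlg_le_nilAlg_of_commute hab.symm fun x => (hker b hb hbZ x).2)
      (nilAlg_le_nilAlg_of_commute hab fun x => (hker b hb hbZ x).1)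
  have hss : ∀ b : A, b ∉ Subalgebra.center K A →
      kernelAlg K (innerDer K b) ≠ eigenAlg K (innerDer K b) → _ :=
    fun b => nilAlg_eq_and_eigenAlg_eq_of_gkDim_lt_three (a := b) hgk
  by_cases hN : kernelAlg K (innerDer K a) = nilAlg K (innerDer K a)
  · by_cases hD : ∀ b ∈ Subalgebra.centralizer K {a}, b ∉ Subalgebra.center K A →
      eigenAlg K (innerDer K b) = kernelAlg K (innerDer K b)
    · refine ⟨.generic, fun b hb hbZ => ⟨hbZ, ?_, hD b hb hbZ⟩⟩
      rw [hD b hb hbZ, hnilEq b hb hbZ, hkerEq b hb hbZ, hN]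
    · push Not at hD
      obtain ⟨c, hc, hcZ, hDc⟩ := hD
      have hcomm : ∀ b ∈ Subalgebra.centralizer K {a}, c * b = b * c := fun b hb =>
        hccc.2 a ha c hc b hb
      have hother : ∀ b ∈ Subalgebra.centralizer K {a}, b ∉ Subalgebra.center K A →
          b ∉ scaledCoset K c → IsGenericElt K b := by
        intro b hb hbZ hbc
        have hDb : eigenAlg K (innerDer K b) = kernelAlg K (innerDer K b) := by
          by_contra hne
          exact hbc (mem_scaledCoset_of_commute hgk hbZ hcZ (hcomm b hb) (Ne.symm hne) hDc.symm)
        refine ⟨hbZ, ?_, hDb⟩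
        rw [hDb, hnilEq b hb hbZ, hkerEq b hb hbZ, hN]
      have hsame : ∀ b ∈ Subalgebra.centralizer K {a}, b ∉ Subalgebra.center K A →
          b ∈ scaledCoset K c → eigenAlg K (innerDer K b) = eigenAlg K (innerDer K c) ∧
          kernelAlg K (innerDer K b) ≠ eigenAlg K (innerDer K b) := by
        intro b hb hbZ hbc
        obtain ⟨r, hr, h⟩ := innerDer_eq_smul_of_mem_scaledCoset hbc
        have h1 : eigenAlg K (innerDer K b) = eigenAlg K (innerDer K c) := by
          rw [h, eigenAlg_smul hr]
        refine ⟨h1, ?_⟩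
        rw [h1, hkerEq b hb hbZ, ← hkerEq c hc hcZ]
        exact hDc.symm
      obtain ⟨hNc, hFc⟩ := hss c hcZ hDc.symm
      by_cases hT : eigenAlg K (innerDer K c) = ⊤
      · refine ⟨.genericExceptStronglySemisimple, c, hc, ⟨hcZ, hNc, hT⟩, fun b hb hbZ =>
          ⟨fun hbc => ?_, hother b hb hbZ⟩⟩
        obtain ⟨h1, h2⟩ := hsame b hb hbZ hbc
        exact ⟨hbZ, (hss b hbZ h2).1, h1.trans hT⟩
      · refine ⟨.genericExceptWeaklySemisimple, c, hc, ⟨hcZ, hNc, hDc.symm, hFc, ?_⟩,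
          fun b hb hbZ => ⟨fun hbc => ?_, hother b hb hbZ⟩⟩
        · rwa [← hFc]
        · obtain ⟨h1, h2⟩ := hsame b hb hbZ hbc
          obtain ⟨h3, h4⟩ := hss b hbZ h2
          refine ⟨hbZ, h3, h2, h4, ?_⟩
          rwa [← h4, h1]
  -- When N(a) ≠ C(a), no b can have D(b) ≠ C(b), since that would give N(b) = C(b).
  · have hDb : ∀ b ∈ Subalgebra.centralizer K {a}, b ∉ Subalgebra.center K A →
        eigenAlg K (innerDer K b) = kernelAlg K (innerDer K b) := by
      intro b hb hbZ
      by_contra hne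
      refine hN ?_
      rw [← hkerEq b hb hbZ, ← hnilEq b hb hbZ, (hss b hbZ (Ne.symm hne)).1]
    by_cases hT : nilAlg K (innerDer K a) = ⊤
    · exact ⟨.stronglyNilpotent, fun b hb hbZ =>
        ⟨hbZ, (hnilEq b hb hbZ).trans hT, hDb b hb hbZ⟩⟩
    · refine ⟨.weaklyNilpotent, fun b hb hbZ => ⟨hbZ, ?_, ?_, hDb b hb hbZ⟩⟩
      · rwa [hkerEq b hb hbZ, hnilEq b hb hbZ]
      · rwa [hnilEq b hb hbZ]

theorem homogCentralizerCondition_of_gkDim_lt_three [CharZero K]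
    [NoZeroDivisors (AlgebraicClosure K ⊗[K] A)] (hgk : gkDim K A < 3)
    (hccc : CommCentralizerCondition K A) : HomogCentralizerCondition K A := by
  have : Nontrivial A := by
    obtain ⟨x, y, h⟩ := hccc.1
    exact ⟨⟨_, _, h⟩⟩
  refine ⟨hccc.1, admitsDixmierPartition_of_gkDim_lt_three hgk, fun a ha => ?_⟩
  obtain ⟨s, hs⟩ := exists_hasCentralizerShape hgk hccc ha
  exact ⟨s, hs, fun t ht => HasCentralizerShape.eq ha ht hs⟩

end HomogeneousCentralizers

/-! ### Shifts of rational functions -/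

section ShiftAutomorphism

open Polynomial

variable (K : Type u) [Field K]

/-- The automorphism `f(h) ↦ f(h - n)` of the field of rational functions. -/
noncomputable def ratShift (n : ℤ) : RatFunc K ≃ₐ[K] RatFunc K :=
  IsFractionRing.fieldEquivOfAlgEquiv K (RatFunc K) (RatFunc K)
    (algEquivAevalXAddC (-(n : K)))

variable {K}

theorem ratShift_algebraMap (n : ℤ) (p : K[X]) :
    ratShift K n (algebraMap K[X] (RatFunc K) p) =
      algebraMap K[X] (RatFunc K) (p.comp (X - C (n : K))) := by
  rw [ratShift, IsFractionRing.fieldEquivOfAlgEquiv_algebraMap]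
  simp [algEquivAevalXAddC, comp, aeval_def, sub_eq_add_neg]

theorem ratShift_add (m n : ℤ) (f : RatFunc K) :
    ratShift K (m + n) f = ratShift K m (ratShift K n f) := by
  induction f using RatFunc.induction_on with
  | f p q hq =>
    rw [map_div₀, map_div₀, map_div₀]
    simp only [ratShift_algebraMap, comp_assoc]
    congr 4 <;> simp <;> ring

theorem ratShift_zero (f : RatFunc K) : ratShift K 0 f = f := by
  induction f using RatFunc.induction_on with
  | f p q hq =>
    rw [map_div₀]
    simp [ratShift_algebraMap]

/-- Invariance makes p/q constant along the multiples of n beyond the last one at which q vanishes.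
These are infinitely many points, so p = cq. -/
theorem exists_eq_algebraMap_of_ratShift_eq [CharZero K] {n : ℤ} (hn : n ≠ 0) {f : RatFunc K}
    (hf : ratShift K n f = f) : ∃ c : K, f = algebraMap K (RatFunc K) c := by
  induction f using RatFunc.induction_on with
  | f p q hq =>
    have hq' : algebraMap K[X] (RatFunc K) q ≠ 0 := RatFunc.algebraMap_ne_zero hq
    have hq'' : ratShift K n (algebraMap K[X] (RatFunc K) q) ≠ 0 := by
      rwa [Ne, map_eq_zero]
    rw [map_div₀, div_eq_div_iff hq'' hq', ratShift_algebraMap, ratShift_algebraMap, ← map_mul,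
      ← map_mul, (RatFunc.algebraMap_injective K).eq_iff] at hf
    have hinj : Function.Injective fun m : ℕ => (m : K) * (n : K) := fun i j hij => by
      have hn' : (n : K) ≠ 0 := Int.cast_ne_zero.2 hn
      exact Nat.cast_injective (mul_right_cancel₀ hn' hij)
    have hfin : {m : ℕ | q.eval ((m : K) * n) = 0}.Finite := by
      refine Set.Finite.of_finite_image ((q.rootSet_finite K).subset ?_) hinj.injOn
      rintro _ ⟨m, hm, rfl⟩
      exact (mem_rootSet.2 ⟨hq, by simpa using hm⟩)
    obtain ⟨M, hM⟩ := hfin.bddAbove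
    have hne : ∀ m, M < m → q.eval ((m : K) * n) ≠ 0 := fun m hm h => absurd (hM h) (by omega)
    have hstep : ∀ x : K, p.eval (x - n) * q.eval x = p.eval x * q.eval (x - n) := fun x => by
      simpa using congrArg (eval x) hf
    refine ⟨p.eval (((M + 1 : ℕ) : K) * n) / q.eval (((M + 1 : ℕ) : K) * n), ?_⟩
    set c := p.eval (((M + 1 : ℕ) : K) * n) / q.eval (((M + 1 : ℕ) : K) * n) with hc
    have hall : ∀ j : ℕ, p.eval (((M + 1 + j : ℕ) : K) * n) =
        c * q.eval (((M + 1 + j : ℕ) : K) * n) := by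
      intro j
      induction j with
      | zero =>
        rw [hc, add_zero, div_mul_cancel₀ _ (hne (M + 1) (by omega))]
      | succ j ih =>
        have h1 := hstep (((M + 1 + (j + 1) : ℕ) : K) * n)
        have h2 : ((M + 1 + (j + 1) : ℕ) : K) * n - n = ((M + 1 + j : ℕ) : K) * n := by
          push_cast; ring
        rw [h2, ih] at h1
        refine mul_right_cancel₀ (hne (M + 1 + j) (by omega)) ?_
        rw [← h1]; ring
    have hpq : p = C c * q := by
      refine sub_eq_zero.1 (eq_zero_of_infinite_isRoot _ (Set.Infinite.mono ?_
        (Set.infinite_range_of_injective (f := fun j : ℕ => ((M + 1 + j : ℕ) : K) * n) ?_)))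
      · rintro _ ⟨j, rfl⟩
        simpa [sub_eq_zero] using hall j
      · exact hinj.comp (add_right_injective (M + 1))
    rw [hpq, map_mul, mul_div_cancel_right₀ _ hq']
    rfl

end ShiftAutomorphism

/-! ### Leading terms in skew Laurent style -/

section LeadingTerms

variable {K : Type u} [Field K]

/-- An assignment of leading terms `f x ^ n`, with coefficients rational functions of `h`
subject to `x f(h) = f(h - 1) x`, to the elements of a ring. The relation `lead u n f` says that
`u` has no term of degree less than `n` and that `f` is its (possibly zero) coefficient in degree
`n`. -/
structure IsLeadingTerm {R : Type v} [Ring R] [Algebra K R] (lead : R → ℤ → RatFunc K → Prop) :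
    Prop where
  zero (n : ℤ) : lead 0 n 0
  add {a b : R} {n : ℤ} {f g : RatFunc K} : lead a n f → lead b n g → lead (a + b) n (f + g)
  mul {a b : R} {m n : ℤ} {f g : RatFunc K} :
    lead a m f → lead b n g → lead (a * b) (m + n) (f * ratShift K m g)
  scalar (c : K) : lead (algebraMap K R c) 0 (algebraMap K (RatFunc K) c)
  of_lt {a : R} {m n : ℤ} {f : RatFunc K} : lead a n f → m < n → lead a m 0
  unique {a : R} {n : ℤ} {f g : RatFunc K} : lead a n f → lead a n g → f = g
  exists_ne_zero {a : R} : a ≠ 0 → ∃ n f, f ≠ 0 ∧ lead a n f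

namespace IsLeadingTerm

variable {R : Type v} [Ring R] [Algebra K R] {lead : R → ℤ → RatFunc K → Prop}

theorem smul (h : IsLeadingTerm lead) {a : R} {n : ℤ} {f : RatFunc K} (c : K) (ha : lead a n f) :
    lead (c • a) n (algebraMap K (RatFunc K) c * f) := by
  have := h.mul (h.scalar c) ha
  rwa [zero_add, ratShift_zero, ← Algebra.smul_def] at this

theorem sub (h : IsLeadingTerm lead) {a b : R} {n : ℤ} {f g : RatFunc K} (ha : lead a n f)
    (hb : lead b n g) : lead (a - b) n (f - g) := by
  have := h.add ha (h.smul (-1) hb)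
  simpa [sub_eq_add_neg] using this

theorem le (h : IsLeadingTerm lead) {a : R} {m n : ℤ} {f g : RatFunc K} (hf : f ≠ 0)
    (ha : lead a m f) (ha' : lead a n g) : n ≤ m := by
  by_contra! hlt
  exact hf (h.unique ha (h.of_lt ha' hlt))

theorem ne_zero (h : IsLeadingTerm lead) {a : R} {n : ℤ} {f : RatFunc K} (hf : f ≠ 0)
    (ha : lead a n f) : a ≠ 0 := by
  rintro rfl
  exact hf (h.unique ha (h.zero n))

/-- If b ≠ 0, its own nonzero leading term multiplies with that of a to a nonzero leading term of
ab. So b has degree at least n, and its coefficient in degree n is found by cancelling f. -/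
theorem mul_left_cancel (h : IsLeadingTerm lead) {a b : R} {m n : ℤ} {f g : RatFunc K}
    (hf : f ≠ 0) (ha : lead a m f) (hab : lead (a * b) (m + n) (f * ratShift K m g)) :
    lead b n g := by
  have key : ∀ g', lead b n g' → g' = g := fun g' hb =>
    (ratShift K m).injective (mul_left_cancel₀ hf (h.unique (h.mul ha hb) hab))
  by_cases hb0 : b = 0
  · have h0 : lead b n 0 := hb0 ▸ h.zero n
    exact key 0 h0 ▸ h0
  · obtain ⟨n', g', hg', hb⟩ := h.exists_ne_zero hb0
    have hne : f * ratShift K m g' ≠ 0 := mul_ne_zero hf (by simpa using hg')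
    have hle := h.le hne (h.mul ha hb) hab
    rcases (show n < n' ∨ n' = n by omega) with hlt | rfl
    · have h0 := h.of_lt hb hlt
      exact key 0 h0 ▸ h0
    · exact key g' hb ▸ hb

theorem mul_right_cancel (h : IsLeadingTerm lead) {a b : R} {m n : ℤ} {f g : RatFunc K}
    (hg : g ≠ 0) (hb : lead b n g) (hab : lead (a * b) (m + n) (f * ratShift K m g)) :
    lead a m f := by
  have hg' : ratShift K m g ≠ 0 := by simpa using hg
  have key : ∀ f', lead a m f' → f' = f := fun f' ha =>
    mul_right_cancel₀ hg' (h.unique (h.mul ha hb) hab)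
  by_cases ha0 : a = 0
  · have h0 : lead a m 0 := ha0 ▸ h.zero m
    exact key 0 h0 ▸ h0
  · obtain ⟨m', f', hf', ha⟩ := h.exists_ne_zero ha0
    have hne : f' * ratShift K m' g ≠ 0 := mul_ne_zero hf' (by simpa using hg)
    have hle := h.le hne (h.mul ha hb) hab
    rcases (show m < m' ∨ m' = m by omega) with hlt | rfl
    · have h0 := h.of_lt ha hlt
      exact key 0 h0 ▸ h0
    · exact key f' ha ▸ ha

theorem exists_succ (h : IsLeadingTerm lead) {a : R} {n : ℤ} (ha : lead a n 0) :
    ∃ f, lead a (n + 1) f := by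
  by_cases ha0 : a = 0
  · exact ⟨0, ha0 ▸ h.zero _⟩
  · obtain ⟨m, f, hf, ham⟩ := h.exists_ne_zero ha0
    have hle := h.le hf ham ha
    rcases (show m = n ∨ m = n + 1 ∨ n + 1 < m by omega) with rfl | rfl | hlt
    · exact absurd (h.unique ham ha) hf
    · exact ⟨f, ham⟩
    · exact ⟨0, h.of_lt ham hlt⟩

end IsLeadingTerm

end LeadingTerms

/-! ### Commutativity of centralizers in a division ring with leading terms -/

section CentralizersInDivisionRings

namespace IsLeadingTerm

variable {K : Type u} [Field K] {Q : Type v} [DivisionRing Q] [Algebra K Q]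
  {lead : Q → ℤ → RatFunc K → Prop}

theorem inv (h : IsLeadingTerm lead) {a : Q} {n : ℤ} {f : RatFunc K} (hf : f ≠ 0)
    (ha : lead a n f) : ∃ g, g ≠ 0 ∧ lead a⁻¹ (-n) g := by
  have ha0 := h.ne_zero hf ha
  obtain ⟨m, g, hg, hinv⟩ := h.exists_ne_zero (inv_ne_zero ha0)
  have h1 := h.mul ha hinv
  rw [mul_inv_cancel₀ ha0] at h1
  have h2 := h.scalar (1 : K)
  rw [map_one, map_one] at h2
  have h3 := h.le one_ne_zero h2 h1
  have h4 := h.le (mul_ne_zero hf (by simpa using hg)) h1 h2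
  obtain rfl : m = -n := by omega
  exact ⟨g, hg, hinv⟩

theorem zpow (h : IsLeadingTerm lead) {a : Q} {n : ℤ} {f : RatFunc K} (hf : f ≠ 0)
    (ha : lead a n f) (k : ℤ) : ∃ g, g ≠ 0 ∧ lead (a ^ k) (k * n) g := by
  have hnat : ∀ k : ℕ, ∃ g, g ≠ 0 ∧ lead (a ^ k) (k * n) g := by
    intro k
    induction k with
    | zero =>
      have h2 := h.scalar (1 : K)
      rw [map_one, map_one] at h2
      exact ⟨1, one_ne_zero, by simpa using h2⟩
    | succ k ih =>
      obtain ⟨g, hg, ih⟩ := ih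
      refine ⟨_, mul_ne_zero hg (?_ : ratShift K (k * n) f ≠ 0), ?_⟩
      · simpa using hf
      · have := h.mul ih ha
        rw [pow_succ]
        convert this using 1
        push_cast; ring
  obtain ⟨k, rfl | rfl⟩ := k.eq_nat_or_neg
  · simpa using hnat k
  · obtain ⟨g, hg, hk⟩ := hnat k
    obtain ⟨g', hg', hk'⟩ := h.inv hg hk
    exact ⟨g', hg', by simpa using hk'⟩

variable [CharZero K]

/-- Comparing leading terms of ab and ba gives f σⁿ(g) = g σᵐ(f), and likewise for g'. So g/g' is
σⁿ-invariant, and n ≠ 0 makes it constant. -/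
theorem exists_smul_eq (h : IsLeadingTerm lead) {a b b' : Q} {n m : ℤ} (hn : n ≠ 0)
    {f g g' : RatFunc K} (hf : f ≠ 0) (hg' : g' ≠ 0) (ha : lead a n f) (hb : lead b m g)
    (hb' : lead b' m g') (hab : a * b = b * a) (hab' : a * b' = b' * a) :
    ∃ c : K, g = algebraMap K (RatFunc K) c * g' := by
  have key : ∀ {b : Q} {g : RatFunc K}, lead b m g → a * b = b * a →
      f * ratShift K n g = g * ratShift K m f := by
    intro b g hb hab
    refine h.unique (h.mul ha hb) ?_
    rw [hab, add_comm]
    exact h.mul hb ha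
  have h1 := key hb hab
  have h2 := key hb' hab'
  have hg'' : ratShift K n g' ≠ 0 := by simpa using hg'
  have h3 : ratShift K n (g / g') = g / g' := by
    rw [map_div₀, div_eq_div_iff hg'' hg']
    refine mul_left_cancel₀ (mul_ne_zero hf (?_ : ratShift K m f ≠ 0)) ?_
    · simpa using hf
    · calc f * ratShift K m f * (ratShift K n g * g')
          = (f * ratShift K n g) * (g' * ratShift K m f) := by ring
        _ = f * ratShift K m f * (g * ratShift K n g') := by rw [h1, ← h2]; ring
  obtain ⟨c, hc⟩ := exists_eq_algebraMap_of_ratShift_eq hn h3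
  exact ⟨c, (div_eq_iff hg').1 hc⟩

/-- Let t ∈ C(a) have least positive degree d. Leading coefficients in C(a) are unique up to scalars
in each degree, so subtracting scalar multiples of powers of t from an element of C(a) raises its
degree without limit. No completion is needed: a nonzero commutator has a finite degree, which these
approximations exceed. -/
theorem commute_of_commute_of_degree_ne_zero (h : IsLeadingTerm lead) {a : Q} {n : ℤ} (hn : n ≠ 0)
    {f : RatFunc K} (hf : f ≠ 0) (ha : lead a n f) {b c : Q} (hab : a * b = b * a)
    (hac : a * c = c * a) : b * c = c * b := by
  classical
  have hdeg : ∃ d : ℕ, 0 < d ∧ ∃ t g, g ≠ 0 ∧ a * t = t * a ∧ lead t d g := by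
    refine ⟨n.natAbs, Int.natAbs_pos.2 hn, ?_⟩
    rcases Int.natAbs_eq n with h' | h'
    · exact ⟨a, f, hf, rfl, h' ▸ ha⟩
    · obtain ⟨g, hg, hinv⟩ := h.inv hf ha
      refine ⟨a⁻¹, g, hg, ((Commute.refl a).inv_right₀).eq, ?_⟩
      rwa [h', neg_neg] at hinv
  set d := Nat.find hdeg with hd
  obtain ⟨hd0, t, e, he, hat, ht⟩ := Nat.find_spec hdeg
  rw [← hd] at hd0 ht
  have hatk : ∀ k : ℤ, a * t ^ k = t ^ k * a := fun k => (Commute.zpow_right₀ hat k).eq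
  -- Division with remainder: x times a power of t has degree m mod d, which would contradict
  -- minimality if positive.
  have hdvd : ∀ {x : Q} {m : ℤ} {g : RatFunc K}, g ≠ 0 → a * x = x * a → lead x m g →
      (d : ℤ) ∣ m := by
    intro x m g hg hax hx
    by_contra hnd
    have hd0' : (0 : ℤ) < d := by exact_mod_cast hd0
    have hpos : 0 < m % d := lt_of_le_of_ne (Int.emod_nonneg _ hd0'.ne')
      fun h' => hnd (Int.dvd_of_emod_eq_zero h'.symm)
    obtain ⟨g', hg', htk⟩ := h.zpow he ht (-(m / d))
    have hlead := h.mul hx htk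
    have hidx : m + -(m / d) * d = ((m % d).toNat : ℤ) := by
      rw [Int.toNat_of_nonneg hpos.le]
      have := Int.emod_add_mul_ediv m d
      linarith
    rw [hidx] at hlead
    have hlt : (m % d).toNat < d := by
      have := Int.emod_lt_of_pos m hd0'
      omega
    refine Nat.find_min hdeg hlt ⟨by omega, _, _, mul_ne_zero hg ?_, ?_, hlead⟩
    · simpa using hg'
    · rw [← mul_assoc, hax, mul_assoc, hatk, mul_assoc]
  have happrox : ∀ {x y : Q}, t * x = x * t → a * y = y * a → y * x = x * y := by
    intro x y htx hay
    by_contra hne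
    have hD : y * x - x * y ≠ 0 := sub_ne_zero.2 hne
    have hy0 : y ≠ 0 := by rintro rfl; simp at hne
    have hx0 : x ≠ 0 := by rintro rfl; simp at hne
    obtain ⟨n₀, f₀, hf₀, hn₀⟩ := h.exists_ne_zero hD
    obtain ⟨m, g, hg, hy⟩ := h.exists_ne_zero hy0
    obtain ⟨l, g₁, hg₁, hx⟩ := h.exists_ne_zero hx0
    -- The remainder r differs from y by a Laurent polynomial in t, which commutes with x, so the
    -- commutator with x is unchanged.
    have hN : ∀ N : ℕ, ∃ r f, a * r = r * a ∧ y * x - x * y = r * x - x * r ∧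
        lead r (m + N) f := by
      intro N
      induction N with
      | zero => exact ⟨y, g, hay, rfl, by simpa using hy⟩
      | succ N ih =>
        obtain ⟨r, f', har, hr, hlr⟩ := ih
        by_cases hf' : f' = 0
        · rw [hf'] at hlr
          obtain ⟨f'', hf''⟩ := h.exists_succ hlr
          exact ⟨r, f'', har, hr, by rwa [Nat.cast_succ, ← add_assoc]⟩
        · obtain ⟨k, hk⟩ := hdvd hf' har hlr
          obtain ⟨g', hg', htk⟩ := h.zpow he ht k
          rw [mul_comm k, ← hk] at htk
          obtain ⟨κ, hκ⟩ := h.exists_smul_eq hn hf hg' ha hlr htk har (hatk k)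
          have hsub := h.sub hlr (h.smul κ htk)
          rw [← hκ, sub_self] at hsub
          obtain ⟨f'', hf''⟩ := h.exists_succ hsub
          refine ⟨_, f'', ?_, ?_, by rwa [Nat.cast_succ, ← add_assoc]⟩
          · rw [mul_sub, sub_mul, har, mul_smul_comm, hatk, smul_mul_assoc]
          · rw [hr, sub_mul, mul_sub, smul_mul_assoc, mul_smul_comm,
              (Commute.zpow_left₀ htx k).eq]
            abel
    obtain ⟨r, f', har, hr, hlr⟩ := hN (n₀ + 1 - m - l).toNat
    have h1 := h.mul hlr hx
    have h2 := h.mul hx hlr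
    rw [add_comm] at h2
    have h3 := h.sub h1 h2
    rw [← hr] at h3
    have := h.le hf₀ hn₀ h3
    have := Int.self_le_toNat (n₀ + 1 - m - l)
    omega
  -- The inner use, with x = t, shows that c commutes with t; the outer use then applies to x = c
  -- and y = b.
  exact happrox (happrox rfl hac).symm hab

theorem commute_of_commute (h : IsLeadingTerm lead) {a b c : Q}
    (ha : ∀ κ : K, a ≠ algebraMap K Q κ) (hab : a * b = b * a) (hac : a * c = c * a) :
    b * c = c * b := by
  have ha0 : a ≠ 0 := fun h0 => ha 0 (by rw [h0, map_zero])
  obtain ⟨n, f, hf, hlead⟩ := h.exists_ne_zero ha0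
  by_cases hn : n = 0
  · subst hn
    by_cases hconst : ∃ κ : K, f = algebraMap K (RatFunc K) κ
    -- Replacing a by a - κ keeps its centralizer and removes the term of degree 0, so the degree
    -- becomes nonzero.
    · obtain ⟨κ, rfl⟩ := hconst
      have h1 := h.sub hlead (h.scalar κ)
      rw [sub_self] at h1
      obtain ⟨m, g, hg, hm⟩ := h.exists_ne_zero (sub_ne_zero.2 (ha κ))
      have hm0 : m ≠ 0 := by
        rintro rfl
        exact hg (h.unique hm h1)
      refine h.commute_of_commute_of_degree_ne_zero hm0 hg hm ?_ ?_
      · rw [sub_mul, mul_sub, hab, Algebra.commutes]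
      · rw [sub_mul, mul_sub, hac, Algebra.commutes]
    -- If x of degree m commutes with a then f is invariant under the shift by m, which forces m = 0
    -- because f is not constant.
    · have hdeg : ∀ {x : Q} {m : ℤ} {g : RatFunc K}, g ≠ 0 → a * x = x * a → lead x m g →
          m = 0 := by
        intro x m g hg hax hx
        by_contra hm
        have h1 := h.mul hlead hx
        have h2 := h.mul hx hlead
        rw [hax, zero_add] at h1
        rw [add_zero] at h2
        have h3 := h.unique h1 h2
        rw [ratShift_zero, mul_comm] at h3
        exact hconst (exists_eq_algebraMap_of_ratShift_eq hm (mul_left_cancel₀ hg h3).symm)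
      have hzero : ∀ {x : Q}, a * x = x * a → ∃ g, lead x 0 g := by
        intro x hax
        by_cases hx : x = 0
        · exact ⟨0, hx ▸ h.zero 0⟩
        · obtain ⟨m, g, hg, hm⟩ := h.exists_ne_zero hx
          obtain rfl := hdeg hg hax hm
          exact ⟨g, hm⟩
      obtain ⟨g, hb⟩ := hzero hab
      obtain ⟨e, hc⟩ := hzero hac
      by_contra hne
      obtain ⟨m, f', hf', hm⟩ := h.exists_ne_zero (sub_ne_zero.2 hne)
      have hcomm : a * (b * c - c * b) = (b * c - c * b) * a := by
        have h1 : a * (b * c) = b * c * a := by rw [← mul_assoc, hab, mul_assoc, hac, mul_assoc]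
        have h2 : a * (c * b) = c * b * a := by rw [← mul_assoc, hac, mul_assoc, hab, mul_assoc]
        rw [mul_sub, sub_mul, h1, h2]
      obtain rfl := hdeg hf' hcomm hm
      have h1 := h.sub (h.mul hb hc) (h.mul hc hb)
      rw [zero_add, ratShift_zero, ratShift_zero, mul_comm, sub_self] at h1
      exact hf' (h.unique hm h1)
  · exact h.commute_of_commute_of_degree_ne_zero hn hf hlead hab hac

end IsLeadingTerm

end CentralizersInDivisionRings

/-! ### Leading terms in the Weyl algebra -/

section WeylLeadingTerms

namespace WeylAlgebra

open Polynomial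

/-- The universal property of the Weyl algebra. -/
noncomputable def lift {K : Type u} [Field K] {B : Type v} [Ring B] [Algebra K B] (p q : B)
    (h : q * p - p * q = 1) : WeylAlgebra K →ₐ[K] B :=
  RingQuot.liftAlgHom K (s := WeylRel K)
    ⟨FreeAlgebra.lift K (fun g : WeylGen => match g with
        | .x => p
        | .d => q), by
      rintro _ _ ⟨⟩
      simpa using h⟩

theorem lift_x {K : Type u} [Field K] {B : Type v} [Ring B] [Algebra K B] (p q : B)
    (h : q * p - p * q = 1) : lift p q h (x K) = p := by
  refine (RingQuot.liftAlgHom_mkAlgHom_apply K _ _ _).trans ?_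
  simp

theorem lift_d {K : Type u} [Field K] {B : Type v} [Ring B] [Algebra K B] (p q : B)
    (h : q * p - p * q = 1) : lift p q h (d K) = q := by
  refine (RingQuot.liftAlgHom_mkAlgHom_apply K _ _ _).trans ?_
  simp

variable (K : Type u) [Field K]

/-- The operator `∑ vᵢ xⁱ ↦ f xⁿ ∑ vᵢ xⁱ` on formal sums with coefficients in `K(h)`. -/
noncomputable def termOp (n : ℤ) (f : RatFunc K) : Module.End K (ℤ → RatFunc K) where
  toFun v i := f * ratShift K n (v (i - n))
  map_add' v w := by
    ext1 i
    simp [mul_add]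
  map_smul' c v := by
    ext1 i
    simp

variable {K}

theorem termOp_apply (n : ℤ) (f : RatFunc K) (v : ℤ → RatFunc K) (i : ℤ) :
    termOp K n f v i = f * ratShift K n (v (i - n)) := rfl

theorem termOp_mul (m n : ℤ) (f g : RatFunc K) :
    termOp K m f * termOp K n g = termOp K (m + n) (f * ratShift K m g) := by
  refine LinearMap.ext fun v => funext fun i => ?_
  rw [Module.End.mul_apply, termOp_apply, termOp_apply, termOp_apply, map_mul, ← ratShift_add,
    sub_sub, mul_assoc]

theorem termOp_zero_one : termOp K 0 1 = 1 := by
  refine LinearMap.ext fun v => funext fun i => ?_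
  rw [termOp_apply, ratShift_zero, one_mul, sub_zero, Module.End.one_apply]

theorem termOp_sub (n : ℤ) (f g : RatFunc K) :
    termOp K n f - termOp K n g = termOp K n (f - g) := by
  refine LinearMap.ext fun v => funext fun i => ?_
  rw [LinearMap.sub_apply, Pi.sub_apply, termOp_apply, termOp_apply, termOp_apply, sub_mul]

theorem ratShift_X (n : ℤ) :
    ratShift K n (RatFunc.X : RatFunc K) = RatFunc.X - RatFunc.C (n : K) := by
  rw [← RatFunc.algebraMap_X, ratShift_algebraMap]
  simp

variable (K)

/-- The action of the Weyl algebra on formal sums `∑ vᵢ xⁱ` with coefficients in `K(h)`, where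
`h = x ∂`. -/
noncomputable def act : WeylAlgebra K →ₐ[K] Module.End K (ℤ → RatFunc K) :=
  -- The coefficient h + 1 makes x∂ act as multiplication by h, since the shift by 1 sends h + 1 to
  -- h.
  lift (termOp K 1 1) (termOp K (-1) (RatFunc.X + 1)) (by
    rw [termOp_mul, termOp_mul]
    simp only [neg_add_cancel, add_neg_cancel, map_one, map_add, one_mul, mul_one, ratShift_X]
    rw [termOp_sub, ← termOp_zero_one]
    congr 1
    simp)

theorem act_x : act K (x K) = termOp K 1 1 := lift_x _ _ _

theorem act_d : act K (d K) = termOp K (-1) (RatFunc.X + 1) := lift_d _ _ _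

theorem act_x_pow (i : ℕ) : act K (x K ^ i) = termOp K i 1 := by
  induction i with
  | zero => rw [pow_zero, map_one, Nat.cast_zero, termOp_zero_one]
  | succ i ih =>
    rw [pow_succ, map_mul, ih, act_x, termOp_mul, map_one, mul_one, Nat.cast_succ]

theorem exists_act_d_pow (i : ℕ) : ∃ f, act K (d K ^ i) = termOp K (-i) f := by
  induction i with
  | zero => exact ⟨1, by rw [pow_zero, map_one, Nat.cast_zero, neg_zero, termOp_zero_one]⟩
  | succ i ih =>
    obtain ⟨f, hf⟩ := ih
    exact ⟨_, by rw [pow_succ, map_mul, hf, act_d, termOp_mul, Nat.cast_succ, neg_add]⟩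

theorem exists_expansion (u : WeylAlgebra K) : ∃ F : ℤ →₀ RatFunc K,
    act K u = F.sum fun n f => termOp K n f := by
  have hadd : ∀ F G : ℤ →₀ RatFunc K, ((F + G).sum fun n f => termOp K n f) =
      (F.sum fun n f => termOp K n f) + G.sum fun n f => termOp K n f := fun F G => by
    refine Finsupp.sum_add_index' (fun n => ?_) (fun n f g => ?_)
    · refine LinearMap.ext fun v => funext fun i => ?_
      simp [termOp_apply]
    · refine LinearMap.ext fun v => funext fun i => ?_
      simp [termOp_apply, add_mul]
  have hzero : ∀ n, termOp K n 0 = 0 := fun n =>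
    LinearMap.ext fun v => funext fun i => by simp [termOp_apply]
  obtain ⟨n, hn⟩ := exists_mem_gens_pow K u
  have hu := gens_pow_le_box K n hn
  clear hn
  induction hu using Submodule.span_induction with
  | mem u hu =>
    obtain ⟨⟨i, j⟩, rfl⟩ := hu
    obtain ⟨f, hf⟩ := exists_act_d_pow K j
    refine ⟨Finsupp.single ((i : ℕ) - (j : ℕ)) (ratShift K (i : ℕ) f), ?_⟩
    rw [Finsupp.sum_single_index (hzero _), map_mul, act_x_pow, hf, termOp_mul, one_mul,
      sub_eq_add_neg]
  | zero => exact ⟨0, by simp⟩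
  | add u v _ _ hu hv =>
    obtain ⟨F, hF⟩ := hu
    obtain ⟨G, hG⟩ := hv
    exact ⟨F + G, by rw [hadd, map_add, hF, hG]⟩
  | smul c u _ hu =>
    obtain ⟨F, hF⟩ := hu
    refine ⟨F.mapRange (fun f => c • f) (smul_zero c), ?_⟩
    rw [Finsupp.sum_mapRange_index hzero, map_smul, hF, Finsupp.smul_sum]
    refine Finsupp.sum_congr fun n _ => LinearMap.ext fun v => funext fun i => ?_
    simp [termOp_apply]

variable {K}

/-- `u` has no term of degree less than `n`, and `f` is its coefficient in degree `n`. -/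
def HasLead (u : WeylAlgebra K) (n : ℤ) (f : RatFunc K) : Prop :=
  ∀ (v : ℤ → RatFunc K) (i : ℤ), (∀ j < i - n, v j = 0) →
    act K u v i = f * ratShift K n (v (i - n))

/-- The kernel is stable under u ↦ ux - xu. Repeated application to a nonzero element of the kernel
would give a nonzero polynomial in x, whose coefficients can be read off from its action on the unit
vector at 0. -/
theorem act_injective [CharZero K] : Function.Injective (act K) := by
  rw [injective_iff_map_eq_zero]
  intro u hu
  by_contra hne
  have hder : ∀ n, act K ((der K ^ n) u) = 0 := by
    intro n
    induction n with
    | zero => simpa using hu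
    | succ n ih => rw [pow_succ', Module.End.mul_apply, der_apply, map_sub, map_mul, map_mul, ih,
        zero_mul, mul_zero, sub_zero]
  obtain ⟨n, p, hp, hnp, -⟩ := exists_symbol K u hne
  have h1 := hder n
  rw [hnp] at h1
  refine hp (Polynomial.ext fun i => ?_)
  have h2 : act K (aeval (x K) p) = ∑ k ∈ Finset.range (p.natDegree + 1),
      termOp K k (algebraMap K (RatFunc K) (p.coeff k)) := by
    rw [aeval_eq_sum_range, map_sum]
    refine Finset.sum_congr rfl fun k _ => ?_
    rw [map_smul, act_x_pow]
    refine LinearMap.ext fun v => funext fun i => ?_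
    simp [termOp_apply, Algebra.smul_def]
  have h3 := congrFun (LinearMap.congr_fun (h2.symm.trans h1) (Pi.single 0 1)) i
  rw [LinearMap.sum_apply, Finset.sum_apply, LinearMap.zero_apply, Pi.zero_apply] at h3
  rw [Finset.sum_eq_single i] at h3
  · simpa [termOp_apply] using h3
  · intro k _ hk
    rw [termOp_apply, Pi.single_eq_of_ne (by omega), map_zero, mul_zero]
  · intro hi
    rw [coeff_eq_zero_of_natDegree_lt (by simpa using hi)]
    simp [termOp_apply]

theorem isLeadingTerm_hasLead [CharZero K] : IsLeadingTerm (HasLead (K := K)) where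
  zero n v i _ := by simp
  add {a b n f g} ha hb v i hv := by
    rw [map_add, LinearMap.add_apply, Pi.add_apply, ha v i hv, hb v i hv, add_mul]
  mul {a b m n f g} ha hb v i hv := by
    have hb' : ∀ j ≤ i - m, act K b v j = g * ratShift K n (v (j - n)) := fun j hj =>
      hb v j fun k hk => hv k (by omega)
    rw [map_mul, Module.End.mul_apply, ha, hb' _ le_rfl, map_mul, ← ratShift_add, sub_sub,
      mul_assoc]
    intro j hj
    rw [hb' j hj.le, hv _ (by omega), map_zero, mul_zero]
  scalar c v i _ := by
    rw [AlgHom.commutes, Module.algebraMap_end_apply, ratShift_zero, sub_zero, Pi.smul_apply,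
      Algebra.smul_def]
  of_lt {a m n f} ha hmn v i hv := by
    rw [ha v i fun j hj => hv j (by omega), hv _ (by omega), map_zero, mul_zero, zero_mul]
  unique {a n f g} hf hg := by
    -- The unit vector at 0 detects the coefficient in degree n.
    have key : ∀ {f}, HasLead a n f → act K a (Pi.single 0 (1 : RatFunc K)) n = f := fun {f} hf => by
      rw [hf _ _ fun j hj => Pi.single_eq_of_ne (M := fun _ : ℤ => RatFunc K)
        (show j ≠ 0 by omega) 1, sub_self, Pi.single_eq_same, map_one, mul_one]
    exact (key hf).symm.trans (key hg)
  exists_ne_zero {u} hu := by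
    obtain ⟨F, hF⟩ := exists_expansion K u
    have hF0 : F.support.Nonempty := by
      rw [Finsupp.support_nonempty_iff]
      rintro rfl
      exact hu ((injective_iff_map_eq_zero _).1 act_injective u (by simpa using hF))
    refine ⟨F.support.min' hF0, F (F.support.min' hF0),
      Finsupp.mem_support_iff.1 (Finset.min'_mem _ _), fun v i hv => ?_⟩
    rw [hF, Finsupp.sum, LinearMap.sum_apply, Finset.sum_apply,
      Finset.sum_eq_single_of_mem _ (Finset.min'_mem _ hF0)]
    · rfl
    · intro k hk hne
      have := Finset.min'_le _ _ hk
      rw [termOp_apply, hv _ (by omega), map_zero, mul_zero]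

theorem isNoncommutative (K : Type u) [Field K] : IsNoncommutative (WeylAlgebra K) :=
  ⟨d K, x K, fun h => one_ne_zero (α := WeylAlgebra K) (by simpa [h] using d_mul_x K)⟩

end WeylAlgebra

end WeylLeadingTerms

/-! ### Extension of leading terms to fractions -/

section LeadingTermsOfFractions

variable {K : Type u} [Field K]

/-- The extension of a notion of leading term to left fractions. -/
def FracLead {R Q : Type*} [Ring R] [Algebra K R] [DivisionRing Q] [Algebra K Q]
    (lead : R → ℤ → RatFunc K → Prop) (j : R →ₐ[K] Q) (q : Q) (n : ℤ) (f : RatFunc K) : Prop :=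
  ∃ s r m g, g ≠ 0 ∧ j s * q = j r ∧ lead s m g ∧ lead r (m + n) (g * ratShift K m f)

namespace IsLeadingTerm

variable {R Q : Type*} [Ring R] [Algebra K R] [DivisionRing Q] [Algebra K Q]
  {lead : R → ℤ → RatFunc K → Prop} {j : R →ₐ[K] Q}

theorem exists_ore (hj : Function.Injective j) (hfrac : ∀ q : Q, ∃ s r, s ≠ 0 ∧ j s * q = j r)
    (r : R) {s : R} (hs : s ≠ 0) : ∃ p p', p ≠ 0 ∧ p * r = p' * s := by
  obtain ⟨p, p', hp, h⟩ := hfrac (j r * (j s)⁻¹)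
  refine ⟨p, p', hp, hj ?_⟩
  have hs' : j s ≠ 0 := (map_ne_zero_iff j hj).2 hs
  rw [map_mul, map_mul, ← h, ← mul_assoc, mul_assoc, inv_mul_cancel₀ hs', mul_one]

/-- `FracLead` asks for one suitable fraction; this shows that every fraction representing q then
has the predicted numerator. A common left multiple of the two denominators compares the numerators,
and a leading term is cancelled. -/
theorem lead_num (h : IsLeadingTerm lead) (hj : Function.Injective j)
    (hfrac : ∀ q : Q, ∃ s r, s ≠ 0 ∧ j s * q = j r) {q : Q} {n : ℤ} {f : RatFunc K}
    (hq : FracLead lead j q n f) {s r : R} (hsr : j s * q = j r) {m : ℤ} {g : RatFunc K}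
    (hg : g ≠ 0) (hs : lead s m g) : lead r (m + n) (g * ratShift K m f) := by
  obtain ⟨s₁, r₁, m₁, g₁, hg₁, hsr₁, hs₁, hr₁⟩ := hq
  obtain ⟨p, p', hp, hpp⟩ := exists_ore hj hfrac s₁ (h.ne_zero hg hs)
  obtain ⟨a, e, he, hpe⟩ := h.exists_ne_zero hp
  have hne₁ : e * ratShift K a g₁ ≠ 0 := mul_ne_zero he (by simpa using hg₁)
  have hl₁ := h.mul hpe hs₁
  have hp' : p' ≠ 0 := by
    rintro rfl
    rw [hpp, zero_mul] at hl₁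
    exact h.ne_zero hne₁ hl₁ rfl
  obtain ⟨a', e', he', hpe'⟩ := h.exists_ne_zero hp'
  have hne : e' * ratShift K a' g ≠ 0 := mul_ne_zero he' (by simpa using hg)
  have hl := h.mul hpe' hs
  rw [← hpp] at hl
  have hdeg : a + m₁ = a' + m := le_antisymm (h.le hne hl hl₁) (h.le hne₁ hl₁ hl)
  rw [hdeg] at hl₁
  have hcoef := h.unique hl₁ hl
  have hnum : p * r₁ = p' * r := hj (by
    rw [map_mul, map_mul, ← hsr₁, ← hsr, ← mul_assoc, ← mul_assoc, ← map_mul, ← map_mul, hpp])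
  have hfin := h.mul hpe hr₁
  rw [hnum, map_mul, ← ratShift_add, ← mul_assoc, hcoef, ← add_assoc, hdeg] at hfin
  refine h.mul_left_cancel he' hpe' ?_
  rwa [map_mul, ← ratShift_add, ← mul_assoc, ← add_assoc]

/-- Leading terms extend to a division ring of fractions. -/
theorem fracLead (h : IsLeadingTerm lead) (hj : Function.Injective j)
    (hfrac : ∀ q : Q, ∃ s r, s ≠ 0 ∧ j s * q = j r) : IsLeadingTerm (FracLead lead j) := by
  have hone : lead 1 0 1 := by simpa using h.scalar 1
  refine ⟨fun n => ?_, fun {q q' n f f'} hq hq' => ?_, fun {q q' n n' f f'} hq hq' => ?_,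
    fun c => ?_, fun {q m n f} hq hmn => ?_, fun {q n f f'} hq hq' => ?_, fun {q} hq => ?_⟩
  · exact ⟨1, 0, 0, 1, one_ne_zero, by simp, hone, by simpa using h.zero n⟩
  · obtain ⟨s, r, m, g, hg, hsr, hs, hr⟩ := id hq
    obtain ⟨s', r', m', g', hg', hsr', hs', hr'⟩ := id hq'
    obtain ⟨p, p', hp, hpp⟩ := exists_ore hj hfrac s (h.ne_zero hg' hs')
    obtain ⟨a, e, he, hpe⟩ := h.exists_ne_zero hp
    have hne : e * ratShift K a g ≠ 0 := mul_ne_zero he (by simpa using hg)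
    have hl := h.mul hpe hs
    have h1 := h.lead_num hj hfrac hq (s := p * s) (r := p * r)
      (by rw [map_mul, map_mul, ← hsr, mul_assoc]) hne hl
    have h2 := h.lead_num hj hfrac hq' (s := p * s) (r := p' * r')
      (by rw [hpp, map_mul, map_mul, ← hsr', mul_assoc]) hne hl
    refine ⟨p * s, p * r + p' * r', _, _, hne, ?_, hl, ?_⟩
    · rw [mul_add, map_add]
      congr 1
      · rw [map_mul, map_mul, ← hsr, mul_assoc]
      · rw [hpp, map_mul, map_mul, ← hsr', mul_assoc]
    · rw [map_add, mul_add]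
      exact h.add h1 h2
  · obtain ⟨s, r, m, g, hg, hsr, hs, hr⟩ := hq
    obtain ⟨s', r', m', g', hg', hsr', hs', hr'⟩ := hq'
    obtain ⟨p, p', hp, hpp⟩ := exists_ore hj hfrac r (h.ne_zero hg' hs')
    obtain ⟨a, e, he, hpe⟩ := h.exists_ne_zero hp
    have hne : e * ratShift K a g ≠ 0 := mul_ne_zero he (by simpa using hg)
    have hl := h.mul hpe hs
    have hpr := h.mul hpe hr
    -- From p r = p' s', the leading term of p' follows by cancelling that of s' on the right; for
    -- this the coefficient of p r is rewritten as a multiple of the shifted g'.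
    have hg'' : ratShift K (a + (m + n) - m') g' ≠ 0 := by simpa using hg'
    rw [hpp, ← sub_add_cancel (a + (m + n)) m',
      ← div_mul_cancel₀ (e * ratShift K a (g * ratShift K m f)) hg''] at hpr
    have hp' := h.mul_right_cancel hg' hs' hpr
    have hfin := h.mul hp' hr'
    refine ⟨p * s, p' * r', _, _, hne, ?_, hl, ?_⟩
    · calc j (p * s) * (q * q') = j p * (j s * q) * q' := by simp only [map_mul, mul_assoc]
        _ = j (p * r) * q' := by rw [hsr, map_mul]
        _ = j p' * (j s' * q') := by rw [hpp, map_mul, mul_assoc]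
        _ = j (p' * r') := by rw [hsr', map_mul]
    · convert hfin using 1
      · ring
      · rw [map_mul (ratShift K (a + (m + n) - m')), ← mul_assoc, div_mul_cancel₀ _ hg'',
          ← ratShift_add, map_mul, map_mul, ← ratShift_add, ← ratShift_add, sub_add_cancel]
        simp only [mul_assoc, add_assoc]
  · exact ⟨1, algebraMap K R c, 0, 1, one_ne_zero, by simp, hone,
      by simpa [ratShift_zero] using h.scalar c⟩
  · obtain ⟨s, r, k, g, hg, hsr, hs, hr⟩ := hq
    refine ⟨s, r, k, g, hg, hsr, hs, ?_⟩
    rw [map_zero, mul_zero]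
    exact h.of_lt hr (by omega)
  · obtain ⟨s, r, k, g, hg, hsr, hs, hr⟩ := hq'
    have h1 := h.lead_num hj hfrac hq hsr hg hs
    exact (ratShift K k).injective (mul_left_cancel₀ hg (h.unique h1 hr))
  · obtain ⟨s, r, hs0, hsr⟩ := hfrac q
    have hr0 : r ≠ 0 := by
      rintro rfl
      rw [map_zero] at hsr
      exact mul_ne_zero ((map_ne_zero_iff j hj).2 hs0) hq hsr
    obtain ⟨m, g, hg, hs⟩ := h.exists_ne_zero hs0
    obtain ⟨k, e, he, hr⟩ := h.exists_ne_zero hr0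
    refine ⟨k - m, ratShift K (-m) (e / g), ?_, s, r, m, g, hg, hsr, hs, ?_⟩
    · simpa using ⟨he, hg⟩
    · rwa [← ratShift_add, add_neg_cancel, ratShift_zero, mul_div_cancel₀ _ hg, add_sub_cancel]

end IsLeadingTerm

end LeadingTermsOfFractions

/-! ### The commutative centralizer condition in the Weyl division ring -/

section WeylDivisionRing

namespace WeylDivisionRing

variable (K : Type u) [Field K] [CharZero K]

/-- The inclusion of the Weyl algebra in its ring of fractions. -/
noncomputable def ofWeyl : WeylAlgebra K →ₐ[K] WeylDivisionRing K :=
  { (OreLocalization.numeratorRingHom :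
      WeylAlgebra K →+* OreLocalization (WeylAlgebra K)⁰ (WeylAlgebra K)) with
    commutes' := fun _ => rfl }

theorem ofWeyl_injective : Function.Injective (ofWeyl K) :=
  OreLocalization.numeratorHom_inj (R := WeylAlgebra K) inf_le_left

theorem exists_fraction (q : WeylDivisionRing K) :
    ∃ s r, s ≠ 0 ∧ ofWeyl K s * q = ofWeyl K r := by
  induction q using OreLocalization.ind with
  | _ r s =>
    exact ⟨s, r, nonZeroDivisors.coe_ne_zero s,
      OreLocalization.mul_cancel (R := WeylAlgebra K) (s := s) (t := 1)⟩

theorem isLeadingTerm_fracLead :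
    IsLeadingTerm (FracLead WeylAlgebra.HasLead (ofWeyl K)) :=
  WeylAlgebra.isLeadingTerm_hasLead.fracLead (ofWeyl_injective K) (exists_fraction K)

variable {K}

theorem commCentralizerCondition_of_injective {A : Type v} [Ring A] [Algebra K A]
    (φ : A →ₐ[K] WeylDivisionRing K) (hφ : Function.Injective φ) (hA : IsNoncommutative A) :
    CommCentralizerCondition K A := by
  refine ⟨hA, fun a ha b hb c hc => hφ ?_⟩
  rw [mem_centralizer_singleton] at hb hc
  rw [map_mul, map_mul]
  refine (isLeadingTerm_fracLead K).commute_of_commute (a := φ a) (fun κ hκ => ha ?_) ?_ ?_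
  · rw [← φ.commutes] at hκ
    rw [hφ hκ]
    exact Subalgebra.algebraMap_mem _ κ
  · rw [← map_mul, hb, map_mul]
  · rw [← map_mul, hc, map_mul]

theorem isNoncommutative : IsNoncommutative (WeylDivisionRing K) := by
  obtain ⟨a, b, hab⟩ := WeylAlgebra.isNoncommutative K
  exact ⟨ofWeyl K a, ofWeyl K b, fun h => hab (ofWeyl_injective K (by simpa using h))⟩

end WeylDivisionRing

end WeylDivisionRing

/-! ### Absence of zero divisors after extension of scalars -/

section BaseChangeOfDomains

variable {K : Type u} [Field K]

theorem Algebra.TensorProduct.map_id_injective {L : Type*} [Field L] [Algebra K L] {A B : Type*}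
    [Ring A] [Algebra K A] [Ring B] [Algebra K B] (φ : A →ₐ[K] B) (hφ : Function.Injective φ) :
    Function.Injective (Algebra.TensorProduct.map (AlgHom.id K L) φ) :=
  Module.Flat.lTensor_preserves_injective_linearMap (M := L) φ.toLinearMap hφ

theorem noZeroDivisors_tensorProduct_of_injective {L : Type*} [Field L] [Algebra K L]
    {A B : Type*} [Ring A] [Algebra K A] [Ring B] [Algebra K B] [NoZeroDivisors (L ⊗[K] B)]
    (φ : A →ₐ[K] B) (hφ : Function.Injective φ) : NoZeroDivisors (L ⊗[K] A) :=
  (Algebra.TensorProduct.map_id_injective φ hφ).noZeroDivisors _ (map_zero _) (map_mul _)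

/-- Every tensor involves finitely many fractions, so the Ore condition gives it a common left
denominator in R. A vanishing product then becomes a vanishing product in L ⊗ R. -/
theorem noZeroDivisors_tensorProduct_of_fractions {L : Type*} [Field L] [Algebra K L]
    {R Q : Type*} [Ring R] [Algebra K R] [DivisionRing Q] [Algebra K Q]
    [NoZeroDivisors (L ⊗[K] R)] (j : R →ₐ[K] Q) (hj : Function.Injective j)
    (hfrac : ∀ q : Q, ∃ s r, s ≠ 0 ∧ j s * q = j r) : NoZeroDivisors (L ⊗[K] Q) := by
  set J := Algebra.TensorProduct.map (AlgHom.id K L) j with hJdef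
  have hJ : Function.Injective J := Algebra.TensorProduct.map_id_injective j hj
  have hJ1 : ∀ (l : L) (r : R), J (l ⊗ₜ r) = l ⊗ₜ j r := fun l r => by simp [hJdef]
  have hmul : ∀ q q' : Q, ((1 : L) ⊗ₜ[K] q) * (1 ⊗ₜ q') = 1 ⊗ₜ (q * q') := fun q q' => by
    rw [Algebra.TensorProduct.tmul_mul_tmul, one_mul]
  have hcancel : ∀ (q : Q) (z : L ⊗[K] Q), q ≠ 0 → ((1 : L) ⊗ₜ[K] q) * z = 0 → z = 0 := by
    intro q z hq hz
    have h1 := congrArg (((1 : L) ⊗ₜ[K] q⁻¹) * ·) hz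
    simpa [← mul_assoc, hmul, inv_mul_cancel₀ hq, ← Algebra.TensorProduct.one_def] using h1
  have hden : ∀ z : L ⊗[K] Q, ∃ s w, s ≠ 0 ∧ ((1 : L) ⊗ₜ[K] j s) * z = J w := by
    intro z
    induction z using TensorProduct.induction_on with
    | zero =>
      obtain ⟨s, r, hs, -⟩ := hfrac 0
      exact ⟨s, 0, hs, by rw [mul_zero, map_zero]⟩
    | tmul l q =>
      obtain ⟨s, r, hs, hsr⟩ := hfrac q
      refine ⟨s, l ⊗ₜ r, hs, ?_⟩
      rw [Algebra.TensorProduct.tmul_mul_tmul, one_mul, hsr, hJ1]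
    | add z z' hz hz' =>
      obtain ⟨s, w, hs, hsw⟩ := hz
      obtain ⟨s', w', hs', hsw'⟩ := hz'
      obtain ⟨p, p', hp, hpp⟩ := IsLeadingTerm.exists_ore hj hfrac s hs'
      refine ⟨p * s, (1 ⊗ₜ p) * w + (1 ⊗ₜ p') * w', fun h0 => ?_, ?_⟩
      · have h1 := congrArg j h0
        rw [map_mul, map_zero] at h1
        exact mul_ne_zero ((map_ne_zero_iff j hj).2 hp) ((map_ne_zero_iff j hj).2 hs) h1
      · rw [mul_add, map_add, map_mul J, map_mul J, hJ1, hJ1, ← hsw, ← hsw', ← mul_assoc,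
          ← mul_assoc, hmul, hmul, ← map_mul, ← map_mul, hpp]
  refine ⟨fun {z z'} hzz => ?_⟩
  obtain ⟨s', w', hs', hsw'⟩ := hden z'
  -- The inverse of the denominator of z' is absorbed into z, so that it cancels in the product w *
  -- w'.
  obtain ⟨s, w, hs, hsw⟩ := hden (z * (1 ⊗ₜ (j s')⁻¹))
  have hjs : j s ≠ 0 := (map_ne_zero_iff j hj).2 hs
  have hjs' : j s' ≠ 0 := (map_ne_zero_iff j hj).2 hs'
  have hww : w * w' = 0 := hJ (by
    rw [map_mul, map_zero, ← hsw, ← hsw', mul_assoc, mul_assoc, ← mul_assoc (1 ⊗ₜ (j s')⁻¹),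
      hmul, inv_mul_cancel₀ hjs', ← Algebra.TensorProduct.one_def, one_mul, hzz, mul_zero])
  rcases mul_eq_zero.1 hww with rfl | rfl
  · left
    rw [map_zero] at hsw
    have h1 := congrArg (· * ((1 : L) ⊗ₜ[K] j s')) (hcancel _ _ hjs hsw)
    simpa [mul_assoc, hmul, inv_mul_cancel₀ hjs', ← Algebra.TensorProduct.one_def] using h1
  · right
    rw [map_zero] at hsw'
    exact hcancel _ _ hjs' hsw'

namespace WeylAlgebra

theorem algHom_ext {B : Type*} [Ring B] [Algebra K B] {f g : WeylAlgebra K →ₐ[K] B}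
    (hx : f (x K) = g (x K)) (hd : f (d K) = g (d K)) : f = g := by
  have h : f.comp (mk K) = g.comp (mk K) := by
    refine FreeAlgebra.hom_ext (funext fun i => ?_)
    cases i
    · exact hx
    · exact hd
  exact AlgHom.cancel_right (RingQuot.mkAlgHom_surjective K (WeylRel K)) |>.1 h

/-- The universal properties give maps between L ⊗ A₁(K) and A₁(L). The one into A₁(L) has a left
inverse, and A₁(L) is a domain. -/
theorem noZeroDivisors_tensorProduct (L : Type u) [Field L] [Algebra K L] [CharZero L] :
    NoZeroDivisors (L ⊗[K] WeylAlgebra K) := by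
  let _ : Algebra K (WeylAlgebra L) := Algebra.compHom _ (algebraMap K L)
  have : IsScalarTower K L (WeylAlgebra L) := IsScalarTower.of_algebraMap_eq' rfl
  have h : d L * x L - x L * d L = 1 := by rw [d_mul_x, add_sub_cancel_left]
  have h' : d K * x K - x K * d K = 1 := by rw [d_mul_x, add_sub_cancel_left]
  let f : WeylAlgebra K →ₐ[K] WeylAlgebra L := lift (x L) (d L) h
  let φ : L ⊗[K] WeylAlgebra K →ₐ[L] WeylAlgebra L :=
    Algebra.TensorProduct.lift (Algebra.ofId L (WeylAlgebra L)) f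
      (fun l u => Algebra.commutes l (f u))
  let ψ : WeylAlgebra L →ₐ[L] L ⊗[K] WeylAlgebra K :=
    lift (1 ⊗ₜ x K) (1 ⊗ₜ d K) (by
      rw [Algebra.TensorProduct.tmul_mul_tmul, Algebra.TensorProduct.tmul_mul_tmul,
        ← TensorProduct.tmul_sub, h', one_mul, Algebra.TensorProduct.one_def])
  have hφ1 : ∀ u, φ (1 ⊗ₜ u) = f u := fun u => by
    refine (Algebra.TensorProduct.lift_tmul _ _ _ _ _).trans ?_
    rw [map_one, one_mul]
  have hψφ : ψ.comp φ = AlgHom.id L _ := by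
    refine Algebra.TensorProduct.ext (Subsingleton.elim _ _) (algHom_ext ?_ ?_)
    · exact (congrArg ψ ((hφ1 _).trans (lift_x _ _ _))).trans (lift_x _ _ _)
    · exact (congrArg ψ ((hφ1 _).trans (lift_d _ _ _))).trans (lift_d _ _ _)
  have hφ : Function.Injective φ :=
    Function.LeftInverse.injective (g := ψ) fun z => AlgHom.congr_fun hψφ z
  exact hφ.noZeroDivisors _ (map_zero _) (map_mul _)

end WeylAlgebra

theorem WeylDivisionRing.noZeroDivisors_tensorProduct [CharZero K] (L : Type u) [Field L]
    [Algebra K L] [CharZero L] : NoZeroDivisors (L ⊗[K] WeylDivisionRing K) := by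
  have := WeylAlgebra.noZeroDivisors_tensorProduct (K := K) L
  exact noZeroDivisors_tensorProduct_of_fractions (ofWeyl K) (ofWeyl_injective K) (exists_fraction K)

end BaseChangeOfDomains

/-! ### Normal forms and quadratic growth of A(a) -/

section KleinianDeformations

open Polynomial

theorem Polynomial.mul_aeval_of_mul {K A : Type*} [Field K] [Ring A] [Algebra K A] {u h h' : A}
    (huh : u * h = h' * u) (p : K[X]) : u * aeval h p = aeval h' p * u := by
  have hpow : ∀ n : ℕ, u * h ^ n = h' ^ n * u := fun n =>
    (SemiconjBy.pow_right (show SemiconjBy u h h' from huh) n).eq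
  rw [aeval_eq_sum_range, aeval_eq_sum_range, Finset.mul_sum, Finset.sum_mul]
  exact Finset.sum_congr rfl fun n _ => by rw [mul_smul_comm, hpow, smul_mul_assoc]

namespace KleinianDeformation

variable {K : Type u} [Field K] (a : K[X])

/-- The quotient map from the free algebra. -/
noncomputable def mk : FreeAlgebra K KleinianGen →ₐ[K] KleinianDeformation K a :=
  RingQuot.mkAlgHom K (KleinianRel K a)

/-- The generator `X`. -/
noncomputable def genX : KleinianDeformation K a := mk a (FreeAlgebra.ι K KleinianGen.X)

/-- The generator `Y`. -/
noncomputable def genY : KleinianDeformation K a := mk a (FreeAlgebra.ι K KleinianGen.Y)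

/-- The generator `H`. -/
noncomputable def genH : KleinianDeformation K a := mk a (FreeAlgebra.ι K KleinianGen.H)

theorem genX_mul_genH : genX a * genH a = (genH a - 1) * genX a := by
  have h : mk a _ = mk a _ := RingQuot.mkAlgHom_rel K (KleinianRel.XH (K := K) (a := a))
  simpa [genX, genH] using h

theorem genY_mul_genH : genY a * genH a = (genH a + 1) * genY a := by
  have h : mk a _ = mk a _ := RingQuot.mkAlgHom_rel K (KleinianRel.YH (K := K) (a := a))
  simpa [genY, genH] using h

theorem genY_mul_genX : genY a * genX a = aeval (genH a) a := by
  have h : mk a _ = mk a _ := RingQuot.mkAlgHom_rel K (KleinianRel.YX (K := K) (a := a))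
  rwa [map_mul, ← aeval_algHom_apply] at h

theorem genX_mul_genY : genX a * genY a = aeval (genH a - 1) a := by
  have h : mk a _ = mk a _ := RingQuot.mkAlgHom_rel K (KleinianRel.XY (K := K) (a := a))
  rwa [map_mul, ← aeval_algHom_apply, map_sub, map_one] at h

theorem genX_mul_aeval (p : K[X]) :
    genX a * aeval (genH a) p = aeval (genH a) (p.comp (X - C 1)) * genX a := by
  rw [mul_aeval_of_mul (genX_mul_genH a), aeval_comp]
  simp

theorem genY_mul_aeval (p : K[X]) :
    genY a * aeval (genH a) p = aeval (genH a) (p.comp (X + C 1)) * genY a := by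
  rw [mul_aeval_of_mul (genY_mul_genH a), aeval_comp]
  simp

/-- `Xⁿ` for `n ≥ 0` and `Y⁻ⁿ` for `n ≤ 0`. -/
noncomputable def base (n : ℤ) : KleinianDeformation K a := genX a ^ n.toNat * genY a ^ (-n).toNat

theorem base_natCast (n : ℕ) : base a n = genX a ^ n := by simp [base]

theorem base_neg_natCast (n : ℕ) : base a (-n) = genY a ^ n := by simp [base]

theorem exists_genX_mul_base (n : ℤ) :
    ∃ c : K[X], c.natDegree ≤ a.natDegree ∧ genX a * base a n = aeval (genH a) c * base a (n + 1) := by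
  obtain ⟨k, rfl | rfl⟩ := n.eq_nat_or_neg
  · refine ⟨1, by simp, ?_⟩
    rw [← Nat.cast_succ, base_natCast, base_natCast, map_one, one_mul, ← pow_succ']
  · rcases k with _ | k
    · refine ⟨1, by simp, ?_⟩
      simp [base]
    · refine ⟨a.comp (X - C 1), by rw [natDegree_comp, natDegree_X_sub_C, mul_one], ?_⟩
      rw [show -((k + 1 : ℕ) : ℤ) + 1 = -(k : ℤ) by push_cast; ring, base_neg_natCast,
        base_neg_natCast, pow_succ', ← mul_assoc, genX_mul_genY, aeval_comp]
      simp

theorem exists_genY_mul_base (n : ℤ) :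
    ∃ c : K[X], c.natDegree ≤ a.natDegree ∧ genY a * base a n = aeval (genH a) c * base a (n - 1) := by
  obtain ⟨k, rfl | rfl⟩ := n.eq_nat_or_neg
  · rcases k with _ | k
    · refine ⟨1, by simp, ?_⟩
      simp [base]
    · refine ⟨a, le_rfl, ?_⟩
      rw [show ((k + 1 : ℕ) : ℤ) - 1 = k by push_cast; ring, base_natCast,
        base_natCast, pow_succ', ← mul_assoc, genY_mul_genX]
  · refine ⟨1, by simp, ?_⟩
    rw [show -(k : ℤ) - 1 = -((k + 1 : ℕ) : ℤ) by push_cast; ring, base_neg_natCast,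
      base_neg_natCast, map_one, one_mul, ← pow_succ']

/-- The span of the elements `Hⁱ Xʲ` and `Hⁱ Yʲ` with `i ≤ (deg a + 1) n` and `j ≤ n`. -/
noncomputable def box (n : ℕ) : Submodule K (KleinianDeformation K a) :=
  Submodule.span K (Set.range fun ij : Fin ((a.natDegree + 1) * n + 1) × Fin (2 * n + 1) =>
    genH a ^ (ij.1 : ℕ) * base a ((ij.2 : ℕ) - n))

theorem mem_box {n : ℕ} {p : K[X]} (hp : p.natDegree ≤ (a.natDegree + 1) * n) {j : ℤ}
    (hj : -n ≤ j) (hj' : j ≤ n) : aeval (genH a) p * base a j ∈ box a n := by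
  rw [aeval_eq_sum_range, Finset.sum_mul]
  refine sum_mem fun i hi => ?_
  rw [smul_mul_assoc]
  refine Submodule.smul_mem _ _ (Submodule.subset_span
    ⟨(⟨i, by have := Finset.mem_range.1 hi; omega⟩, ⟨(j + n).toNat, by omega⟩), ?_⟩)
  simp only
  rw [Int.toNat_of_nonneg (by omega), add_sub_cancel_right]

theorem finrank_box_le (n : ℕ) :
    Module.finrank K (box a n) ≤ 2 * (a.natDegree + 1) * (n + 1) ^ 2 := by
  refine (finrank_range_le_card _).trans ?_
  simp only [Fintype.card_prod, Fintype.card_fin]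
  nlinarith [Nat.zero_le (a.natDegree * n)]

instance (n : ℕ) : Module.Finite K (box a n) :=
  Module.Finite.iff_fg.2 (Submodule.fg_span (Set.finite_range _))

/-- The span of `1, X, Y, H`. -/
noncomputable def gens : Submodule K (KleinianDeformation K a) :=
  Submodule.span K {1, genX a, genY a, genH a}

/-- Left multiplication by a generator moves the index j by at most one. It raises the degree in H
by at most max(1, deg a), where deg a comes from contracting XY or YX. -/
theorem gens_pow_le_box (n : ℕ) : gens a ^ n ≤ box a n := by
  induction n with
  | zero =>
    rw [pow_zero, Submodule.one_le]
    simpa [base] using mem_box a (n := 0) (p := 1) (by simp) (j := 0) (by simp) (by simp)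
  | succ n ih =>
    rw [pow_succ']
    refine (mul_le_mul' le_rfl ih).trans ?_
    rw [gens, box, Submodule.span_mul_span, Submodule.span_le]
    rintro _ ⟨g, hg, _, ⟨⟨⟨i, hi⟩, ⟨j, hj⟩⟩, rfl⟩, rfl⟩
    have hi' : i + a.natDegree + 1 ≤ (a.natDegree + 1) * (n + 1) := by
      rw [mul_add]; omega
    have hH : genH a ^ i = aeval (genH a) (X ^ i : K[X]) := by simp
    simp only [SetLike.mem_coe]
    rw [hH]
    rcases hg with rfl | rfl | rfl | rfl
    · rw [one_mul]
      exact mem_box a (by rw [natDegree_X_pow]; omega) (by push_cast; omega) (by push_cast; omega)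
    · obtain ⟨c, hc, hX⟩ := exists_genX_mul_base a ((j : ℤ) - n)
      rw [← mul_assoc, genX_mul_aeval, mul_assoc, hX, ← mul_assoc, ← map_mul]
      refine mem_box a (natDegree_mul_le.trans ?_) (by push_cast; omega) (by push_cast; omega)
      rw [natDegree_comp, natDegree_X_pow, natDegree_X_sub_C]
      omega
    · obtain ⟨c, hc, hY⟩ := exists_genY_mul_base a ((j : ℤ) - n)
      rw [← mul_assoc, genY_mul_aeval, mul_assoc, hY, ← mul_assoc, ← map_mul]
      refine mem_box a (natDegree_mul_le.trans ?_) (by push_cast; omega) (by push_cast; omega)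
      rw [natDegree_comp, natDegree_X_pow, natDegree_X_add_C]
      omega
    · rw [← mul_assoc, show genH a * aeval (genH a) (X ^ i : K[X]) =
        aeval (genH a) (X ^ (i + 1) : K[X]) by simp [pow_succ']]
      exact mem_box a (by rw [natDegree_X_pow]; omega) (by push_cast; omega) (by push_cast; omega)

theorem one_le_gens : 1 ≤ gens a := Submodule.one_le.2 (Submodule.subset_span (by simp))

theorem exists_mem_gens_pow (u : KleinianDeformation K a) : ∃ n, u ∈ gens a ^ n := by
  obtain ⟨f, rfl⟩ : ∃ f, mk a f = u := RingQuot.mkAlgHom_surjective K (KleinianRel K a) u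
  induction f using FreeAlgebra.induction with
  | grade0 r =>
    refine ⟨0, ?_⟩
    rw [AlgHom.commutes, pow_zero]
    exact Submodule.algebraMap_mem r
  | grade1 g =>
    refine ⟨1, ?_⟩
    rw [pow_one]
    cases g
    · exact Submodule.subset_span (by simp [genX])
    · exact Submodule.subset_span (by simp [genY])
    · exact Submodule.subset_span (by simp [genH])
  | mul a b ha hb =>
    obtain ⟨n, hn⟩ := ha
    obtain ⟨m, hm⟩ := hb
    exact ⟨n + m, by rw [map_mul, pow_add]; exact Submodule.mul_mem_mul hn hm⟩
  | add b c hb hc =>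
    obtain ⟨n, hn⟩ := hb
    obtain ⟨m, hm⟩ := hc
    exact ⟨max n m, by
      rw [map_add]
      exact add_mem (pow_le_pow_right₀ (one_le_gens a) (le_max_left _ _) hn)
        (pow_le_pow_right₀ (one_le_gens a) (le_max_right _ _) hm)⟩

theorem gkDim_le_two [Nontrivial (KleinianDeformation K a)] :
    gkDim K (KleinianDeformation K a) ≤ 2 := by
  refine _root_.gkDim_le_two (gens a) (one_le_gens a) (exists_mem_gens_pow a)
    (fun n => Submodule.finiteDimensional_of_le (gens_pow_le_box a n)) (2 * (a.natDegree + 1))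
    fun n => ?_
  exact (Submodule.finrank_mono (gens_pow_le_box a n)).trans (finrank_box_le a n)

theorem exists_expansion (u : KleinianDeformation K a) :
    ∃ F : ℤ →₀ K[X], u = F.sum fun n p => aeval (genH a) p * base a n := by
  obtain ⟨n, hn⟩ := exists_mem_gens_pow a u
  have hu := gens_pow_le_box a n hn
  clear hn
  induction hu using Submodule.span_induction with
  | mem u hu =>
    obtain ⟨⟨i, j⟩, rfl⟩ := hu
    refine ⟨Finsupp.single ((j : ℕ) - n) (X ^ (i : ℕ)), ?_⟩
    rw [Finsupp.sum_single_index (by simp)]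
    simp
  | zero => exact ⟨0, by simp⟩
  | add u v _ _ hu hv =>
    obtain ⟨F, hF⟩ := hu
    obtain ⟨G, hG⟩ := hv
    refine ⟨F + G, ?_⟩
    rw [Finsupp.sum_add_index' (by simp) (by simp [add_mul]), hF, hG]
  | smul c u _ hu =>
    obtain ⟨F, hF⟩ := hu
    refine ⟨F.mapRange (fun p => c • p) (smul_zero c), ?_⟩
    rw [Finsupp.sum_mapRange_index (by simp), hF, Finsupp.smul_sum]
    exact Finsupp.sum_congr fun n _ => by rw [map_smul, smul_mul_assoc]

end KleinianDeformation

end KleinianDeformations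

/-! ### Embedding A(a) in the Weyl division ring, and the conclusion -/

section Applications

open Polynomial

theorem IsLeadingTerm.sum {K : Type u} [Field K] {R : Type v} [Ring R] [Algebra K R]
    {lead : R → ℤ → RatFunc K → Prop} (h : IsLeadingTerm lead) {ι : Type*} (s : Finset ι)
    {n : ℤ} {b : ι → R} {f : ι → RatFunc K} (hb : ∀ i ∈ s, lead (b i) n (f i)) :
    lead (∑ i ∈ s, b i) n (∑ i ∈ s, f i) := by
  classical
  induction s using Finset.induction_on with
  | empty => simpa using h.zero n
  | insert i s hi ih =>
    rw [Finset.sum_insert hi, Finset.sum_insert hi]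
    exact h.add (hb i (by simp)) (ih fun k hk => hb k (by simp [hk]))

theorem IsLeadingTerm.aeval {K : Type u} [Field K] {R : Type v} [Ring R] [Algebra K R]
    {lead : R → ℤ → RatFunc K → Prop} (h : IsLeadingTerm lead) {b : R} (hb : lead b 0 RatFunc.X)
    (p : K[X]) : lead (Polynomial.aeval b p) 0 (algebraMap K[X] (RatFunc K) p) := by
  have hpow : ∀ n : ℕ, lead (b ^ n) 0 (RatFunc.X ^ n) := by
    intro n
    induction n with
    | zero => simpa using h.scalar 1
    | succ n ih =>
      have := h.mul ih hb
      rwa [ratShift_zero, zero_add, ← pow_succ, ← pow_succ] at this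
  have hp : algebraMap K[X] (RatFunc K) p =
      ∑ i ∈ Finset.range (p.natDegree + 1), algebraMap K (RatFunc K) (p.coeff i) * RatFunc.X ^ i := by
    conv_lhs => rw [p.as_sum_range_C_mul_X_pow]
    rw [map_sum]
    refine Finset.sum_congr rfl fun i _ => ?_
    rw [map_mul, map_pow, RatFunc.algebraMap_X]
    rfl
  rw [hp, aeval_eq_sum_range]
  exact h.sum _ fun i _ => h.smul _ (hpow i)

namespace WeylDivisionRing

variable {K : Type u} [Field K] [CharZero K]

theorem fracLead_ofWeyl {u : WeylAlgebra K} {n : ℤ} {f : RatFunc K}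
    (hu : WeylAlgebra.HasLead u n f) :
    FracLead WeylAlgebra.HasLead (ofWeyl K) (ofWeyl K u) n f :=
  ⟨1, u, 0, 1, one_ne_zero, by simp, by simpa using WeylAlgebra.isLeadingTerm_hasLead.scalar (1 : K),
    by simpa [ratShift_zero] using hu⟩

variable (K)

/-- The element `x` of the Weyl division ring. -/
noncomputable def x : WeylDivisionRing K := ofWeyl K (WeylAlgebra.x K)

/-- The element `h = x ∂` of the Weyl division ring. -/
noncomputable def h : WeylDivisionRing K := ofWeyl K (WeylAlgebra.x K * WeylAlgebra.d K)

theorem lead_x : FracLead WeylAlgebra.HasLead (ofWeyl K) (x K) 1 1 :=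
  fracLead_ofWeyl fun v i _ => by rw [WeylAlgebra.act_x, WeylAlgebra.termOp_apply]

theorem lead_h : FracLead WeylAlgebra.HasLead (ofWeyl K) (h K) 0 RatFunc.X :=
  fracLead_ofWeyl fun v i _ => by
    rw [map_mul, WeylAlgebra.act_x, WeylAlgebra.act_d, WeylAlgebra.termOp_mul,
      WeylAlgebra.termOp_apply]
    simp [WeylAlgebra.ratShift_X]

theorem x_ne_zero : x K ≠ 0 := (isLeadingTerm_fracLead K).ne_zero one_ne_zero (lead_x K)

theorem x_mul_h : x K * h K = (h K - 1) * x K := by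
  rw [x, h, ← map_one (ofWeyl K), ← map_sub, ← map_mul, ← map_mul, sub_mul, mul_assoc,
    WeylAlgebra.d_mul_x, mul_add, mul_one, one_mul, add_sub_cancel_right]

theorem inv_x_mul_h : (x K)⁻¹ * h K = (h K + 1) * (x K)⁻¹ := by
  rw [inv_mul_eq_iff_eq_mul₀ (x_ne_zero K), ← mul_assoc, mul_add, x_mul_h, sub_mul, mul_one,
    one_mul, sub_add_cancel, mul_assoc, mul_inv_cancel₀ (x_ne_zero K), mul_one]

end WeylDivisionRing

namespace KleinianDeformation

open WeylDivisionRing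

variable {K : Type u} [Field K] [CharZero K] (a : K[X])

/-- The homomorphism `X ↦ x`, `Y ↦ a(h) x⁻¹`, `H ↦ h` to the Weyl division ring. -/
noncomputable def toWeyl : KleinianDeformation K a →ₐ[K] WeylDivisionRing K :=
  RingQuot.liftAlgHom K (s := KleinianRel K a)
    ⟨FreeAlgebra.lift K (fun g : KleinianGen => match g with
        | .X => x K
        | .Y => aeval (h K) a * (x K)⁻¹
        | .H => h K), by
      rintro _ _ ⟨⟩
      · simpa using x_mul_h K
      · have hc : aeval (h K) a * (h K + 1) = (h K + 1) * aeval (h K) a := by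
          have h1 := congrArg (aeval (h K)) (mul_comm a (X + 1))
          rwa [map_mul, map_mul, map_add, aeval_X, map_one] at h1
        simp [mul_assoc, inv_x_mul_h]
        rw [← mul_assoc, hc, mul_assoc]
      · simp [← aeval_algHom_apply, x_ne_zero]
      · simp [← aeval_algHom_apply]
        rw [← mul_assoc, mul_aeval_of_mul (x_mul_h K), mul_assoc, mul_inv_cancel₀ (x_ne_zero K),
          mul_one]⟩

theorem toWeyl_genX : toWeyl a (genX a) = x K := by
  refine (RingQuot.liftAlgHom_mkAlgHom_apply K _ _ _).trans ?_
  simp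

theorem toWeyl_genY : toWeyl a (genY a) = aeval (h K) a * (x K)⁻¹ := by
  refine (RingQuot.liftAlgHom_mkAlgHom_apply K _ _ _).trans ?_
  simp

theorem toWeyl_genH : toWeyl a (genH a) = h K := by
  refine (RingQuot.liftAlgHom_mkAlgHom_apply K _ _ _).trans ?_
  simp

variable {a}

theorem exists_lead_toWeyl_base (ha : a ≠ 0) (n : ℤ) : ∃ f, f ≠ 0 ∧
    FracLead WeylAlgebra.HasLead (ofWeyl K) (toWeyl a (base a n)) n f := by
  have H := isLeadingTerm_fracLead K
  obtain ⟨k, rfl | rfl⟩ := n.eq_nat_or_neg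
  · obtain ⟨f, hf, hl⟩ := H.zpow one_ne_zero (lead_x K) k
    refine ⟨f, hf, ?_⟩
    rw [base_natCast, map_pow, toWeyl_genX]
    simpa using hl
  · obtain ⟨g, hg, hinv⟩ := H.inv one_ne_zero (lead_x K)
    have hy := H.mul (H.aeval (lead_h K) a) hinv
    have hne : algebraMap K[X] (RatFunc K) a * ratShift K 0 g ≠ 0 :=
      mul_ne_zero (RatFunc.algebraMap_ne_zero ha) (by simpa using hg)
    obtain ⟨f, hf, hl⟩ := H.zpow hne hy k
    refine ⟨f, hf, ?_⟩
    rw [base_neg_natCast, map_pow, toWeyl_genY]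
    simpa using hl

/-- The images of Xⁿ and Yⁿ have degrees n and -n with nonzero coefficients, and a polynomial in H
has degree-zero coefficient that same polynomial in h. So the term of least index in an expansion
cannot be cancelled. -/
theorem toWeyl_injective (ha : a ≠ 0) : Function.Injective (toWeyl a) := by
  have H := isLeadingTerm_fracLead K
  rw [injective_iff_map_eq_zero]
  intro u hu
  obtain ⟨F, rfl⟩ := exists_expansion a u
  by_contra hne
  have hF : F.support.Nonempty := by
    rw [Finsupp.support_nonempty_iff]
    rintro rfl
    simp at hne
  choose f hf hlead using exists_lead_toWeyl_base ha
  set n := F.support.min' hF with hn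
  have hnF : n ∈ F.support := Finset.min'_mem _ _
  have hterm : ∀ k ∈ F.support, FracLead WeylAlgebra.HasLead (ofWeyl K)
      (toWeyl a (Polynomial.aeval (genH a) (F k) * base a k)) n
      (if k = n then algebraMap K[X] (RatFunc K) (F n) * f n else 0) := by
    intro k hk
    have h1 := H.mul (H.aeval (lead_h K) (F k)) (hlead k)
    rw [zero_add, ratShift_zero, ← toWeyl_genH a, Polynomial.aeval_algHom_apply, ← map_mul] at h1
    split_ifs with hkn
    · exact hkn ▸ h1
    · exact H.of_lt h1 (lt_of_le_of_ne (Finset.min'_le _ _ hk) (Ne.symm hkn))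
  have hsum := H.sum F.support hterm
  rw [Finset.sum_ite_eq' F.support n, if_pos hnF, ← map_sum] at hsum
  exact H.ne_zero (mul_ne_zero (RatFunc.algebraMap_ne_zero (Finsupp.mem_support_iff.1 hnF)) (hf n))
    hsum hu

theorem isNoncommutative : IsNoncommutative (KleinianDeformation K a) := by
  refine ⟨genX a, genH a, fun hXH => x_ne_zero K ?_⟩
  rw [genX_mul_genH, sub_mul, one_mul, sub_eq_self] at hXH
  rw [← toWeyl_genX a, hXH, map_zero]

end KleinianDeformation

theorem WeylAlgebra.gkDim_le_two (K : Type u) [Field K] : gkDim K (WeylAlgebra K) ≤ 2 := by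
  refine _root_.gkDim_le_two (gens K) (Submodule.one_le.2 (Submodule.subset_span (by simp)))
    (exists_mem_gens_pow K) (fun n => Submodule.finiteDimensional_of_le (gens_pow_le_box K n)) 1
    fun n => ?_
  rw [one_mul]
  exact (Submodule.finrank_mono (gens_pow_le_box K n)).trans (finrank_box_le K n)

/-- An embedding in Q(A₁) provides both inputs, the ccc and the absence of zero divisors in K̄ ⊗ A;
the growth bound does the rest. -/
theorem centralizerConditions_of_injective {K : Type u} [Field K] [CharZero K] {A : Type u}
    [Ring A] [Algebra K A] (φ : A →ₐ[K] WeylDivisionRing K) (hφ : Function.Injective φ)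
    (hA : IsNoncommutative A) (hgk : gkDim K A < 3) :
    AdmitsDixmierPartition K A ∧ HomogCentralizerCondition K A ∧ CommCentralizerCondition K A := by
  have := WeylDivisionRing.noZeroDivisors_tensorProduct (K := K) (AlgebraicClosure K)
  have := noZeroDivisors_tensorProduct_of_injective (L := AlgebraicClosure K) φ hφ
  have hccc := WeylDivisionRing.commCentralizerCondition_of_injective φ hφ hA
  have hhcc := homogCentralizerCondition_of_gkDim_lt_three hgk hccc
  exact ⟨hhcc.2.1, hhcc, hccc⟩

end Applications

theorem mainTheorem8 (K : Type u) [Field K] [CharZero K] :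
    CommCentralizerCondition K (WeylDivisionRing K) ∧
    (AdmitsDixmierPartition K (WeylAlgebra K) ∧
      HomogCentralizerCondition K (WeylAlgebra K) ∧
      CommCentralizerCondition K (WeylAlgebra K)) ∧
    (∀ a : K[X], a ≠ 0 →
      AdmitsDixmierPartition K (KleinianDeformation K a) ∧
      HomogCentralizerCondition K (KleinianDeformation K a) ∧
      CommCentralizerCondition K (KleinianDeformation K a)) ∧
    (∀ A : Subalgebra K (WeylDivisionRing K), IsNoncommutative A → gkDim K A < 3 →
      AdmitsDixmierPartition K A ∧
      HomogCentralizerCondition K A ∧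
      CommCentralizerCondition K A) := by
  have h23 : (2 : EReal) < 3 := by exact_mod_cast (by norm_num : (2 : ℝ) < 3)
  refine ⟨?_, ?_, fun a ha => ?_, fun A hA hgk => ?_⟩
  · exact WeylDivisionRing.commCentralizerCondition_of_injective (AlgHom.id K _)
      Function.injective_id WeylDivisionRing.isNoncommutative
  · exact centralizerConditions_of_injective (WeylDivisionRing.ofWeyl K)
      (WeylDivisionRing.ofWeyl_injective K) (WeylAlgebra.isNoncommutative K)
      ((WeylAlgebra.gkDim_le_two K).trans_lt h23)
  · have hnc := KleinianDeformation.isNoncommutative (a := a)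
    have : Nontrivial (KleinianDeformation K a) := ⟨_, _, hnc.choose_spec.choose_spec⟩
    exact centralizerConditions_of_injective (KleinianDeformation.toWeyl a)
      (KleinianDeformation.toWeyl_injective ha) hnc
      ((KleinianDeformation.gkDim_le_two a).trans_lt h23)
  · exact centralizerConditions_of_injective A.val Subtype.val_injective hA hgk
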